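/- All manifolds are smooth, finite-dimensional, Hausdorff and second countable. A submanifold $S\hookrightarrow X$ is an injectively immersed manifold, and tangent spaces of $S$ are regarded as subspaces of those of $X$. \textbf{Definitions.} A contact manifold $(Q,\eta)$ is a manifold of dimension $2n+1$ with a $1$-form $\eta$ such that $\eta\wedge(d\eta)^n$ vanishes nowhere; put $\flat(v)=i_vd\eta+\eta(v)\eta$. A cocontact manifold $(M,\theta,\eta)$ is a manifold of dimension $2n+2$ with $1$-forms $\theta,\eta$ such that $d\theta=0$ and $\theta\wedge\eta\wedge(d\eta)^n$ vanishes nowhere; put $\flat(v)=\theta(v)\theta+i_vd\eta+\eta(v)\eta$. In both cases $\sharp=\flat^{-1}$, $\Lambda(\alpha,\beta)=-d\eta(\sharp\alpha,\sharp\beta)$, $\sharp_\Lambda(\alpha)=i_\alpha\Lambda$, and the $\Lambda$-orthogonal of a subspace $\Delta$ of a tangent space is $\Delta^{\perp_\Lambda}=\sharp_\Lambda(\Delta^0)$, where $\Delta^0$ is the annihilator of $\Delta$. A submanifold $L$ is Legendrian if $(TL)^{\perp_\Lambda}=TL$, and a submanifold $N$ is coisotropic if $(TN)^{\perp_\Lambda}\subseteq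 TN$. On a cocontact manifold let $\mathcal R_z=\sharp(\eta)$; a submanifold $N$ is $z$-vertical if $\mathcal R_z$ is tangent to $N$ at each point of $N$, and $t$-horizontal if $TN\subseteq\ker\theta$. Submanifolds $L,N$ of $M$ intersect cleanly if $L\cap N$ is a submanifold (of $M$, with smooth inclusions into $L$ and into $N$) and $T_q(L\cap N)=T_qL\cap T_qN$ for every $q\in L\cap N$. \textbf{Theorem.} Let $(M,\theta,\eta)$ be a cocontact manifold and let $i:N\hookrightarrow M$ be a nonempty coisotropic submanifold that is $z$-vertical and $t$-horizontal. Let $\mathcal F$ be the foliation of $N$ by the leaves (maximal connected integral manifolds) of the distribution $(TN)^{\perp_\Lambda}$. Suppose that the leaf space $N/\mathcal F$ has a manifold structure such that the canonical projection $\pi:N\to N/\mathcal F$ is a submersion. Then there is a unique $1$-form $\eta_N$ on $N/\mathcal F$ with $i^*\eta=\pi^*\eta_N$, and $(N/\mathcal F,\eta_N)$ is a contact manifold. Moreover, let $L\hookrightarrow M$ be a Legendrian submanifold that intersects $N$ cleanly, and suppose that $L_N=\pi(L\cap N)$ is a submanifold of $N/\mathcal F$. Then $L_N$ is a Legendrian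 submanifold of $(N/\mathcal F,\eta_N)$. -/

import Mathlib

open scoped Manifold ContDiff
open Bundle

noncomputable section

namespace CocontactReduction

/-! ### Linear algebra of forms on one vector space -/

section Linear

variable {V : Type*} [AddCommGroup V] [Module ℝ V]

/-- A linear functional regarded as an alternating `1`-form. -/
def toAlt (α : Module.Dual ℝ V) : V [⋀^Fin 1]→ₗ[ℝ] ℝ :=
  AlternatingMap.ofSubsingleton ℝ V ℝ (0 : Fin 1) α

/-- The wedge product of alternating forms (sum over shuffles). -/
def wedge {k l : ℕ} (a : V [⋀^Fin k]→ₗ[ℝ] ℝ) (b : V [⋀^Fin l]→ₗ[ℝ] ℝ) :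
    V [⋀^Fin (k + l)]→ₗ[ℝ] ℝ :=
  ((LinearMap.mul' ℝ ℝ).compAlternatingMap (a.domCoprod b)).domDomCongr finSumFinEquiv

/-- The wedge power `Ω ^ n = Ω ∧ ⋯ ∧ Ω` of a `2`-form. -/
def wedgePow (Ω : V [⋀^Fin 2]→ₗ[ℝ] ℝ) : (n : ℕ) → V [⋀^Fin (2 * n)]→ₗ[ℝ] ℝ
  | 0 => (AlternatingMap.constOfIsEmpty ℝ V (Fin 0) (1 : ℝ) : V [⋀^Fin 0]→ₗ[ℝ] ℝ)
  | n + 1 => (wedge (wedgePow Ω n) Ω : V [⋀^Fin (2 * n + 2)]→ₗ[ℝ] ℝ)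

/-- The contraction `v ↦ i_v Ω = Ω(v, ·)` of a `2`-form. -/
def contract (Ω : V [⋀^Fin 2]→ₗ[ℝ] ℝ) : V →ₗ[ℝ] Module.Dual ℝ V :=
  LinearMap.mk₂ ℝ (fun v w => Ω ![v, w])
    (fun v v' w => Ω.map_vecCons_add ![w] v v')
    (fun c v w => Ω.map_vecCons_smul ![w] c v)
    (fun v w w' => by
      have h : ∀ u : V, Function.update ![v, 0] 1 u = ![v, u] := fun u => by
        funext j; fin_cases j <;> rfl
      simpa only [h] using Ω.map_update_add ![v, 0] 1 w w')
    (fun c v w => by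
      have h : ∀ u : V, Function.update ![v, 0] 1 u = ![v, u] := fun u => by
        funext j; fin_cases j <;> rfl
      simpa only [h] using Ω.map_update_smul ![v, 0] 1 c w)

/-- `♭_η(v) = i_v Ω + η(v) η`, to be used with `Ω = dη`. -/
def contactFlat (η : Module.Dual ℝ V) (Ω : V [⋀^Fin 2]→ₗ[ℝ] ℝ) : V →ₗ[ℝ] Module.Dual ℝ V :=
  contract Ω + η.smulRight η

/-- `♭_{θ,η}(v) = θ(v) θ + i_v Ω + η(v) η`, to be used with `Ω = dη`. -/
def cocontactFlat (θ η : Module.Dual ℝ V) (Ω : V [⋀^Fin 2]→ₗ[ℝ] ℝ) :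
    V →ₗ[ℝ] Module.Dual ℝ V :=
  θ.smulRight θ + contract Ω + η.smulRight η

open Classical in
/-- The inverse `♯ = ♭⁻¹` of a linear isomorphism `♭` (and `0` if `♭` is not bijective). -/
def sharp (flat : V →ₗ[ℝ] Module.Dual ℝ V) : Module.Dual ℝ V →ₗ[ℝ] V :=
  if h : Function.Bijective flat then ((LinearEquiv.ofBijective flat h).symm).toLinearMap else 0

/-- The Jacobi bivector `Λ(α, β) = -Ω(♯α, ♯β)`, to be used with `Ω = dη`. -/
def bivector (flat : V →ₗ[ℝ] Module.Dual ℝ V) (Ω : V [⋀^Fin 2]→ₗ[ℝ] ℝ)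
    (α β : Module.Dual ℝ V) : ℝ :=
  -Ω ![sharp flat α, sharp flat β]

/-- The `Λ`-orthogonal `Δ^{⊥Λ} = ♯_Λ(Δ⁰)`, where `Δ⁰` is the annihilator of `Δ` and `♯_Λ(α)` is
the vector `w` with `β(w) = Λ(α, β)` for all covectors `β`. -/
def lambdaOrth (flat : V →ₗ[ℝ] Module.Dual ℝ V) (Ω : V [⋀^Fin 2]→ₗ[ℝ] ℝ)
    (Δ : Submodule ℝ V) : Submodule ℝ V where
  carrier := {w | ∃ α ∈ Δ.dualAnnihilator, ∀ β : Module.Dual ℝ V, β w = bivector flat Ω α β}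
  zero_mem' := ⟨0, Submodule.zero_mem _, fun β => by
    have h : contract Ω 0 (sharp flat β) = 0 := by simp
    have h' : Ω ![0, sharp flat β] = 0 := h
    simp [bivector, h']⟩
  add_mem' := by
    rintro w w' ⟨α, hα, h⟩ ⟨α', hα', h'⟩
    refine ⟨α + α', Submodule.add_mem _ hα hα', fun β => ?_⟩
    have e : contract Ω (sharp flat α + sharp flat α') (sharp flat β)
        = contract Ω (sharp flat α) (sharp flat β)
          + contract Ω (sharp flat α') (sharp flat β) := by simp
    have e' : Ω ![sharp flat α + sharp flat α', sharp flat β]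
        = Ω ![sharp flat α, sharp flat β] + Ω ![sharp flat α', sharp flat β] := e
    rw [map_add, h, h']
    simp only [bivector, map_add, e']
    ring
  smul_mem' := by
    rintro c w ⟨α, hα, h⟩
    refine ⟨c • α, Submodule.smul_mem _ c hα, fun β => ?_⟩
    have e : contract Ω (c • sharp flat α) (sharp flat β)
        = c * contract Ω (sharp flat α) (sharp flat β) := by simp
    have e' : Ω ![c • sharp flat α, sharp flat β]
        = c * Ω ![sharp flat α, sharp flat β] := e
    rw [map_smul, h]
    simp only [bivector, map_smul, e', smul_eq_mul]
    ring

end Linear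

/-! ### Smooth one-forms on manifolds and their exterior derivative -/

section Forms

variable {d : ℕ} {M : Type*} [TopologicalSpace M] [ChartedSpace (EuclideanSpace ℝ (Fin d)) M]
  [IsManifold (𝓡 d) ∞ M]

variable (d M) in
/-- Smooth `1`-forms on a `d`-dimensional manifold: smooth sections of the cotangent bundle. -/
abbrev OneForm : Type _ :=
  ContMDiffSection (𝓡 d) (EuclideanSpace ℝ (Fin d) →L[ℝ] ℝ) ∞
    (fun x : M => TangentSpace (𝓡 d) x →L[ℝ] ℝ)

/-- The value of a `1`-form at a point, as a linear functional on the tangent space. -/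
def OneForm.val (η : OneForm d M) (x : M) : Module.Dual ℝ (TangentSpace (𝓡 d) x) :=
  (η x).toLinearMap

/-- The expression `(φ⁻¹)^* η` of a `1`-form in the preferred chart `φ` at `x₀`, a form on (the
target of the chart in) Euclidean space. -/
def OneForm.inChart (η : OneForm d M) (x₀ : M) (y : EuclideanSpace ℝ (Fin d)) :
    EuclideanSpace ℝ (Fin d) [⋀^Fin 1]→L[ℝ] ℝ :=
  ContinuousAlternatingMap.ofSubsingleton ℝ (EuclideanSpace ℝ (Fin d)) ℝ (0 : Fin 1)
    ((η ((extChartAt (𝓡 d) x₀).symm y)).comp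
      (mfderiv 𝓘(ℝ, EuclideanSpace ℝ (Fin d)) (𝓡 d) (extChartAt (𝓡 d) x₀).symm y))

/-- The exterior derivative `dη = φ^* d((φ⁻¹)^* η)` at the point `x`, with `φ` the preferred chart
at `x`. -/
def OneForm.extD (η : OneForm d M) (x : M) : TangentSpace (𝓡 d) x [⋀^Fin 2]→ₗ[ℝ] ℝ :=
  (extDeriv (η.inChart x) (extChartAt (𝓡 d) x x)).toAlternatingMap.compLinearMap
    (mfderiv (𝓡 d) 𝓘(ℝ, EuclideanSpace ℝ (Fin d)) (extChartAt (𝓡 d) x) x).toLinearMap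

/-- `(M, η)` is a contact manifold: `dim M = 2n + 1` and `η ∧ (dη)^n` vanishes nowhere. -/
def IsContact (η : OneForm d M) : Prop :=
  ∃ n : ℕ, d = 2 * n + 1 ∧
    ∀ x : M, wedge (toAlt (η.val x)) (wedgePow (η.extD x) n) ≠ 0

/-- `(M, θ, η)` is a cocontact manifold: `dim M = 2n + 2`, `dθ = 0` and `θ ∧ η ∧ (dη)^n` vanishes
nowhere. -/
def IsCocontact (θ η : OneForm d M) : Prop :=
  ∃ n : ℕ, d = 2 * n + 2 ∧ (∀ x : M, θ.extD x = 0) ∧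
    ∀ x : M, wedge (toAlt (θ.val x)) (wedge (toAlt (η.val x)) (wedgePow (η.extD x) n)) ≠ 0

/-- The `Λ`-orthogonal of a subspace of a tangent space of a contact manifold. -/
def contactOrth (η : OneForm d M) (x : M) (Δ : Submodule ℝ (TangentSpace (𝓡 d) x)) :
    Submodule ℝ (TangentSpace (𝓡 d) x) :=
  lambdaOrth (contactFlat (η.val x) (η.extD x)) (η.extD x) Δ

/-- The `Λ`-orthogonal of a subspace of a tangent space of a cocontact manifold. -/
def cocontactOrth (θ η : OneForm d M) (x : M) (Δ : Submodule ℝ (TangentSpace (𝓡 d) x)) :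
    Submodule ℝ (TangentSpace (𝓡 d) x) :=
  lambdaOrth (cocontactFlat (θ.val x) (η.val x) (η.extD x)) (η.extD x) Δ

/-- The Reeb vector field `R_z = ♯_{θ,η}(η)` of a cocontact manifold. -/
def reebZ (θ η : OneForm d M) (x : M) : TangentSpace (𝓡 d) x :=
  sharp (cocontactFlat (θ.val x) (η.val x) (η.extD x)) (η.val x)

end Forms

/-! ### Submanifolds -/

section Submanifolds

/-- `j : S → M` presents `S` as an (immersed) submanifold of `M`: `j` is an injective smooth
immersion. -/
structure IsSubmanifold (s d : ℕ)
    {S : Type*} [TopologicalSpace S] [ChartedSpace (EuclideanSpace ℝ (Fin s)) S]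
    {M : Type*} [TopologicalSpace M] [ChartedSpace (EuclideanSpace ℝ (Fin d)) M]
    (j : S → M) : Prop where
  injective : Function.Injective j
  immersion : Manifold.IsImmersion (𝓡 s) (𝓡 d) ∞ j

/-- The tangent space of the submanifold `j : S → M` at the point `j x`, inside `T_{j x} M`. -/
def tangentRange (s d : ℕ)
    {S : Type*} [TopologicalSpace S] [ChartedSpace (EuclideanSpace ℝ (Fin s)) S]
    {M : Type*} [TopologicalSpace M] [ChartedSpace (EuclideanSpace ℝ (Fin d)) M]
    (j : S → M) (x : S) : Submodule ℝ (TangentSpace (𝓡 d) (j x)) :=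
  LinearMap.range (mfderiv (𝓡 s) (𝓡 d) j x).toLinearMap

/-- The map `j : S → N` presents `S` as a connected integral manifold of the distribution `D`. -/
structure IsIntegralManifold (s k : ℕ)
    {S : Type*} [TopologicalSpace S] [ChartedSpace (EuclideanSpace ℝ (Fin s)) S]
    {N : Type*} [TopologicalSpace N] [ChartedSpace (EuclideanSpace ℝ (Fin k)) N]
    (D : (x : N) → Submodule ℝ (TangentSpace (𝓡 k) x)) (j : S → N) : Prop where
  manifold : IsManifold (𝓡 s) ∞ S
  t2 : T2Space S
  secondCountable : SecondCountableTopology S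
  connected : ConnectedSpace S
  submanifold : IsSubmanifold s k j
  tangent : ∀ x : S, tangentRange s k j x = D (j x)

/-- `A` is a leaf of the distribution `D` on `N`: the point set of a maximal connected integral
manifold of `D`. -/
def IsLeaf.{u} (k : ℕ) {N : Type u} [TopologicalSpace N] [ChartedSpace (EuclideanSpace ℝ (Fin k)) N]
    (D : (x : N) → Submodule ℝ (TangentSpace (𝓡 k) x)) (A : Set N) : Prop :=
  (∃ (s : ℕ) (S : Type u) (_ : TopologicalSpace S)
      (_ : ChartedSpace (EuclideanSpace ℝ (Fin s)) S) (j : S → N),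
      IsIntegralManifold s k D j ∧ Set.range j = A) ∧
    ∀ (s : ℕ) (S : Type u) (_ : TopologicalSpace S)
      (_ : ChartedSpace (EuclideanSpace ℝ (Fin s)) S) (j : S → N),
      IsIntegralManifold s k D j → (Set.range j ∩ A).Nonempty → Set.range j ⊆ A

/-- `pr : N → Q` presents the manifold `Q` as the leaf space `N / F` of the distribution `D`, with a
manifold structure for which the canonical projection is a submersion: `pr` is a surjective
submersion, and two points have the same image exactly if they lie on a common leaf. -/
structure IsLeafSpaceProjection (k q : ℕ)
    {N : Type*} [TopologicalSpace N] [ChartedSpace (EuclideanSpace ℝ (Fin k)) N]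
    {Q : Type*} [TopologicalSpace Q] [ChartedSpace (EuclideanSpace ℝ (Fin q)) Q]
    (D : (x : N) → Submodule ℝ (TangentSpace (𝓡 k) x)) (pr : N → Q) : Prop where
  surjective : Function.Surjective pr
  submersion : Manifold.IsSubmersion (𝓡 k) (𝓡 q) ∞ pr
  eq_iff : ∀ x y : N, pr x = pr y ↔ ∃ A : Set N, IsLeaf k D A ∧ x ∈ A ∧ y ∈ A

/-- The submanifolds `l : L → M` and `i : N → M` intersect cleanly, and `a : K → L`, `b : K → N`
present `K` as the submanifold `L ∩ N`, with `T(L ∩ N) = TL ∩ TN` inside `TM`. -/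
structure IsCleanIntersection (m k e c : ℕ)
    {M : Type*} [TopologicalSpace M] [ChartedSpace (EuclideanSpace ℝ (Fin m)) M]
    {N : Type*} [TopologicalSpace N] [ChartedSpace (EuclideanSpace ℝ (Fin k)) N]
    {L : Type*} [TopologicalSpace L] [ChartedSpace (EuclideanSpace ℝ (Fin e)) L]
    {K : Type*} [TopologicalSpace K] [ChartedSpace (EuclideanSpace ℝ (Fin c)) K]
    (l : L → M) (i : N → M) (a : K → L) (b : K → N) : Prop where
  smooth_left : ContMDiff (𝓡 c) (𝓡 e) ∞ a
  smooth_right : ContMDiff (𝓡 c) (𝓡 k) ∞ b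
  comm : l ∘ a = i ∘ b
  submanifold : IsSubmanifold c m (l ∘ a)
  range_eq : Set.range (l ∘ a) = Set.range l ∩ Set.range i
  tangent_eq : Set.range (tangentMap (𝓡 c) (𝓡 m) (l ∘ a)) =
    Set.range (tangentMap (𝓡 e) (𝓡 m) l) ∩ Set.range (tangentMap (𝓡 k) (𝓡 m) i)

end Submanifolds

section CocontactSubmanifolds

variable {m : ℕ} {M : Type*} [TopologicalSpace M] [ChartedSpace (EuclideanSpace ℝ (Fin m)) M]
  [IsManifold (𝓡 m) ∞ M]

/-- `(TN)^{⊥Λ} ⊆ TN`. -/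
def IsCoisotropic (k : ℕ) {N : Type*} [TopologicalSpace N]
    [ChartedSpace (EuclideanSpace ℝ (Fin k)) N] (θ η : OneForm m M) (i : N → M) : Prop :=
  ∀ x : N, cocontactOrth θ η (i x) (tangentRange k m i x) ≤ tangentRange k m i x

/-- The submanifold `N` is `z`-vertical: the Reeb field `R_z` is tangent to `N`. -/
def IsZVertical (k : ℕ) {N : Type*} [TopologicalSpace N]
    [ChartedSpace (EuclideanSpace ℝ (Fin k)) N] (θ η : OneForm m M) (i : N → M) : Prop :=
  ∀ x : N, reebZ θ η (i x) ∈ tangentRange k m i x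

/-- The submanifold `N` is `t`-horizontal: `TN ⊆ H_t = ker θ`. -/
def IsTHorizontal (k : ℕ) {N : Type*} [TopologicalSpace N]
    [ChartedSpace (EuclideanSpace ℝ (Fin k)) N] (θ : OneForm m M) (i : N → M) : Prop :=
  ∀ x : N, tangentRange k m i x ≤ LinearMap.ker (θ.val (i x))

/-- The distribution `(TN)^{⊥Λ}` on `N` (as subspaces of the tangent spaces of `N`). -/
def orthDistribution (k : ℕ) {N : Type*} [TopologicalSpace N]
    [ChartedSpace (EuclideanSpace ℝ (Fin k)) N] (θ η : OneForm m M) (i : N → M) (x : N) :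
    Submodule ℝ (TangentSpace (𝓡 k) x) :=
  (cocontactOrth θ η (i x) (tangentRange k m i x)).comap
    (mfderiv (𝓡 k) (𝓡 m) i x).toLinearMap

/-- `(TL)^{⊥Λ} = TL` in a cocontact manifold. -/
def IsCocontactLegendrian (e : ℕ) {L : Type*} [TopologicalSpace L]
    [ChartedSpace (EuclideanSpace ℝ (Fin e)) L] (θ η : OneForm m M) (l : L → M) : Prop :=
  ∀ x : L, cocontactOrth θ η (l x) (tangentRange e m l x) = tangentRange e m l x

/-- `(TL)^{⊥Λ} = TL` in a contact manifold. -/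
def IsContactLegendrian (e : ℕ) {L : Type*} [TopologicalSpace L]
    [ChartedSpace (EuclideanSpace ℝ (Fin e)) L] (η : OneForm m M) (l : L → M) : Prop :=
  ∀ x : L, contactOrth η (l x) (tangentRange e m l x) = tangentRange e m l x

end CocontactSubmanifolds

/-- `i^* α = pr^* β` for maps `i : N → M`, `pr : N → Q` and `1`-forms `α` on `M`, `β` on `Q`. -/
def PullbacksAgree (k : ℕ) {m q : ℕ}
    {N : Type*} [TopologicalSpace N] [ChartedSpace (EuclideanSpace ℝ (Fin k)) N]
    {M : Type*} [TopologicalSpace M] [ChartedSpace (EuclideanSpace ℝ (Fin m)) M]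
    [IsManifold (𝓡 m) ∞ M]
    {Q : Type*} [TopologicalSpace Q] [ChartedSpace (EuclideanSpace ℝ (Fin q)) Q]
    [IsManifold (𝓡 q) ∞ Q]
    (i : N → M) (α : OneForm m M) (pr : N → Q) (β : OneForm q Q) : Prop :=
  ∀ (x : N) (v : TangentSpace (𝓡 k) x),
    α.val (i x) (mfderiv (𝓡 k) (𝓡 m) i x v) = β.val (pr x) (mfderiv (𝓡 k) (𝓡 q) pr x v)

end CocontactReduction

end

open CocontactReduction

open scoped Manifold ContDiff
open Bundle
noncomputable section
namespace CocontactReduction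

universe u

/-! ### Wedge products as permutation sums; a nonzero top form forces nondegeneracy. -/

section LinearAlgebra

open Equiv

variable {V : Type*} [AddCommGroup V] [Module ℝ V]

/-! Pointwise, the theorem is linear symplectic reduction. Let `W = T_xN` and `Ω = dη`. Since `R_z ∈
W ⊆ ker θ`, a vector of `W` lies in the `Λ`-orthogonal of `W` exactly when it is killed by `η` and
is `Ω`-orthogonal to `W` (`IsReebData.mem_lambdaOrth_of_reeb_mem`). Hence `η` and `Ω` descend to the
quotient of `W` by this kernel. There the image of `R_z` is a Reeb vector, and `Ω` is nondegenerate
on the kernel of the descended `η` (`IsReebData.quotient`). This nondegeneracy is equivalent to the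
wedge condition that defines contact structures, through symplectic bases.

Globally, the kernel of the differential of the projection is the distribution itself
(`IsLeafSpaceProjection.ker_mfderiv`). The form `i^*η` is basic: it and its differential are
annihilated by vertical vectors, so in submersion charts its coefficients do not depend on the fibre
variable. Leaves are connected, so one covector on the quotient works along a whole fibre. Local
sections make the descended form smooth and transfer `dη` to `dη_N`.

For a Legendrian `L`, the tangent space of `L` is Lagrangian in `ker θ ∩ ker η`, and the reduction
of a Lagrangian by a coisotropic subspace is Lagrangian. The key identity is `(X ∩ Y)^⊥ = X^⊥ + Y^⊥`
(`IsReebData.isLagrangian_quotient`). By cleanness, `f = pr ∘ b` on `L ∩ N` therefore has Lagrangian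
tangent images, so its rank is constant.

It remains to pass from `f` to the submanifold `p : P → Q` with the same point set, although no
smooth map between `L ∩ N` and `P` is given. The constant rank theorem and Baire's theorem show that
`p` factors smoothly through `f` near a dense set of points (`dense_setOf_range_mfderiv_le`). So
`p^*η_N` vanishes on a dense set, hence everywhere, and then so does `p^*dη_N`. Hausdorff dimension
and the dense set together give `dim P = rank f`. An isotropic subspace of half the dimension of
`ker η_N` is Lagrangian. -/

theorem contract_apply (Ω : V [⋀^Fin 2]→ₗ[ℝ] ℝ) (v w : V) : contract Ω v w = Ω ![v, w] := rfl

theorem contract_self (Ω : V [⋀^Fin 2]→ₗ[ℝ] ℝ) (v : V) : contract Ω v v = 0 :=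
  Ω.map_eq_zero_of_eq (i := 0) (j := 1) _ rfl (by decide)

theorem contract_isAlt (Ω : V [⋀^Fin 2]→ₗ[ℝ] ℝ) : (contract Ω).IsAlt := contract_self Ω

theorem contract_swap (Ω : V [⋀^Fin 2]→ₗ[ℝ] ℝ) (v w : V) : contract Ω w v = -contract Ω v w :=
  (LinearMap.IsAlt.neg (contract_isAlt Ω) v w).symm

theorem map_fin_two (Ω : V [⋀^Fin 2]→ₗ[ℝ] ℝ) (x : Fin 2 → V) : Ω x = contract Ω (x 0) (x 1) := by
  rw [contract_apply]
  congr 1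
  funext j; fin_cases j <;> rfl

theorem toAlt_apply (α : Module.Dual ℝ V) (x : Fin 1 → V) : toAlt α x = α (x 0) := rfl

/-- The wedge product as a normalized sum over all permutations. -/
theorem factorial_smul_wedge {k l : ℕ} (a : V [⋀^Fin k]→ₗ[ℝ] ℝ) (b : V [⋀^Fin l]→ₗ[ℝ] ℝ)
    (x : Fin (k + l) → V) :
    ((k.factorial * l.factorial : ℕ) : ℝ) * wedge a b x =
      ∑ σ : Perm (Fin k ⊕ Fin l), ((Perm.sign σ : ℤ) : ℝ) *
        (a (fun j => x (finSumFinEquiv (σ (Sum.inl j)))) *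
          b (fun j => x (finSumFinEquiv (σ (Sum.inr j))))) := by
  have h := MultilinearMap.domCoprod_alternization_eq a b
  have h2 := congrArg (fun F => LinearMap.mul' ℝ ℝ (F (fun j => x (finSumFinEquiv j)))) h
  simp only [MultilinearMap.alternatization_apply, map_sum, AlternatingMap.smul_apply,
    Fintype.card_fin, map_nsmul] at h2
  have h3 : wedge a b x = LinearMap.mul' ℝ ℝ ((a.domCoprod b) (fun j => x (finSumFinEquiv j))) := rfl
  rw [h3, ← nsmul_eq_mul, ← h2]
  refine Finset.sum_congr rfl fun σ _ => ?_
  rw [MultilinearMap.domDomCongr_apply, MultilinearMap.domCoprod_apply]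
  rcases Int.units_eq_one_or (Perm.sign σ) with h | h <;> simp [h]

theorem wedge_eq_zero_of_forall_perm {k l : ℕ} (a : V [⋀^Fin k]→ₗ[ℝ] ℝ) (b : V [⋀^Fin l]→ₗ[ℝ] ℝ)
    (x : Fin (k + l) → V)
    (h : ∀ σ : Fin k ⊕ Fin l ≃ Fin (k + l),
      a (fun j => x (σ (Sum.inl j))) = 0 ∨ b (fun j => x (σ (Sum.inr j))) = 0) :
    wedge a b x = 0 := by
  have h1 := factorial_smul_wedge a b x
  rw [Finset.sum_eq_zero fun σ _ => ?_] at h1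
  · exact (mul_eq_zero.1 h1).resolve_left
      (by exact_mod_cast (mul_pos k.factorial_pos l.factorial_pos).ne')
  · rcases h (σ.trans finSumFinEquiv) with h | h <;> simp only [Equiv.trans_apply] at h <;> simp [h]

/-- `a` vanishes on all tuples of vectors of `W` one of which is `v`. -/
def VanishesWith {k : ℕ} (W : Submodule ℝ V) (v : V) (a : V [⋀^Fin k]→ₗ[ℝ] ℝ) : Prop :=
  ∀ x : Fin k → V, (∀ j, x j ∈ W) → (∃ j, x j = v) → a x = 0

theorem VanishesWith.wedge {k l : ℕ} {W : Submodule ℝ V} {v : V}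
    {a : V [⋀^Fin k]→ₗ[ℝ] ℝ} {b : V [⋀^Fin l]→ₗ[ℝ] ℝ}
    (ha : VanishesWith W v a) (hb : VanishesWith W v b) : VanishesWith W v (wedge a b) := by
  rintro x hx ⟨j, hj⟩
  refine wedge_eq_zero_of_forall_perm a b x fun σ => ?_
  rcases h : σ.symm j with j' | j'
  · exact Or.inl (ha _ (fun _ => hx _) ⟨j', by rw [← h]; simpa⟩)
  · exact Or.inr (hb _ (fun _ => hx _) ⟨j', by rw [← h]; simpa⟩)

theorem VanishesWith.wedgePow {W : Submodule ℝ V} {v : V} {Ω : V [⋀^Fin 2]→ₗ[ℝ] ℝ}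
    (h : VanishesWith W v Ω) (n : ℕ) : VanishesWith W v (wedgePow Ω n) := by
  induction n with
  | zero => rintro x - ⟨j, -⟩; exact j.elim0
  | succ n ih => exact ih.wedge h

theorem vanishesWith_toAlt {W : Submodule ℝ V} {v : V} {η : Module.Dual ℝ V} (h : η v = 0) :
    VanishesWith W v (toAlt η) := by
  rintro x - ⟨j, hj⟩
  rw [toAlt_apply, ← Subsingleton.elim j 0, hj, h]

theorem vanishesWith_two {W : Submodule ℝ V} {v : V} {Ω : V [⋀^Fin 2]→ₗ[ℝ] ℝ}
    (h : ∀ w ∈ W, contract Ω v w = 0) : VanishesWith W v Ω := by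
  rintro x hx ⟨j, hj⟩
  rw [map_fin_two]
  fin_cases j
  · simp only [Fin.zero_eta] at hj
    rw [hj, h _ (hx _)]
  · simp only [Fin.mk_one] at hj
    rw [contract_swap, hj, h _ (hx _), neg_zero]

/-- If such a `v` were nonzero, evaluate the form on a basis consisting of a vector `T` transverse
to `ker θ` and a basis of `ker θ` containing `v`. In every term of the shuffle sum, either `θ`
receives a vector of `ker θ`, or `η ∧ Ωⁿ` receives `v` together with vectors of `ker θ`. -/
theorem ker_nondegenerate_of_wedge_ne_zero [FiniteDimensional ℝ V] {n : ℕ}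
    (hd : Module.finrank ℝ V = 2 * n + 2) {θ η : Module.Dual ℝ V} {Ω : V [⋀^Fin 2]→ₗ[ℝ] ℝ}
    (hw : wedge (toAlt θ) (wedge (toAlt η) (wedgePow Ω n)) ≠ 0) {v : V}
    (hθ : θ v = 0) (hη : η v = 0) (hΩ : ∀ w, θ w = 0 → contract Ω v w = 0) : v = 0 := by
  by_contra hv
  obtain ⟨T, hT⟩ : ∃ T, θ T ≠ 0 := by
    by_contra! h
    refine hw (AlternatingMap.ext fun x => wedge_eq_zero_of_forall_perm _ _ x fun σ => Or.inl ?_)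
    rw [toAlt_apply, h]
  set W := LinearMap.ker θ with hW
  have hμ : VanishesWith W v (wedge (toAlt η) (wedgePow Ω n)) :=
    (vanishesWith_toAlt hη).wedge ((vanishesWith_two fun w hw => hΩ w hw).wedgePow n)
  let v' : W := ⟨v, hθ⟩
  have hli : LinearIndepOn ℝ id ({v'} : Set W) := by
    refine LinearIndepOn.singleton (by simpa [v', Subtype.ext_iff] using hv)
  let b := Module.Basis.extend hli
  have hvb : v' ∈ hli.extend (Set.subset_univ _) :=
    hli.subset_extend _ (Set.mem_singleton _)
  let ι := hli.extend (Set.subset_univ ({v'} : Set W))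
  -- The index `none` carries the transverse vector `T`; the others carry the basis of `ker θ` that
  -- extends `v`.
  let y : Option ι → V := fun o => o.elim T fun i => (b i : V)
  have hy : LinearIndependent ℝ y := by
    rw [linearIndependent_option]
    refine ⟨(b.linearIndependent.map' W.subtype W.ker_subtype :), fun hmem => hT ?_⟩
    have : Submodule.span ℝ (Set.range (y ∘ ((↑) : ι → Option ι))) ≤ W := by
      rw [Submodule.span_le]
      rintro _ ⟨i, rfl⟩
      exact (b i).2
    exact this hmem
  have : Fintype ι := FiniteDimensional.fintypeBasisIndex b
  have hcard : Fintype.card (Option ι) = Module.finrank ℝ V := by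
    rw [Fintype.card_option, ← Module.finrank_eq_card_basis b]
    have h1 := LinearMap.finrank_range_add_finrank_ker θ
    rw [LinearMap.range_eq_top.2 (LinearMap.surjective fun h => hT (by simp [h])), finrank_top,
      Module.finrank_self] at h1
    change 1 + Module.finrank ℝ W = _ at h1
    omega
  let B := basisOfLinearIndependentOfCardEqFinrank hy hcard
  have e : Fin (1 + (1 + 2 * n)) ≃ Option ι :=
    (Fintype.equivFinOfCardEq (by rw [hcard, hd]; ring)).symm
  let B' := B.reindex e.symm
  have hB' : ∀ j, B' j = y (e j) := fun j => by simp [B', B]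
  apply hw
  refine Module.Basis.ext_alternating B' fun s hs => ?_
  rw [AlternatingMap.zero_apply]
  refine wedge_eq_zero_of_forall_perm _ _ _ fun σ => ?_
  rw [toAlt_apply]
  -- The question is whether the slot of `θ` is filled by `T`. If it is, all vectors of `ker θ`, and
  -- `v` among them, go to the other factor.
  by_cases h0 : e (s (σ (Sum.inl 0))) = none
  · right
    have hs' : Function.Bijective s := (Finite.injective_iff_bijective).1 hs
    have hne : ∀ j, ∃ i, e (s (σ (Sum.inr j))) = some i := fun j => by
      rw [← Option.ne_none_iff_exists']
      intro h
      have := σ.injective (hs (e.injective (h0.trans h.symm)))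
      simp at this
    refine hμ _ (fun j => ?_) ?_
    · obtain ⟨i, hi⟩ := hne j
      rw [hB', hi]
      exact (b i).2
    · obtain ⟨j0, hj0⟩ := hs'.2 (e.symm (some ⟨v', hvb⟩))
      obtain ⟨j1, hj1⟩ := σ.surjective j0
      rcases j1 with j1 | j1
      · exfalso
        rw [Subsingleton.elim j1 0] at hj1
        rw [hj1, hj0] at h0
        simp at h0
      · refine ⟨j1, ?_⟩
        rw [hj1, hj0, hB']
        simp [y, b, v', Module.Basis.extend_apply_self]
  · left
    obtain ⟨i, hi⟩ := Option.ne_none_iff_exists'.1 h0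
    rw [hB', hi]
    exact (b i).2

end LinearAlgebra

/-! ### Symplectic bases; nondegeneracy makes the top form nonzero. -/

section Symplectic

open Equiv

variable {V : Type*} [AddCommGroup V] [Module ℝ V]

theorem isAlt_swap {B : LinearMap.BilinForm ℝ V} (hB : B.IsAlt) (v w : V) : B v w = -B w v :=
  (LinearMap.IsAlt.neg hB w v).symm

/-- The product `∏ᵢ B(x(i,0), x(i,1))` for a family indexed by `Fin n × Fin 2`. -/
def pairProd (B : LinearMap.BilinForm ℝ V) {n : ℕ} (x : Fin n × Fin 2 → V) : ℝ :=
  ∏ i, B (x (i, 0)) (x (i, 1))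

/-- The alternating sum of `pairProd` over all rearrangements. -/
def pairSum (B : LinearMap.BilinForm ℝ V) {n : ℕ} (x : Fin n × Fin 2 → V) : ℝ :=
  ∑ σ : Perm (Fin n × Fin 2), ((Perm.sign σ : ℤ) : ℝ) * pairProd B (x ∘ σ)

/-- Appending one more pair of indices. -/
def pairSuccEquiv (n : ℕ) : (Fin n × Fin 2) ⊕ Fin 2 ≃ Fin (n + 1) × Fin 2 :=
  ((Equiv.sumCongr (Equiv.refl _) (Equiv.uniqueProd (Fin 2) (Fin 1)).symm).trans
    (Equiv.sumProdDistrib (Fin n) (Fin 1) (Fin 2)).symm).trans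
    (Equiv.prodCongr finSumFinEquiv (Equiv.refl _))

theorem pairSuccEquiv_inl (n : ℕ) (i : Fin n) (b : Fin 2) :
    pairSuccEquiv n (Sum.inl (i, b)) = (i.castSucc, b) := rfl

theorem pairSuccEquiv_inr (n : ℕ) (b : Fin 2) :
    pairSuccEquiv n (Sum.inr b) = (Fin.last n, b) := rfl

theorem pairProd_succ (B : LinearMap.BilinForm ℝ V) {n : ℕ} (x : Fin (n + 1) × Fin 2 → V) :
    pairProd B x = pairProd B (fun j => x (pairSuccEquiv n (Sum.inl j))) *
      B (x (pairSuccEquiv n (Sum.inr 0))) (x (pairSuccEquiv n (Sum.inr 1))) := by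
  simp only [pairProd, pairSuccEquiv_inl, pairSuccEquiv_inr]
  exact Fin.prod_univ_castSucc _

/-- Only the non-vanishing of a power of `Ω` is needed, so its value is computed up to a nonzero
constant and a reindexing of the slots. -/
theorem exists_wedgePow_eq_pairSum (Ω : V [⋀^Fin 2]→ₗ[ℝ] ℝ) (n : ℕ) :
    ∃ (c : ℝ) (e : Fin n × Fin 2 ≃ Fin (2 * n)), c ≠ 0 ∧
      ∀ x : Fin (2 * n) → V, c * wedgePow Ω n x = pairSum (contract Ω) (x ∘ e) := by
  induction n with
  | zero =>
    refine ⟨1, Equiv.equivOfIsEmpty (Fin 0 × Fin 2) (Fin 0), one_ne_zero, fun x => ?_⟩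
    have h1 : wedgePow Ω 0 x = 1 := rfl
    simp [pairSum, pairProd, h1]
  | succ n ih =>
    obtain ⟨c, e, hc, h⟩ := ih
    let E : (Fin n × Fin 2) ⊕ Fin 2 ≃ Fin (2 * n + 2) :=
      (Equiv.sumCongr e (Equiv.refl _)).trans finSumFinEquiv
    let e' : Fin (n + 1) × Fin 2 ≃ Fin (2 * n + 2) := (pairSuccEquiv n).symm.trans E
    -- The factor `(2n)! · 2!` normalizes the wedge product. The division by `(2n)!` compensates for
    -- the inner sum over permutations, which repeats the outer sum that many times.
    refine ⟨c * ((2 * n).factorial * (2).factorial : ℕ) / (Nat.factorial (2 * n) : ℕ), e',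
      div_ne_zero (mul_ne_zero hc ?_) ?_, fun x => ?_⟩
    · exact_mod_cast (mul_pos (2 * n).factorial_pos (2).factorial_pos).ne'
    · exact_mod_cast (2 * n).factorial_pos.ne'
    have hf := factorial_smul_wedge (wedgePow Ω n) Ω x
    have hne : ((Nat.factorial (2 * n) : ℕ) : ℝ) ≠ 0 := by exact_mod_cast (2 * n).factorial_pos.ne'
    change _ * wedge (wedgePow Ω n) Ω x = _
    rw [div_mul_eq_mul_div, div_eq_iff hne, mul_assoc, hf, Finset.mul_sum]
    let G : Perm (Fin (2 * n) ⊕ Fin 2) → ℝ := fun ρ => ((Perm.sign ρ : ℤ) : ℝ) *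
      (pairProd (contract Ω) (fun j => x (finSumFinEquiv (ρ (Sum.inl (e j))))) *
        Ω (fun j => x (finSumFinEquiv (ρ (Sum.inr j)))))
    have key : ∀ ρ : Perm (Fin (2 * n) ⊕ Fin 2),
        c * (((Perm.sign ρ : ℤ) : ℝ) * (wedgePow Ω n (fun j => x (finSumFinEquiv (ρ (Sum.inl j)))) *
          Ω (fun j => x (finSumFinEquiv (ρ (Sum.inr j))))))
        = ∑ τ : Perm (Fin n × Fin 2), G (ρ * Perm.sumCongr (e.permCongr τ) 1) := by
      intro ρ
      have : ∀ A B C : ℝ, c * (A * (B * C)) = A * C * (c * B) := fun A B C => by ring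
      rw [this, h, pairSum, Finset.mul_sum]
      refine Finset.sum_congr rfl fun τ _ => ?_
      simp only [G, Perm.sign_mul, Perm.sign_sumCongr, Perm.sign_permCongr, Perm.mul_apply,
        Perm.sumCongr_apply, Sum.map_inl, Sum.map_inr, Equiv.permCongr_apply,
        Equiv.symm_apply_apply, Perm.sign_one, Perm.one_apply, Function.comp_def]
      push_cast
      ring
    rw [Finset.sum_congr rfl fun ρ _ => key ρ, Finset.sum_comm]
    -- Right translation absorbs each inner permutation `τ` into the outer sum, so the inner sum
    -- only contributes the number of `τ`.
    have hG : ∀ τ : Perm (Fin n × Fin 2),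
        ∑ ρ, G (ρ * Perm.sumCongr (e.permCongr τ) 1) = ∑ ρ, G ρ := fun τ =>
      Equiv.sum_comp (Equiv.mulRight (Perm.sumCongr (e.permCongr τ) 1)) G
    rw [Finset.sum_congr rfl fun τ _ => hG τ, Finset.sum_const, Finset.card_univ,
      Fintype.card_perm, nsmul_eq_mul, mul_comm]
    have hcard : Fintype.card (Fin n × Fin 2) = 2 * n := by simp [mul_comm]
    rw [hcard]
    congr 1
    rw [pairSum]
    let F : Fin (2 * n) ⊕ Fin 2 ≃ Fin (n + 1) × Fin 2 :=
      finSumFinEquiv.trans e'.symm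
    refine Fintype.sum_equiv F.permCongr _ _ fun ρ => ?_
    have hF : ∀ z, e' (F z) = finSumFinEquiv z := fun z => by simp [F]
    have hF' : ∀ j, F.symm (pairSuccEquiv n (Sum.inl j)) = Sum.inl (e j) := fun j => by
      rw [Equiv.symm_apply_eq]; simp [F, e', E]
    have hF2 : ∀ j, F.symm (pairSuccEquiv n (Sum.inr j)) = Sum.inr j := fun j => by
      rw [Equiv.symm_apply_eq]; simp [F, e', E]
    rw [Perm.sign_permCongr, pairProd_succ]
    simp only [Function.comp_apply, Equiv.permCongr_apply, hF, hF', hF2, G]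
    rw [map_fin_two]

/-- A family of pairs of vectors that are dual to each other with respect to `B`. -/
structure IsSymplecticFamily (B : LinearMap.BilinForm ℝ V) {n : ℕ} (x : Fin n × Fin 2 → V) :
    Prop where
  pair : ∀ i, B (x (i, 0)) (x (i, 1)) = 1
  ne : ∀ i j b c, i ≠ j → B (x (i, b)) (x (j, c)) = 0

/-- No cancellation occurs. A permutation with nonzero product permutes the pairs and possibly flips
the two members of each pair. The sign of the pair permutation enters twice and cancels, and each
flip changes both the sign of the permutation and one factor of the product. -/
theorem IsSymplecticFamily.pairSum_pos {B : LinearMap.BilinForm ℝ V} (hB : B.IsAlt) {n : ℕ}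
    {x : Fin n × Fin 2 → V} (hx : IsSymplecticFamily B x) : 0 < pairSum B x := by
  have hpair : ∀ i b c, B (x (i, b)) (x (i, c)) ≠ 0 → b ≠ c := by
    rintro i b c h rfl
    exact h (hB _)
  have hnonneg : ∀ σ : Perm (Fin n × Fin 2),
      0 ≤ ((Perm.sign σ : ℤ) : ℝ) * pairProd B (x ∘ σ) := by
    intro σ
    by_cases h0 : pairProd B (x ∘ σ) = 0
    · simp [h0]
    simp only [pairProd, Finset.prod_eq_zero_iff, Finset.mem_univ, true_and, not_exists,
      Function.comp_apply] at h0
    have h1 : ∀ i, (σ (i, 0)).1 = (σ (i, 1)).1 := fun i => by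
      by_contra hne
      exact h0 i (hx.ne _ _ _ _ hne)
    have h2 : ∀ i, (σ (i, 0)).2 ≠ (σ (i, 1)).2 := fun i => by
      refine hpair (σ (i, 0)).1 _ _ ?_
      nth_rw 2 [h1]
      exact h0 i
    let pm : Fin n → Fin n := fun i => (σ (i, 0)).1
    -- This is the identity when the pair is not flipped, because `swap 0 0 = 1`.
    let s : Fin n → Perm (Fin 2) := fun i => Equiv.swap 0 (σ (i, 0)).2
    have hs : ∀ i b, σ (i, b) = (pm i, s i b) := by
      intro i b
      have h2 := h2 i
      have h1 := h1 i
      ext1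
      · fin_cases b
        · rfl
        · exact h1.symm
      · simp only [s]
        generalize hu : (σ (i, 0)).2 = u at *
        generalize hw : (σ (i, 1)).2 = w at *
        fin_cases b
        · simp [hu]
        · simp only [Fin.mk_one, hw]
          revert h2
          clear hu hw
          revert u w
          decide
    have hpm : Function.Injective pm := by
      intro i j hij
      have : σ (i, 0) = σ (j, (s j).symm (s i 0)) := by
        rw [hs, hs, hij]; simp
      exact congrArg Prod.fst (σ.injective this)
    let pme : Perm (Fin n) := Equiv.ofBijective pm (Finite.injective_iff_bijective.1 hpm)
    have hσ : σ = Equiv.prodCongrLeft (fun _ : Fin 2 => pme) * Equiv.prodCongrRight s := by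
      ext1 ⟨i, b⟩
      rw [hs]; rfl
    have hsign : Perm.sign σ = ∏ i, Perm.sign (s i) := by
      rw [hσ, Perm.sign_mul, Perm.sign_prodCongrLeft, Perm.sign_prodCongrRight]
      simp
    have hterm : ∀ i, B (x (σ (i, 0))) (x (σ (i, 1))) = ((Perm.sign (s i) : ℤ) : ℝ) := by
      intro i
      rw [hs, hs]
      have hcases : s i = 1 ∨ s i = Equiv.swap 0 1 := by
        simp only [s]
        generalize (σ (i, 0)).2 = u
        fin_cases u
        · left; simp; rfl
        · right; rfl
      rcases hcases with h | h
      · simp [h, hx.pair]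
      · rw [h, Equiv.swap_apply_left, Equiv.swap_apply_right, isAlt_swap hB, hx.pair,
          Perm.sign_swap (by decide)]
        simp
    rw [hsign, pairProd]
    simp only [Function.comp_apply, hterm]
    push_cast
    exact mul_self_nonneg _
  -- The identity permutation contributes the value `1`.
  refine lt_of_lt_of_le ?_ (Finset.single_le_sum (fun σ _ => hnonneg σ) (Finset.mem_univ 1))
  simp [pairProd, hx.pair]

theorem wedgePow_ne_zero_of_isSymplecticFamily (Ω : V [⋀^Fin 2]→ₗ[ℝ] ℝ) {n : ℕ}
    {x : Fin n × Fin 2 → V} (hx : IsSymplecticFamily (contract Ω) x) :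
    ∃ e : Fin (2 * n) ≃ Fin n × Fin 2, wedgePow Ω n (x ∘ e) ≠ 0 := by
  obtain ⟨c, e, hc, h⟩ := exists_wedgePow_eq_pairSum Ω n
  refine ⟨e.symm, fun h0 => ?_⟩
  have := h (x ∘ e.symm)
  rw [h0, mul_zero, Function.comp_assoc, Equiv.symm_comp_self, Function.comp_id] at this
  exact (hx.pairSum_pos (contract_isAlt Ω)).ne this

/-- Evaluate on `R` followed by `x`. Since `η` kills every `x j`, only permutations keeping `R` in
the first slot contribute. Each contributes `η R * μ x`, because the sign produced by `μ` cancels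
that of the permutation. -/
theorem toAlt_wedge_ne_zero {l : ℕ} (η : Module.Dual ℝ V) (μ : V [⋀^Fin l]→ₗ[ℝ] ℝ) {R : V}
    (hR : η R ≠ 0) {x : Fin l → V} (hx : ∀ j, η (x j) = 0) (hμ : μ x ≠ 0) :
    wedge (toAlt η) μ ≠ 0 := by
  intro h0
  let y : Fin (1 + l) → V := fun j => Sum.elim (fun _ => R) x (finSumFinEquiv.symm j)
  have h := factorial_smul_wedge (toAlt η) μ y
  rw [h0] at h
  have hterm : ∀ σ : Perm (Fin 1 ⊕ Fin l), ((Perm.sign σ : ℤ) : ℝ) *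
      (toAlt η (fun j => y (finSumFinEquiv (σ (Sum.inl j)))) *
        μ (fun j => y (finSumFinEquiv (σ (Sum.inr j))))) =
      if σ (Sum.inl 0) = Sum.inl 0 then η R * μ x else 0 := by
    intro σ
    simp only [y, Equiv.symm_apply_apply, toAlt_apply]
    split_ifs with hσ
    · have hmaps : Set.MapsTo σ (Set.range (Sum.inl : Fin 1 → Fin 1 ⊕ Fin l))
          (Set.range Sum.inl) := by
        rintro _ ⟨j, rfl⟩
        rw [Subsingleton.elim j 0, hσ]
        exact ⟨0, rfl⟩
      obtain ⟨⟨s, t⟩, hst⟩ := Perm.mem_sumCongrHom_range_of_perm_mapsTo_inl hmaps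
      have hst' : σ = Perm.sumCongr s t := hst.symm
      rw [hst', Perm.sign_sumCongr, Subsingleton.elim s 1]
      simp only [Perm.sumCongr_apply, Sum.map_inl, Sum.map_inr, Sum.elim_inl, Sum.elim_inr]
      have := μ.map_perm x t
      change μ (fun j => x (t j)) = _ at this
      rw [this]
      rcases Int.units_eq_one_or (Perm.sign t) with h | h <;> simp [h]
    · rcases hj : σ (Sum.inl 0) with j | j
      · rw [Subsingleton.elim j 0] at hj
        exact absurd hj hσ
      · simp [hx]
  rw [Finset.sum_congr rfl fun σ _ => hterm σ, ← Finset.sum_filter, Finset.sum_const,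
    AlternatingMap.zero_apply, mul_zero, nsmul_eq_mul] at h
  refine mul_ne_zero ?_ (mul_ne_zero hR hμ) h.symm
  rw [Nat.cast_ne_zero]
  exact (Finset.card_pos.2 ⟨1, by simp⟩).ne'

/-- Split off a hyperbolic pair `e, f` with `B e f = 1` and induct on its orthogonal complement,
where `B` is still nondegenerate. -/
theorem exists_isSymplecticFamily [FiniteDimensional ℝ V] (B : LinearMap.BilinForm ℝ V)
    (hB : B.IsAlt) (hnd : ∀ v, (∀ w, B v w = 0) → v = 0) :
    ∃ (n : ℕ) (x : Fin n × Fin 2 → V), Module.finrank ℝ V = 2 * n ∧ IsSymplecticFamily B x := by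
  induction hd : Module.finrank ℝ V using Nat.strong_induction_on generalizing V with
  | _ d ih =>
  by_cases htriv : ∀ v : V, v = 0
  · refine ⟨0, fun p => p.1.elim0, ?_, ⟨fun i => i.elim0, fun i => i.elim0⟩⟩
    have : Subsingleton V := ⟨fun a b => by rw [htriv a, htriv b]⟩
    rw [← hd, Module.finrank_zero_of_subsingleton]
  push Not at htriv
  obtain ⟨e, he⟩ := htriv
  obtain ⟨f', hf'⟩ : ∃ f', B e f' ≠ 0 := by
    by_contra! h
    exact he (hnd e h)
  obtain ⟨f, hef⟩ : ∃ f, B e f = 1 := ⟨(B e f')⁻¹ • f', by simp [hf']⟩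
  have hfe : B f e = -1 := by rw [isAlt_swap hB, hef]
  let φ : V →ₗ[ℝ] ℝ × ℝ := (B e).prod (B f)
  have hsurj : Function.Surjective φ := by
    rintro ⟨a, b⟩
    refine ⟨a • f - b • e, ?_⟩
    simp [φ, hef, hfe, hB e, hB f]
  let W := LinearMap.ker φ
  have hW : ∀ w : W, B e w = 0 ∧ B f w = 0 := fun w => by
    simpa [φ, W] using w.2
  have hdim : 2 + Module.finrank ℝ W = d := by
    have := LinearMap.finrank_range_add_finrank_ker φ
    rw [LinearMap.range_eq_top.2 hsurj, finrank_top, Module.finrank_prod, Module.finrank_self,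
      hd] at this
    exact this
  obtain ⟨n, x, hn, hx⟩ := ih (Module.finrank ℝ W) (by omega) (B.restrict W)
    (fun w => hB w) (fun w hw => by
      ext1
      refine hnd w fun v => ?_
      -- This is the projection of `v` to the complement of the plane spanned by `e` and `f`; the
      -- correction terms are orthogonal to `w`.
      have hmem : v - B e v • f + B f v • e ∈ W := by
        simp [W, φ, hef, hfe, hB e, hB f]
      have h1 : B w (v - B e v • f + B f v • e) = 0 := hw ⟨_, hmem⟩
      have h2 : B w e = 0 := by rw [isAlt_swap hB, (hW w).1, neg_zero]
      have h3 : B w f = 0 := by rw [isAlt_swap hB, (hW w).2, neg_zero]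
      simpa [h2, h3] using h1) rfl
  refine ⟨n + 1, fun p => Sum.elim (fun q => (x q : V)) ![e, f] ((pairSuccEquiv n).symm p),
    by omega, ⟨fun i => ?_, fun i j b c hij => ?_⟩⟩
  · refine Fin.lastCases ?_ (fun i => ?_) i
    · simp only [← pairSuccEquiv_inr, Equiv.symm_apply_apply]
      simpa using hef
    · simp only [← pairSuccEquiv_inl, Equiv.symm_apply_apply]
      exact hx.pair i
  · have hz : ∀ (q : Fin n × Fin 2) (b : Fin 2), B (![e, f] b) (x q : V) = 0 := fun q b => by
      fin_cases b
      · exact (hW _).1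
      · exact (hW _).2
    revert hij
    refine Fin.lastCases ?_ (fun i => ?_) i <;> refine Fin.lastCases ?_ (fun j => ?_) j <;>
      intro hij <;>
      simp only [← pairSuccEquiv_inl, ← pairSuccEquiv_inr, Equiv.symm_apply_apply, Sum.elim_inl,
        Sum.elim_inr]
    · exact absurd rfl hij
    · exact hz _ _
    · rw [isAlt_swap hB, hz, neg_zero]
    · exact hx.ne i j b c fun h => hij (by rw [h])

/-- A contact structure on a vector space: `η ∧ Ωⁿ ≠ 0` follows from nondegeneracy. -/
theorem wedge_ne_zero_of_nondegenerate [FiniteDimensional ℝ V] {η : Module.Dual ℝ V}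
    {Ω : V [⋀^Fin 2]→ₗ[ℝ] ℝ} {R : V} (hR : η R = 1)
    (hnd : ∀ v, η v = 0 → (∀ w, η w = 0 → contract Ω v w = 0) → v = 0) :
    ∃ n, Module.finrank ℝ V = 2 * n + 1 ∧ wedge (toAlt η) (wedgePow Ω n) ≠ 0 := by
  obtain ⟨n, x, hn, hx⟩ := exists_isSymplecticFamily (LinearMap.BilinForm.restrict (contract Ω) (LinearMap.ker η))
    (fun w => contract_isAlt Ω w) (fun v hv => Subtype.ext (hnd v v.2 fun w hw => hv ⟨w, hw⟩))
  refine ⟨n, ?_, ?_⟩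
  · have h1 := LinearMap.finrank_range_add_finrank_ker η
    rw [LinearMap.range_eq_top.2 (LinearMap.surjective fun h => by simp [h] at hR), finrank_top,
      Module.finrank_self] at h1
    change Module.finrank ℝ (LinearMap.ker η) = _ at hn
    omega
  · have hx' : IsSymplecticFamily (contract Ω) (fun p => (x p : V)) := ⟨hx.pair, hx.ne⟩
    obtain ⟨e, he⟩ := wedgePow_ne_zero_of_isSymplecticFamily Ω hx'
    exact toAlt_wedge_ne_zero η _ (by rw [hR]; exact one_ne_zero) (fun j => (x (e j)).2) he

end Symplectic

/-! ### Linear contact and cocontact algebra, and reduction of Lagrangian subspaces. -/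

section Reduction

variable {V : Type*} [AddCommGroup V] [Module ℝ V]

/-- Reeb data for a pair of covectors and a `2`-form: `R` is the Reeb vector of `η`, there is a Reeb
vector for `θ` unless `θ = 0` (the contact case), and the `2`-form is nondegenerate on
`ker θ ∩ ker η`. -/
structure IsReebData (θ η : Module.Dual ℝ V) (Ω : V [⋀^Fin 2]→ₗ[ℝ] ℝ) (R : V) : Prop where
  theta_reeb : θ R = 0
  eta_reeb : η R = 1
  contract_reeb : contract Ω R = 0
  theta : θ = 0 ∨ ∃ T, θ T = 1 ∧ η T = 0 ∧ contract Ω T = 0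
  nondeg : ∀ v, θ v = 0 → η v = 0 → (∀ w, θ w = 0 → η w = 0 → contract Ω v w = 0) → v = 0

/-- Lagrangian subspaces of `ker θ ∩ ker η`. -/
def IsLagrangian (θ η : Module.Dual ℝ V) (Ω : V [⋀^Fin 2]→ₗ[ℝ] ℝ) (U : Submodule ℝ V) : Prop :=
  (∀ u ∈ U, θ u = 0 ∧ η u = 0) ∧
    ∀ w, θ w = 0 → η w = 0 → (w ∈ U ↔ ∀ d ∈ U, contract Ω w d = 0)

theorem cocontactFlat_apply (θ η : Module.Dual ℝ V) (Ω : V [⋀^Fin 2]→ₗ[ℝ] ℝ) (v w : V) :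
    cocontactFlat θ η Ω v w = θ v * θ w + contract Ω v w + η v * η w := by
  simp [cocontactFlat]

theorem contactFlat_eq (η : Module.Dual ℝ V) (Ω : V [⋀^Fin 2]→ₗ[ℝ] ℝ) :
    contactFlat η Ω = cocontactFlat 0 η Ω := by
  ext v w
  simp [contactFlat, cocontactFlat]

/-- Evaluating `♭ v` on `v` itself gives `θ(v)² + η(v)²`, since `Ω` is alternating. -/
theorem eq_zero_of_cocontactFlat_eq_zero {θ η : Module.Dual ℝ V} {Ω : V [⋀^Fin 2]→ₗ[ℝ] ℝ} {v : V}
    (h : cocontactFlat θ η Ω v = 0) : θ v = 0 ∧ η v = 0 ∧ contract Ω v = 0 := by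
  have h1 := cocontactFlat_apply θ η Ω v v
  rw [h, contract_self] at h1
  simp only [LinearMap.zero_apply] at h1
  have hθ : θ v = 0 := by nlinarith [mul_self_nonneg (θ v), mul_self_nonneg (η v)]
  have hη : η v = 0 := by nlinarith [mul_self_nonneg (θ v), mul_self_nonneg (η v)]
  refine ⟨hθ, hη, LinearMap.ext fun w => ?_⟩
  have h2 := cocontactFlat_apply θ η Ω v w
  rw [h, hθ, hη] at h2
  simpa using h2.symm

theorem flat_bijective_of_injective [FiniteDimensional ℝ V] {flat : V →ₗ[ℝ] Module.Dual ℝ V}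
    (h : ∀ v, flat v = 0 → v = 0) : Function.Bijective flat := by
  have hinj : Function.Injective flat := LinearMap.ker_eq_bot.1 (LinearMap.ker_eq_bot'.2 h)
  exact ⟨hinj, (LinearMap.injective_iff_surjective_of_finrank_eq_finrank
    Subspace.dual_finrank_eq.symm).1 hinj⟩

theorem flat_sharp {flat : V →ₗ[ℝ] Module.Dual ℝ V} (h : Function.Bijective flat)
    (α : Module.Dual ℝ V) : flat (sharp flat α) = α := by
  rw [sharp, dif_pos h]
  exact (LinearEquiv.ofBijective flat h).apply_symm_apply α

theorem sharp_flat {flat : V →ₗ[ℝ] Module.Dual ℝ V} (h : Function.Bijective flat)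
    (v : V) : sharp flat (flat v) = v := by
  rw [sharp, dif_pos h]
  exact (LinearEquiv.ofBijective flat h).symm_apply_apply v

theorem IsReebData.flat_bijective [FiniteDimensional ℝ V] {θ η : Module.Dual ℝ V}
    {Ω : V [⋀^Fin 2]→ₗ[ℝ] ℝ} {R : V} (h : IsReebData θ η Ω R) :
    Function.Bijective (cocontactFlat θ η Ω) := by
  refine flat_bijective_of_injective fun v hv => ?_
  obtain ⟨h1, h2, h3⟩ := eq_zero_of_cocontactFlat_eq_zero hv
  exact h.nondeg v h1 h2 fun w _ _ => by rw [h3]; rfl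

/-- The wedge condition alone allows `Ω` to pair the directions transverse to `ker θ ∩ ker η`, and
then there is no Reeb vector. The condition `θ(♯η) = 0`, which a submanifold that is both
`z`-vertical and `t`-horizontal supplies, excludes this: together with the parity of `dim ker θ` it
forces `♯η` and `♯θ` to be the expected Reeb vectors. -/
theorem isReebData_of_wedge_ne_zero [FiniteDimensional ℝ V] {n : ℕ}
    (hd : Module.finrank ℝ V = 2 * n + 2) {θ η : Module.Dual ℝ V} {Ω : V [⋀^Fin 2]→ₗ[ℝ] ℝ}
    (hw : wedge (toAlt θ) (wedge (toAlt η) (wedgePow Ω n)) ≠ 0)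
    (hθR : θ (sharp (cocontactFlat θ η Ω) η) = 0) :
    IsReebData θ η Ω (sharp (cocontactFlat θ η Ω) η) := by
  have hnd : ∀ v, θ v = 0 → η v = 0 → (∀ w, θ w = 0 → contract Ω v w = 0) → v = 0 :=
    fun v => ker_nondegenerate_of_wedge_ne_zero hd hw
  have hθ0 : θ ≠ 0 := by
    rintro rfl
    refine hw (AlternatingMap.ext fun x => wedge_eq_zero_of_forall_perm _ _ x fun σ => Or.inl ?_)
    rfl
  have hbij : Function.Bijective (cocontactFlat θ η Ω) := by
    refine flat_bijective_of_injective fun v hv => ?_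
    obtain ⟨h1, h2, h3⟩ := eq_zero_of_cocontactFlat_eq_zero hv
    exact hnd v h1 h2 fun w _ => by rw [h3]; rfl
  set R := sharp (cocontactFlat θ η Ω) η with hR
  have hRflat : ∀ w, contract Ω R w + η R * η w = η w := fun w => by
    have := congrArg (fun α => α w) (flat_sharp hbij η)
    rw [← hR] at this
    simp only [cocontactFlat_apply, hθR] at this
    linarith
  have hηR : η R = 1 := by
    -- Pairing `♭ R = η` with `R` gives `η(R)² = η(R)`. If `η(R) = 0`, then `i_R Ω = η`, which makes
    -- `Ω` nondegenerate on `ker θ`; that space has odd dimension `2n + 1`.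
    by_contra hne
    have h0 : η R = 0 := by
      have := hRflat R
      rw [contract_self] at this
      have : η R * (η R - 1) = 0 := by linarith
      exact (mul_eq_zero.1 this).resolve_right fun h => hne (by linarith)
    have hR' : ∀ w, contract Ω R w = η w := fun w => by simpa [h0] using hRflat w
    have hev : ∃ k, Module.finrank ℝ (LinearMap.ker θ) = 2 * k := by
      obtain ⟨k, x, hk, -⟩ := exists_isSymplecticFamily
        (LinearMap.BilinForm.restrict (contract Ω) (LinearMap.ker θ))
        (fun w => contract_isAlt Ω w) (fun v hv => by
          have hv' : ∀ w, θ w = 0 → contract Ω v w = 0 := fun w hw => hv ⟨w, hw⟩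
          refine Subtype.ext (hnd v v.2 ?_ hv')
          rw [← hR', contract_swap, hv' R hθR, neg_zero])
      exact ⟨k, hk⟩
    obtain ⟨k, hk⟩ := hev
    have h1 := LinearMap.finrank_range_add_finrank_ker θ
    rw [LinearMap.range_eq_top.2 (LinearMap.surjective hθ0), finrank_top,
      Module.finrank_self] at h1
    omega
  have hΩR : contract Ω R = 0 := LinearMap.ext fun w => by
    have := hRflat w
    rw [hηR] at this
    simpa using this
  set T := sharp (cocontactFlat θ η Ω) θ with hT
  have hTflat : ∀ w, θ T * θ w + contract Ω T w + η T * η w = θ w := fun w => by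
    have := congrArg (fun α => α w) (flat_sharp hbij θ)
    rw [← hT] at this
    simpa only [cocontactFlat_apply] using this
  have hηT : η T = 0 := by
    have := hTflat R
    rw [contract_swap, hΩR, hθR, hηR] at this
    simpa using this
  have hθT : θ T = 1 := by
    by_contra hne
    have h0 : θ T = 0 := by
      have := hTflat T
      rw [contract_self, hηT] at this
      have : θ T * (θ T - 1) = 0 := by linarith
      exact (mul_eq_zero.1 this).resolve_right fun h => hne (by linarith)
    have hT0 : T = 0 := hnd T h0 hηT fun w hw => by simpa [h0, hηT, hw] using hTflat w
    refine hθ0 (LinearMap.ext fun w => ?_)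
    rw [← hTflat w, hT0]
    simp
  refine ⟨hθR, hηR, hΩR, Or.inr ⟨T, hθT, hηT, LinearMap.ext fun w => ?_⟩,
    fun v h1 h2 h3 => hnd v h1 h2 fun w hw => ?_⟩
  · simpa [hθT, hηT] using hTflat w
  · have h4 : contract Ω v (w - η w • R) = 0 := h3 _ (by simp [hw, hθR]) (by simp [hηR])
    have h5 : contract Ω v R = 0 := by rw [contract_swap, hΩR]; simp
    simpa [h5] using h4

/-- Write `α = ♭ u` and test against `β = ♭ v`. The defining identity becomes `θ(v)θ(w) + Ω(v,w) +
η(v)η(w) = Ω(v,u)`. The Reeb vectors as `v` give `η(w) = 0` and `θ(w) = 0`, and what is left is `i_u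
Ω = i_w Ω`. The vector `u` is determined by `w` only up to the kernel of `Ω`, which is why it stays
in the criterion. -/
theorem IsReebData.mem_lambdaOrth [FiniteDimensional ℝ V] {θ η : Module.Dual ℝ V}
    {Ω : V [⋀^Fin 2]→ₗ[ℝ] ℝ} {R : V} (h : IsReebData θ η Ω R) {Δ : Submodule ℝ V} {w : V} :
    w ∈ lambdaOrth (cocontactFlat θ η Ω) Ω Δ ↔ θ w = 0 ∧ η w = 0 ∧
      ∃ u, contract Ω u = contract Ω w ∧
        ∀ d ∈ Δ, θ u * θ d + contract Ω u d + η u * η d = 0 := by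
  have hbij := h.flat_bijective
  have hΩR : ∀ v, contract Ω v R = 0 := fun v => by
    rw [contract_swap, h.contract_reeb]; simp
  constructor
  · rintro ⟨α, hα, hw⟩
    obtain ⟨u, rfl⟩ := hbij.2 α
    have hv : ∀ v, θ v * θ w + contract Ω v w + η v * η w = contract Ω v u := fun v => by
      have := hw (cocontactFlat θ η Ω v)
      rw [bivector, sharp_flat hbij, sharp_flat hbij, cocontactFlat_apply] at this
      rw [this, contract_swap, contract_apply]
    have hηw : η w = 0 := by
      have := hv R
      simpa [h.theta_reeb, h.contract_reeb, h.eta_reeb] using this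
    have hθw : θ w = 0 := by
      rcases h.theta with h0 | ⟨T, h1, h2, h3⟩
      · simp [h0]
      · simpa [h1, h2, h3] using hv T
    refine ⟨hθw, hηw, u, LinearMap.ext fun v => ?_, fun d hd => ?_⟩
    · rw [contract_swap, ← hv v, contract_swap Ω v w, hθw, hηw]; simp
    · rw [← cocontactFlat_apply]
      exact (Submodule.mem_dualAnnihilator _).1 hα d hd
  · rintro ⟨hθ, hη, u, hu, hΔ⟩
    refine ⟨cocontactFlat θ η Ω u, (Submodule.mem_dualAnnihilator _).2 fun d hd => ?_, fun β => ?_⟩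
    · rw [cocontactFlat_apply, hΔ d hd]
    · obtain ⟨v, rfl⟩ := hbij.2 β
      rw [bivector, sharp_flat hbij, sharp_flat hbij, cocontactFlat_apply, hθ, hη,
        ← contract_apply, hu, contract_swap]
      simp

/-- Testing the auxiliary vector `u` against `R ∈ W` gives `η(u) = 0`, and `θ` vanishes on `W`. So
`u` can be replaced by `w`. -/
theorem IsReebData.mem_lambdaOrth_of_reeb_mem [FiniteDimensional ℝ V] {θ η : Module.Dual ℝ V}
    {Ω : V [⋀^Fin 2]→ₗ[ℝ] ℝ} {R : V} (h : IsReebData θ η Ω R) {W : Submodule ℝ V}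
    (hR : R ∈ W) (hW : W ≤ LinearMap.ker θ) {w : V} :
    w ∈ lambdaOrth (cocontactFlat θ η Ω) Ω W ↔
      θ w = 0 ∧ η w = 0 ∧ ∀ d ∈ W, contract Ω w d = 0 := by
  rw [h.mem_lambdaOrth]
  constructor
  · rintro ⟨h1, h2, u, hu, hd⟩
    have hηu : η u = 0 := by
      have := hd R hR
      rw [h.theta_reeb, contract_swap, h.contract_reeb, h.eta_reeb] at this
      simpa using this
    refine ⟨h1, h2, fun d hdW => ?_⟩
    have := hd d hdW
    have hθd : θ d = 0 := hW hdW
    rwa [hηu, hu, hθd, mul_zero, zero_mul, zero_add, add_zero] at this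
  · rintro ⟨h1, h2, h3⟩
    exact ⟨h1, h2, w, rfl, fun d hd => by rw [h1, h2, h3 d hd]; simp⟩

/-- This removes `♯` and `Λ` from the Legendrian condition and leaves symplectic linear algebra.
With `θ = 0` it covers the contact case. -/
theorem IsReebData.lambdaOrth_eq_self_iff [FiniteDimensional ℝ V] {θ η : Module.Dual ℝ V}
    {Ω : V [⋀^Fin 2]→ₗ[ℝ] ℝ} {R : V} (h : IsReebData θ η Ω R) {U : Submodule ℝ V} :
    lambdaOrth (cocontactFlat θ η Ω) Ω U = U ↔ IsLagrangian θ η Ω U := by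
  have key : (∀ u ∈ U, θ u = 0 ∧ η u = 0) → ∀ w,
      (w ∈ lambdaOrth (cocontactFlat θ η Ω) Ω U ↔
        θ w = 0 ∧ η w = 0 ∧ ∀ d ∈ U, contract Ω w d = 0) := by
    intro hU w
    rw [h.mem_lambdaOrth]
    refine and_congr_right fun h1 => and_congr_right fun h2 => ⟨?_, fun h3 => ⟨w, rfl, ?_⟩⟩
    · rintro ⟨u, hu, hd⟩ d hdU
      have := hd d hdU
      rwa [hu, (hU d hdU).1, (hU d hdU).2, mul_zero, mul_zero, zero_add, add_zero] at this
    · intro d hd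
      rw [h1, h2, h3 d hd]; simp
  constructor
  · intro hU
    have h1 : ∀ u ∈ U, θ u = 0 ∧ η u = 0 := fun u hu => by
      rw [← hU, h.mem_lambdaOrth] at hu
      exact ⟨hu.1, hu.2.1⟩
    refine ⟨h1, fun w hw hw' => ?_⟩
    have := key h1 w
    rw [hU] at this
    rw [this]
    exact ⟨fun h => h.2.2, fun h => ⟨hw, hw', h⟩⟩
  · rintro ⟨h1, h2⟩
    ext w
    rw [key h1 w]
    exact ⟨fun ⟨a, b, c⟩ => (h2 w a b).2 c,
      fun hw => ⟨(h1 w hw).1, (h1 w hw).2, (h2 w (h1 w hw).1 (h1 w hw).2).1 hw⟩⟩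

theorem nondegenerate_of_isAlt {B : LinearMap.BilinForm ℝ V} (hB : B.IsAlt)
    (h : ∀ v, (∀ w, B v w = 0) → v = 0) : B.Nondegenerate :=
  ⟨h, fun v hv => h v fun w => by rw [isAlt_swap hB, hv, neg_zero]⟩

/-- Take orthogonals of the easy identity `(A + B)^⊥ = A^⊥ ∩ B^⊥` and use that the double orthogonal
is the identity. -/
theorem orthogonal_inf [FiniteDimensional ℝ V] {B : LinearMap.BilinForm ℝ V} (hB : B.IsAlt)
    (hnd : B.Nondegenerate) (X Y : Submodule ℝ V) :
    B.orthogonal (X ⊓ Y) = B.orthogonal X ⊔ B.orthogonal Y := by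
  rw [← LinearMap.BilinForm.orthogonal_orthogonal hnd hB.isRefl (B.orthogonal X ⊔ B.orthogonal Y)]
  congr 1
  apply le_antisymm
  · intro v hv
    rw [LinearMap.BilinForm.mem_orthogonal_iff]
    intro u hu
    obtain ⟨a, ha, b, hb, rfl⟩ := Submodule.mem_sup.1 hu
    have h1 : B v a = 0 := ha v hv.1
    have h2 : B v b = 0 := hb v hv.2
    change B (a + b) v = 0
    rw [isAlt_swap hB, map_add, h1, h2]
    simp
  · refine le_inf ?_ ?_
    · refine (LinearMap.BilinForm.orthogonal_le le_sup_left).trans ?_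
      rw [LinearMap.BilinForm.orthogonal_orthogonal hnd hB.isRefl]
    · refine (LinearMap.BilinForm.orthogonal_le le_sup_right).trans ?_
      rw [LinearMap.BilinForm.orthogonal_orthogonal hnd hB.isRefl]

/-- The restriction of the `2`-form to `ker θ ∩ ker η`. -/
def kerForm (θ η : Module.Dual ℝ V) (Ω : V [⋀^Fin 2]→ₗ[ℝ] ℝ) :
    LinearMap.BilinForm ℝ ↥(LinearMap.ker θ ⊓ LinearMap.ker η) :=
  LinearMap.BilinForm.restrict (contract Ω) (LinearMap.ker θ ⊓ LinearMap.ker η)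

theorem kerForm_isAlt (θ η : Module.Dual ℝ V) (Ω : V [⋀^Fin 2]→ₗ[ℝ] ℝ) :
    (kerForm θ η Ω).IsAlt := fun w => contract_isAlt Ω w

theorem IsReebData.kerForm_nondegenerate {θ η : Module.Dual ℝ V}
    {Ω : V [⋀^Fin 2]→ₗ[ℝ] ℝ} {R : V} (h : IsReebData θ η Ω R) :
    (kerForm θ η Ω).Nondegenerate :=
  nondegenerate_of_isAlt (kerForm_isAlt θ η Ω) fun v hv =>
    Subtype.ext (h.nondeg v v.2.1 v.2.2 fun w h1 h2 => hv ⟨w, h1, h2⟩)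

theorem finrank_comap_subtype_eq {H U : Submodule ℝ V} (h : U ≤ H) :
    Module.finrank ℝ (U.comap H.subtype) = Module.finrank ℝ U :=
  (Submodule.comapSubtypeEquivOfLe h).finrank_eq

theorem IsReebData.finrank_ker [FiniteDimensional ℝ V] {η : Module.Dual ℝ V}
    {Ω : V [⋀^Fin 2]→ₗ[ℝ] ℝ} {R : V} (h : IsReebData 0 η Ω R) :
    Module.finrank ℝ ↥(LinearMap.ker (0 : Module.Dual ℝ V) ⊓ LinearMap.ker η) + 1 =
      Module.finrank ℝ V := by
  have h1 := LinearMap.finrank_range_add_finrank_ker η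
  have hη : η ≠ 0 := fun h0 => by simpa [h0] using h.eta_reeb
  rw [LinearMap.range_eq_top.2 (LinearMap.surjective hη), finrank_top, Module.finrank_self] at h1
  rw [LinearMap.ker_zero, top_inf_eq]
  omega

/-- A Lagrangian subspace is its own orthogonal in `ker η`, so its dimension is half of `dim V - 1`.
-/
theorem IsReebData.finrank_of_isLagrangian [FiniteDimensional ℝ V] {η : Module.Dual ℝ V}
    {Ω : V [⋀^Fin 2]→ₗ[ℝ] ℝ} {R : V} (h : IsReebData 0 η Ω R) {U : Submodule ℝ V}
    (hU : IsLagrangian 0 η Ω U) : 2 * Module.finrank ℝ U + 1 = Module.finrank ℝ V := by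
  have hle : U ≤ LinearMap.ker (0 : Module.Dual ℝ V) ⊓ LinearMap.ker η := fun u hu => hU.1 u hu
  have h1 := LinearMap.BilinForm.finrank_orthogonal h.kerForm_nondegenerate
    (U.comap (LinearMap.ker (0 : Module.Dual ℝ V) ⊓ LinearMap.ker η).subtype)
  have h2 : (kerForm 0 η Ω).orthogonal
      (U.comap (LinearMap.ker (0 : Module.Dual ℝ V) ⊓ LinearMap.ker η).subtype) =
      U.comap (LinearMap.ker (0 : Module.Dual ℝ V) ⊓ LinearMap.ker η).subtype := by
    ext w
    rw [LinearMap.BilinForm.mem_orthogonal_iff, Submodule.mem_comap, Submodule.subtype_apply,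
      hU.2 w w.2.1 w.2.2]
    constructor
    · intro hw d hd
      have : contract Ω d w = 0 := hw ⟨d, hle hd⟩ hd
      rw [contract_swap, this, neg_zero]
    · intro hw d hd
      change contract Ω d w = 0
      rw [contract_swap, hw d hd, neg_zero]
  rw [h2, finrank_comap_subtype_eq hle] at h1
  have h3 := h.finrank_ker
  have h4 := Submodule.finrank_mono hle
  omega

theorem IsReebData.isLagrangian_of_finrank [FiniteDimensional ℝ V] {η : Module.Dual ℝ V}
    {Ω : V [⋀^Fin 2]→ₗ[ℝ] ℝ} {R : V} (h : IsReebData 0 η Ω R) {U : Submodule ℝ V}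
    (hη : ∀ u ∈ U, η u = 0) (hΩ : ∀ u ∈ U, ∀ v ∈ U, contract Ω u v = 0)
    (hdim : 2 * Module.finrank ℝ U + 1 = Module.finrank ℝ V) : IsLagrangian 0 η Ω U := by
  refine ⟨fun u hu => ⟨rfl, hη u hu⟩, fun w _ hw => ⟨fun hwU d hd => hΩ w hwU d hd, fun hwd => ?_⟩⟩
  have hle : U ≤ LinearMap.ker (0 : Module.Dual ℝ V) ⊓ LinearMap.ker η :=
    fun u hu => ⟨rfl, hη u hu⟩
  have h1 := LinearMap.BilinForm.finrank_orthogonal h.kerForm_nondegenerate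
    (U.comap (LinearMap.ker (0 : Module.Dual ℝ V) ⊓ LinearMap.ker η).subtype)
  have h2 : U.comap (LinearMap.ker (0 : Module.Dual ℝ V) ⊓ LinearMap.ker η).subtype ≤
      (kerForm 0 η Ω).orthogonal
      (U.comap (LinearMap.ker (0 : Module.Dual ℝ V) ⊓ LinearMap.ker η).subtype) :=
    fun v hv d hd => hΩ d hd v hv
  have h3 := h.finrank_ker
  rw [finrank_comap_subtype_eq hle] at h1
  have h4 := Submodule.eq_of_le_of_finrank_eq h2
    (by rw [h1, finrank_comap_subtype_eq hle]; omega)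
  have h5 : (⟨w, rfl, hw⟩ : ↥(LinearMap.ker (0 : Module.Dual ℝ V) ⊓ LinearMap.ker η)) ∈
      (kerForm 0 η Ω).orthogonal
      (U.comap (LinearMap.ker (0 : Module.Dual ℝ V) ⊓ LinearMap.ker η).subtype) := fun d hd => by
    change contract Ω d w = 0
    rw [contract_swap, hwd d hd, neg_zero]
  rw [← h4] at h5
  exact h5

variable {N Q : Type*} [AddCommGroup N] [Module ℝ N] [AddCommGroup Q] [Module ℝ Q]

/-- The Reeb data descend to the quotient of a coisotropic subspace (the range of `I`) by its
orthogonal. -/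
theorem IsReebData.quotient {θ η : Module.Dual ℝ V} {Ω : V [⋀^Fin 2]→ₗ[ℝ] ℝ} {r : N}
    {I : N →ₗ[ℝ] V} (h : IsReebData θ η Ω (I r))
    {p : N →ₗ[ℝ] Q} (hp : Function.Surjective p)
    (hker : ∀ v, η (I v) = 0 → (∀ w, contract Ω (I v) (I w) = 0) → p v = 0)
    {η' : Module.Dual ℝ Q} {Ω' : Q [⋀^Fin 2]→ₗ[ℝ] ℝ} (hη' : ∀ v, η' (p v) = η (I v))
    (hΩ' : ∀ v w, contract Ω' (p v) (p w) = contract Ω (I v) (I w)) :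
    IsReebData 0 η' Ω' (p r) := by
  refine ⟨rfl, by rw [hη', h.eta_reeb], LinearMap.ext fun y => ?_, Or.inl rfl, fun y _ hy hw => ?_⟩
  · obtain ⟨w, rfl⟩ := hp y
    rw [hΩ', h.contract_reeb]; rfl
  · obtain ⟨v, rfl⟩ := hp y
    refine hker v (by rw [← hη', hy]) fun w => ?_
    -- Subtracting a multiple of the Reeb vector puts `w` in the kernel of `η`, where the hypothesis
    -- on `y` applies.
    have h1 := hw (p (w - η (I w) • r)) rfl (by rw [hη']; simp [h.eta_reeb])
    rw [hΩ', map_sub, map_smul, map_sub, map_smul, contract_swap Ω (I r) (I v),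
      h.contract_reeb] at h1
    simpa using h1

/-- Let `W` be the range of `I`. If `y = p v` is orthogonal to the reduced subspace, then `I v ∈ (U
∩ W)^⊥ = U + W^⊥`, with orthogonals taken in `ker θ ∩ ker η`. By coisotropy the `W^⊥` component lies
in `W`, and `p` kills it, so `y` is represented by a vector of `U ∩ W`. -/
theorem IsReebData.isLagrangian_quotient [FiniteDimensional ℝ V]
    {θ η : Module.Dual ℝ V} {Ω : V [⋀^Fin 2]→ₗ[ℝ] ℝ} {r : N}
    {I : N →ₗ[ℝ] V} (h : IsReebData θ η Ω (I r)) (hθ : ∀ v, θ (I v) = 0)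
    (hcois : ∀ w, θ w = 0 → η w = 0 → (∀ d, contract Ω w (I d) = 0) → w ∈ LinearMap.range I)
    {p : N →ₗ[ℝ] Q} (hp : Function.Surjective p)
    (hker : ∀ v, η (I v) = 0 → (∀ w, contract Ω (I v) (I w) = 0) → p v = 0)
    {η' : Module.Dual ℝ Q} {Ω' : Q [⋀^Fin 2]→ₗ[ℝ] ℝ} (hη' : ∀ v, η' (p v) = η (I v))
    (hΩ' : ∀ v w, contract Ω' (p v) (p w) = contract Ω (I v) (I w))
    {U : Submodule ℝ V} (hU : IsLagrangian θ η Ω U) :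
    IsLagrangian 0 η' Ω' ((U.comap I).map p) := by
  constructor
  · rintro _ ⟨v, hv, rfl⟩
    exact ⟨rfl, by rw [hη', (hU.1 _ hv).2]⟩
  · intro y _ hy
    obtain ⟨v, rfl⟩ := hp y
    rw [hη'] at hy
    constructor
    · rintro ⟨v', hv', hvv⟩ _ ⟨d, hd, rfl⟩
      rw [← hvv, hΩ']
      exact (hU.2 _ (hU.1 _ hv').1 (hU.1 _ hv').2).1 hv' _ hd
    · intro hd
      let H := LinearMap.ker θ ⊓ LinearMap.ker η
      let X := U.comap H.subtype
      let Y := (LinearMap.range I).comap H.subtype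
      let z : H := ⟨I v, hθ v, hy⟩
      have hz : z ∈ (kerForm θ η Ω).orthogonal (X ⊓ Y) := by
        rintro ⟨x, hx⟩ ⟨hxX, ⟨d, hxd⟩⟩
        change I d = x at hxd
        subst hxd
        have h1 := hd (p d) ⟨d, hxX, rfl⟩
        rw [hΩ'] at h1
        change contract Ω (I d) (I v) = 0
        rw [contract_swap, h1, neg_zero]
      rw [orthogonal_inf (kerForm_isAlt θ η Ω) h.kerForm_nondegenerate] at hz
      obtain ⟨a, ha, b, hb, hab⟩ := Submodule.mem_sup.1 hz
      have haU : (a : V) ∈ U := by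
        rw [hU.2 a a.2.1 a.2.2]
        intro d hdU
        have : contract Ω d a = 0 := ha ⟨d, hU.1 d hdU⟩ hdU
        rw [contract_swap, this, neg_zero]
      have hbI : ∀ d, contract Ω b (I d) = 0 := by
        intro d
        have h1 : contract Ω (I (d - η (I d) • r)) b = 0 :=
          hb ⟨I (d - η (I d) • r), hθ _, by simp [h.eta_reeb]⟩ ⟨_, rfl⟩
        rw [contract_swap, map_sub, map_smul, map_sub, map_smul, contract_swap Ω (I r) b,
          h.contract_reeb] at h1
        simpa using h1
      obtain ⟨b', hb'⟩ := hcois b b.2.1 b.2.2 hbI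
      have hpb : p b' = 0 := hker b' (by rw [hb']; exact b.2.2) fun w => by rw [hb', hbI]
      have hsum : (a : V) + b = I v := congrArg Subtype.val hab
      refine ⟨v - b', ?_, by rw [map_sub, hpb, sub_zero]⟩
      change I (v - b') ∈ U
      rw [map_sub, hb', ← hsum, add_sub_cancel_right]
      exact haU

end Reduction

/-! ### Pulling one-forms back to normed spaces; naturality of the exterior derivative. -/

section Pullback

open Filter Topology

variable {m : ℕ} {M : Type*} [TopologicalSpace M] [ChartedSpace (EuclideanSpace ℝ (Fin m)) M]

theorem contMDiffAt_extChartAt_symm [IsManifold (𝓡 m) ∞ M] (x : M)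
    {z : EuclideanSpace ℝ (Fin m)} (hz : z ∈ (extChartAt (𝓡 m) x).target) :
    ContMDiffAt 𝓘(ℝ, EuclideanSpace ℝ (Fin m)) (𝓡 m) ∞ (extChartAt (𝓡 m) x).symm z :=
  (contMDiffOn_extChartAt_symm x).contMDiffAt ((isOpen_extChartAt_target x).mem_nhds hz)

theorem mdifferentiableAt_extChartAt_symm [IsManifold (𝓡 m) ∞ M] (x : M)
    {z : EuclideanSpace ℝ (Fin m)} (hz : z ∈ (extChartAt (𝓡 m) x).target) :
    MDifferentiableAt 𝓘(ℝ, EuclideanSpace ℝ (Fin m)) (𝓡 m) (extChartAt (𝓡 m) x).symm z :=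
  (contMDiffAt_extChartAt_symm x hz).mdifferentiableAt (by simp)

/-- Smoothness of a section of the cotangent bundle is expressed through trivializations, while the
exterior derivative is expressed through inverse charts. This identifies the two coordinate
expressions of a covector. -/
theorem inCoordinates_eq_comp_mfderiv_symm [IsManifold (𝓡 m) ∞ M] {x₀ x : M}
    (hx : x ∈ (chartAt (EuclideanSpace ℝ (Fin m)) x₀).source)
    (β : TangentSpace (𝓡 m) x →L[ℝ] ℝ) :
    ContinuousLinearMap.inCoordinates (EuclideanSpace ℝ (Fin m)) (TangentSpace (𝓡 m) (M := M)) ℝ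
      (Trivial M ℝ) x₀ x x₀ x β =
    β.comp (mfderiv 𝓘(ℝ, EuclideanSpace ℝ (Fin m)) (𝓡 m) (extChartAt (𝓡 m) x₀).symm
      (extChartAt (𝓡 m) x₀ x)) := by
  have h := TangentBundle.symmL_trivializationAt (I := 𝓡 m) hx
  rw [ContinuousLinearMap.inCoordinates, h]
  ext v
  simp
  rfl

variable [IsManifold (𝓡 m) ∞ M]

/-- A `1`-form in the preferred chart at `x₀`, as a function with values in covectors. -/
def OneForm.chartRep (α : OneForm m M) (x₀ : M) (z : EuclideanSpace ℝ (Fin m)) :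
    EuclideanSpace ℝ (Fin m) →L[ℝ] ℝ :=
  (α ((extChartAt (𝓡 m) x₀).symm z)).comp
      (mfderiv 𝓘(ℝ, EuclideanSpace ℝ (Fin m)) (𝓡 m) (extChartAt (𝓡 m) x₀).symm z)

theorem OneForm.contDiffAt_chartRep (α : OneForm m M) (x₀ : M) :
    ContDiffAt ℝ ∞ (α.chartRep x₀) (extChartAt (𝓡 m) x₀ x₀) := by
  have h1 := ((contMDiffAt_hom_bundle _).1 (α.contMDiff x₀)).2
  have h2 := contMDiffAt_extChartAt_symm x₀ (mem_extChartAt_target (I := 𝓡 m) x₀)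
  have h3 : (extChartAt (𝓡 m) x₀).symm (extChartAt (𝓡 m) x₀ x₀) = x₀ := extChartAt_to_inv x₀
  have h4 := ContMDiffAt.comp_of_eq h1 h2 h3
  rw [← contMDiffAt_iff_contDiffAt]
  refine h4.congr_of_eventuallyEq ?_
  filter_upwards [extChartAt_target_mem_nhds (I := 𝓡 m) x₀] with z hz
  have hz' : (extChartAt (𝓡 m) x₀).symm z ∈ (chartAt (EuclideanSpace ℝ (Fin m)) x₀).source := by
    rw [← extChartAt_source (𝓡 m)]
    exact (extChartAt (𝓡 m) x₀).map_target hz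
  refine Eq.trans ?_ (inCoordinates_eq_comp_mfderiv_symm hz' _).symm
  rw [(extChartAt (𝓡 m) x₀).right_inv hz]
  rfl

variable {E : Type*} [NormedAddCommGroup E] [NormedSpace ℝ E]

/-- The pullback of a `1`-form to a normed space along a map `g`. -/
def OneForm.pull (α : OneForm m M) (g : E → M) (y : E) : E →L[ℝ] ℝ :=
  (α (g y)).comp (mfderiv 𝓘(ℝ, E) (𝓡 m) g y)

theorem OneForm.pull_apply (α : OneForm m M) (g : E → M) (y v : E) :
    α.pull g y v = α.val (g y) (mfderiv 𝓘(ℝ, E) (𝓡 m) g y v) := rfl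

/-- Factoring `g` through the chart at `g y₀` writes the pullback with ordinary Fréchet derivatives,
so its smoothness and its differential become calculus in normed spaces. -/
theorem OneForm.pull_eventuallyEq (α : OneForm m M) {g : E → M} {y₀ : E}
    (hg : ContMDiffAt 𝓘(ℝ, E) (𝓡 m) ∞ g y₀) :
    α.pull g =ᶠ[𝓝 y₀] fun y => (α.chartRep (g y₀) (extChartAt (𝓡 m) (g y₀) (g y))).comp
      (fderiv ℝ (fun y => extChartAt (𝓡 m) (g y₀) (g y)) y) := by
  have hsrc : ∀ᶠ y in 𝓝 y₀, g y ∈ (extChartAt (𝓡 m) (g y₀)).source :=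
    hg.continuousAt.eventually (extChartAt_source_mem_nhds (I := 𝓡 m) (g y₀))
  have hd : ∀ᶠ y in 𝓝 y₀, MDifferentiableAt 𝓘(ℝ, E) (𝓡 m) g y :=
    (contMDiffAt_iff_contMDiffAt_nhds (n := 1) (by simp)).1 (hg.of_le (by simp)) |>.mono
      fun y hy => hy.mdifferentiableAt (by simp)
  filter_upwards [hsrc.eventually_nhds, hd] with y hy hdy
  have hy' := hy.self_of_nhds
  have hgeq : g =ᶠ[𝓝 y] fun y' =>
      (extChartAt (𝓡 m) (g y₀)).symm (extChartAt (𝓡 m) (g y₀) (g y')) := by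
    filter_upwards [hy] with y' h
    exact ((extChartAt (𝓡 m) (g y₀)).left_inv h).symm
  have h1 : MDifferentiableAt (𝓡 m) 𝓘(ℝ, EuclideanSpace ℝ (Fin m)) (extChartAt (𝓡 m) (g y₀))
      (g y) := mdifferentiableAt_extChartAt (by rwa [extChartAt_source] at hy')
  have h2 : MDifferentiableAt 𝓘(ℝ, E) 𝓘(ℝ, EuclideanSpace ℝ (Fin m))
      (fun y => extChartAt (𝓡 m) (g y₀) (g y)) y := h1.comp y hdy
  have h3 := mdifferentiableAt_extChartAt_symm (g y₀) ((extChartAt (𝓡 m) (g y₀)).map_source hy')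
  have h4 := mfderiv_comp y h3 h2
  ext v
  have h5 : mfderiv 𝓘(ℝ, E) (𝓡 m) g y v = mfderiv 𝓘(ℝ, EuclideanSpace ℝ (Fin m)) (𝓡 m)
      (extChartAt (𝓡 m) (g y₀)).symm (extChartAt (𝓡 m) (g y₀) (g y))
        (fderiv ℝ (fun y => extChartAt (𝓡 m) (g y₀) (g y)) y v) := by
    rw [hgeq.mfderiv_eq]
    refine (congrArg (fun L => L v) h4).trans ?_
    rw [mfderiv_eq_fderiv]
    rfl
  have h6 : ∀ (x : M) (z u : EuclideanSpace ℝ (Fin m)), (extChartAt (𝓡 m) (g y₀)).symm z = x →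
      α.val x (mfderiv 𝓘(ℝ, EuclideanSpace ℝ (Fin m)) (𝓡 m) (extChartAt (𝓡 m) (g y₀)).symm z u) =
        α.chartRep (g y₀) z u := by
    rintro _ z u rfl
    rfl
  rw [OneForm.pull_apply, h5]
  exact h6 _ _ _ ((extChartAt (𝓡 m) (g y₀)).left_inv hy')

theorem OneForm.contDiffAt_pull (α : OneForm m M) {g : E → M} {y₀ : E}
    (hg : ContMDiffAt 𝓘(ℝ, E) (𝓡 m) ∞ g y₀) : ContDiffAt ℝ ∞ (α.pull g) y₀ := by
  refine ContDiffAt.congr_of_eventuallyEq ?_ (α.pull_eventuallyEq hg)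
  have hF : ContDiffAt ℝ ∞ (fun y => extChartAt (𝓡 m) (g y₀) (g y)) y₀ := by
    rw [← contMDiffAt_iff_contDiffAt]
    exact (contMDiffAt_extChartAt (x := g y₀)).comp y₀ hg
  have h1 : ContDiffAt ℝ ∞ (fun y => α.chartRep (g y₀) (extChartAt (𝓡 m) (g y₀) (g y))) y₀ :=
    ContDiffAt.comp (g := α.chartRep (g y₀)) y₀ (α.contDiffAt_chartRep (g y₀)) hF
  exact h1.clm_comp (hF.fderiv_right (m := ∞) (by simp))

theorem extDeriv_ofSubsingleton_apply {a : E → E →L[ℝ] ℝ} {y : E} (ha : DifferentiableAt ℝ a y)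
    (v w : E) :
    extDeriv (fun z => ContinuousAlternatingMap.ofSubsingleton ℝ E ℝ (0 : Fin 1) (a z)) y ![v, w] =
      fderiv ℝ a y v w - fderiv ℝ a y w v := by
  have h : DifferentiableAt ℝ
      (fun z => ContinuousAlternatingMap.ofSubsingleton ℝ E ℝ (0 : Fin 1) (a z)) y :=
    (ContinuousAlternatingMap.ofSubsingletonLIE (𝕜 := ℝ) (E := E) (F := ℝ)
      (i := (0 : Fin 1))).differentiable.differentiableAt.comp
      y ha
  rw [extDeriv_apply h, Fin.sum_univ_two]
  have h2 : ∀ u, fderiv ℝ (fun z => a z u) y = (fderiv ℝ a y).flip u := fun u => by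
    refine (HasFDerivAt.fderiv ?_ )
    exact ((ContinuousLinearMap.apply ℝ ℝ u).hasFDerivAt.comp y ha.hasFDerivAt)
  simp [h2, sub_eq_add_neg, Fin.removeNth]

/-- The exterior derivative commutes with pullbacks. -/
theorem OneForm.extD_mfderiv (α : OneForm m M) {g : E → M} {y₀ : E}
    (hg : ContMDiffAt 𝓘(ℝ, E) (𝓡 m) ∞ g y₀) (v w : E) :
    contract (α.extD (g y₀)) (mfderiv 𝓘(ℝ, E) (𝓡 m) g y₀ v) (mfderiv 𝓘(ℝ, E) (𝓡 m) g y₀ w) =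
      fderiv ℝ (α.pull g) y₀ v w - fderiv ℝ (α.pull g) y₀ w v := by
  have hF : ContDiffAt ℝ ∞ (fun y => extChartAt (𝓡 m) (g y₀) (g y)) y₀ := by
    rw [← contMDiffAt_iff_contDiffAt]
    exact (contMDiffAt_extChartAt (x := g y₀)).comp y₀ hg
  rw [← extDeriv_ofSubsingleton_apply ((α.contDiffAt_pull hg).differentiableAt (by simp))]
  have heq := (α.pull_eventuallyEq hg).fun_comp
    (ContinuousAlternatingMap.ofSubsingleton ℝ E ℝ (0 : Fin 1))
  have h1 := Filter.EventuallyEq.extDeriv_eq heq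
  have h0 : DifferentiableAt ℝ (α.inChart (g y₀)) (extChartAt (𝓡 m) (g y₀) (g y₀)) :=
    (ContinuousAlternatingMap.ofSubsingletonLIE (𝕜 := ℝ) (E := EuclideanSpace ℝ (Fin m))
      (F := ℝ) (i := (0 : Fin 1))).differentiable.differentiableAt.comp _
      ((α.contDiffAt_chartRep (g y₀)).differentiableAt (by simp))
  have h2 := extDeriv_pullback (r := 2) h0 (f := fun y => extChartAt (𝓡 m) (g y₀) (g y)) (x := y₀)
    (hF.of_le (WithTop.coe_le_coe.2 le_top)) (by simp)
  have h3 := congrArg (fun A => A ![v, w]) (h1.trans h2)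
  refine Eq.trans ?_ h3.symm
  have h4 : mfderiv 𝓘(ℝ, E) 𝓘(ℝ, EuclideanSpace ℝ (Fin m))
      (fun y => extChartAt (𝓡 m) (g y₀) (g y)) y₀ =
      (mfderiv (𝓡 m) 𝓘(ℝ, EuclideanSpace ℝ (Fin m)) (extChartAt (𝓡 m) (g y₀)) (g y₀)).comp
        (mfderiv 𝓘(ℝ, E) (𝓡 m) g y₀) :=
    mfderiv_comp y₀ ((contMDiffAt_extChartAt (n := ∞)).mdifferentiableAt (by simp))
      (hg.mdifferentiableAt (by simp))
  rw [mfderiv_eq_fderiv] at h4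
  rw [contract_apply]
  change (extDeriv (α.inChart (g y₀)) (extChartAt (𝓡 m) (g y₀) (g y₀))) _ =
    (extDeriv (α.inChart (g y₀)) (extChartAt (𝓡 m) (g y₀) (g y₀))) _
  congr 1
  rw [h4]
  funext j
  fin_cases j <;> rfl

end Pullback

/-! ### Forms given locally as pullbacks: their differentials and their smoothness. -/

section PullbackManifold

open Filter Topology

variable {m : ℕ} {M : Type*} [TopologicalSpace M] [ChartedSpace (EuclideanSpace ℝ (Fin m)) M]
  [IsManifold (𝓡 m) ∞ M]
  {q : ℕ} {Q : Type*} [TopologicalSpace Q] [ChartedSpace (EuclideanSpace ℝ (Fin q)) Q]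
  [IsManifold (𝓡 q) ∞ Q]

theorem mfderiv_extChartAt_symm_self (x : Q) (v : EuclideanSpace ℝ (Fin q)) :
    mfderiv 𝓘(ℝ, EuclideanSpace ℝ (Fin q)) (𝓡 q) (extChartAt (𝓡 q) x).symm
      (extChartAt (𝓡 q) x x) v = v := by
  have h1 := mfderiv_extChartAt_comp_mfderivWithin_extChartAt_symm (I := 𝓡 q)
    (mem_extChartAt_target (I := 𝓡 q) x)
  have h2 : ∀ y, y = x → mfderiv (𝓡 q) 𝓘(ℝ, EuclideanSpace ℝ (Fin q)) (extChartAt (𝓡 q) x) y =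
      ContinuousLinearMap.id ℝ (EuclideanSpace ℝ (Fin q)) := by
    rintro y rfl
    exact mfderiv_extChartAt_self
  rw [h2 _ (extChartAt_to_inv x), ModelWithCorners.range_eq_univ, mfderivWithin_univ] at h1
  exact congrArg (fun L => L v) h1

theorem OneForm.extD_eq_of_pullback (β : OneForm q Q) (α : OneForm m M) {σ : Q → M} {x : Q}
    (hσ : ContMDiffAt (𝓡 q) (𝓡 m) ∞ σ x)
    (h : ∀ᶠ y in 𝓝 x, ∀ v, β.val y v = α.val (σ y) (mfderiv (𝓡 q) (𝓡 m) σ y v))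
    (v w : TangentSpace (𝓡 q) x) :
    contract (β.extD x) v w = contract (α.extD (σ x)) (mfderiv (𝓡 q) (𝓡 m) σ x v)
      (mfderiv (𝓡 q) (𝓡 m) σ x w) := by
  let γ := (extChartAt (𝓡 q) x).symm
  let z := extChartAt (𝓡 q) x x
  have hγz : γ z = x := extChartAt_to_inv x
  have hγ : ContMDiffAt 𝓘(ℝ, EuclideanSpace ℝ (Fin q)) (𝓡 q) ∞ γ z :=
    contMDiffAt_extChartAt_symm x (mem_extChartAt_target x)
  have hσ' : ContMDiffAt (𝓡 q) (𝓡 m) ∞ σ (γ z) := by rwa [hγz]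
  have h1 := β.extD_mfderiv hγ v w
  have h2 := α.extD_mfderiv (hσ'.comp z hγ) v w
  have hd : ∀ᶠ y in 𝓝 x, MDifferentiableAt (𝓡 q) (𝓡 m) σ y :=
    (contMDiffAt_iff_contMDiffAt_nhds (n := 1) (by simp)).1 (hσ.of_le (by simp)) |>.mono
      fun y hy => hy.mdifferentiableAt (by simp)
  have hγx : Tendsto γ (𝓝 z) (𝓝 x) := by
    have := hγ.continuousAt.tendsto
    rwa [hγz] at this
  have h3 : β.pull γ =ᶠ[𝓝 z] α.pull (σ ∘ γ) := by
    filter_upwards [hγx.eventually h, hγx.eventually hd,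
      extChartAt_target_mem_nhds (I := 𝓡 q) x] with y hy hdy hyt
    ext u
    have h4 := mfderiv_comp y hdy (mdifferentiableAt_extChartAt_symm x hyt)
    rw [OneForm.pull_apply, OneForm.pull_apply, hy]
    refine congrArg (α.val (σ (γ y))) ?_
    exact (congrArg (fun L => L u) h4).symm
  rw [h3.fderiv_eq] at h1
  have h5 := h1.trans h2.symm
  have h6 : mfderiv 𝓘(ℝ, EuclideanSpace ℝ (Fin q)) (𝓡 m) (σ ∘ γ) z =
      (mfderiv (𝓡 q) (𝓡 m) σ (γ z)).comp (mfderiv 𝓘(ℝ, EuclideanSpace ℝ (Fin q)) (𝓡 q) γ z) :=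
    mfderiv_comp z (hσ'.mdifferentiableAt (by simp))
      (mdifferentiableAt_extChartAt_symm x (mem_extChartAt_target x))
  rw [h6] at h5
  -- The base point `γ z` equals `x` only propositionally. Quantifying over it allows the tangent
  -- spaces to be identified by substitution.
  have h7 : ∀ y, y = x →
      (contract (β.extD y) (mfderiv 𝓘(ℝ, EuclideanSpace ℝ (Fin q)) (𝓡 q) γ z v)
        (mfderiv 𝓘(ℝ, EuclideanSpace ℝ (Fin q)) (𝓡 q) γ z w) =
      contract (α.extD (σ y)) (mfderiv (𝓡 q) (𝓡 m) σ y
        (mfderiv 𝓘(ℝ, EuclideanSpace ℝ (Fin q)) (𝓡 q) γ z v))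
        (mfderiv (𝓡 q) (𝓡 m) σ y (mfderiv 𝓘(ℝ, EuclideanSpace ℝ (Fin q)) (𝓡 q) γ z w))) →
      contract (β.extD x) v w = contract (α.extD (σ x)) (mfderiv (𝓡 q) (𝓡 m) σ x v)
      (mfderiv (𝓡 q) (𝓡 m) σ x w) := by
    rintro y rfl h
    rwa [mfderiv_extChartAt_symm_self y v, mfderiv_extChartAt_symm_self y w] at h
  exact h7 _ hγz h5

/-- For the form on the leaf space, `σ` will be a local section of the projection followed by the
inclusion into `M`. -/
theorem contMDiff_of_eventually_pullback (α : OneForm m M)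
    (β : (x : Q) → TangentSpace (𝓡 q) x →L[ℝ] ℝ)
    (h : ∀ x, ∃ σ : Q → M, ContMDiffAt (𝓡 q) (𝓡 m) ∞ σ x ∧
      ∀ᶠ y in 𝓝 x, ∀ v, β y v = α.val (σ y) (mfderiv (𝓡 q) (𝓡 m) σ y v)) :
    ContMDiff (𝓡 q) ((𝓡 q).prod 𝓘(ℝ, EuclideanSpace ℝ (Fin q) →L[ℝ] ℝ)) ∞
      (fun x => TotalSpace.mk' (EuclideanSpace ℝ (Fin q) →L[ℝ] ℝ)
        (E := fun x : Q => TangentSpace (𝓡 q) x →L[ℝ] ℝ) x (β x)) := by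
  intro x
  obtain ⟨σ, hσ, hβ⟩ := h x
  refine (contMDiffAt_hom_bundle _).2 ⟨contMDiffAt_id, ?_⟩
  let γ := (extChartAt (𝓡 q) x).symm
  let z := extChartAt (𝓡 q) x x
  have hγz : γ z = x := extChartAt_to_inv x
  have hγ : ContMDiffAt 𝓘(ℝ, EuclideanSpace ℝ (Fin q)) (𝓡 q) ∞ γ z :=
    contMDiffAt_extChartAt_symm x (mem_extChartAt_target x)
  have hσ' : ContMDiffAt (𝓡 q) (𝓡 m) ∞ σ (γ z) := by rwa [hγz]
  have h2 := (α.contDiffAt_pull (hσ'.comp z hγ)).contMDiffAt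
  have h3 := h2.comp x (contMDiffAt_extChartAt (I := 𝓡 q) (x := x))
  refine h3.congr_of_eventuallyEq ?_
  have hd : ∀ᶠ y in 𝓝 x, MDifferentiableAt (𝓡 q) (𝓡 m) σ y :=
    (contMDiffAt_iff_contMDiffAt_nhds (n := 1) (by simp)).1 (hσ.of_le (by simp)) |>.mono
      fun y hy => hy.mdifferentiableAt (by simp)
  filter_upwards [hβ, hd, extChartAt_source_mem_nhds (I := 𝓡 q) x] with y hy hdy hys
  have hys' : y ∈ (chartAt (EuclideanSpace ℝ (Fin q)) x).source := by
    rwa [extChartAt_source] at hys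
  refine (inCoordinates_eq_comp_mfderiv_symm hys' (β y)).trans ?_
  have hyt := (extChartAt (𝓡 q) x).map_source hys
  have hyinv : γ (extChartAt (𝓡 q) x y) = y := (extChartAt (𝓡 q) x).left_inv hys
  have hdy' : MDifferentiableAt (𝓡 q) (𝓡 m) σ (γ (extChartAt (𝓡 q) x y)) := by rwa [hyinv]
  have h4 := mfderiv_comp _ hdy' (mdifferentiableAt_extChartAt_symm x hyt)
  ext u
  have key : ∀ (y' : Q) (hy' : y' = y) (w : EuclideanSpace ℝ (Fin q)),
      β y w = α.val (σ y') (mfderiv (𝓡 q) (𝓡 m) σ y' w) := by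
    rintro _ rfl w
    exact hy w
  refine (key _ hyinv _).trans ?_
  change _ = α.val _ (mfderiv 𝓘(ℝ, EuclideanSpace ℝ (Fin q)) (𝓡 m) (σ ∘ γ)
    (extChartAt (𝓡 q) x y) u)
  refine congrArg (α.val (σ (γ (extChartAt (𝓡 q) x y)))) ?_
  exact (congrArg (fun L => L u) h4).symm

end PullbackManifold

/-! ### Local normal forms of immersions and submersions; a dimension bound. -/

section LocalForms

open Filter Topology Set

/-- The inverse of a smooth chart-like map has a bijective differential. -/
theorem mfderiv_symm_bijective {E₁ E₂ H₁ H₂ : Type*} [NormedAddCommGroup E₁] [NormedSpace ℝ E₁]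
    [NormedAddCommGroup E₂] [NormedSpace ℝ E₂] [TopologicalSpace H₁] [TopologicalSpace H₂]
    {I : ModelWithCorners ℝ E₁ H₁} {J : ModelWithCorners ℝ E₂ H₂}
    {A B : Type*} [TopologicalSpace A] [ChartedSpace H₁ A] [TopologicalSpace B] [ChartedSpace H₂ B]
    (e : OpenPartialHomeomorph A B) (he : ContMDiffOn I J ∞ e e.source)
    (he' : ContMDiffOn J I ∞ e.symm e.target) {b : B} (hb : b ∈ e.target) :
    Function.Bijective (mfderiv J I e.symm b) := by
  have hb' : e.symm b ∈ e.source := e.map_target hb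
  have hd : MDifferentiableAt I J e (e.symm b) :=
    (he.contMDiffAt (e.open_source.mem_nhds hb')).mdifferentiableAt (by simp)
  have hd' : MDifferentiableAt J I e.symm b :=
    (he'.contMDiffAt (e.open_target.mem_nhds hb)).mdifferentiableAt (by simp)
  have h1 : (mfderiv I J e (e.symm b)).comp (mfderiv J I e.symm b) =
      ContinuousLinearMap.id ℝ _ := by
    rw [← mfderiv_comp b hd hd', ← mfderiv_id]
    refine Filter.EventuallyEq.mfderiv_eq ?_
    filter_upwards [e.open_target.mem_nhds hb] with y hy
    exact e.right_inv hy
  have hd'' : MDifferentiableAt J I e.symm (e (e.symm b)) := by rwa [e.right_inv hb]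
  have h2 : (mfderiv J I e.symm (e (e.symm b))).comp (mfderiv I J e (e.symm b)) =
      ContinuousLinearMap.id ℝ _ := by
    rw [← mfderiv_comp _ hd'' hd, ← mfderiv_id]
    refine Filter.EventuallyEq.mfderiv_eq ?_
    filter_upwards [e.open_source.mem_nhds hb'] with y hy
    exact e.left_inv hy
  constructor
  · intro v w hvw
    have := congrArg (mfderiv I J e (e.symm b)) hvw
    have h3 : ∀ u, mfderiv I J e (e.symm b) (mfderiv J I e.symm b u) = u :=
      fun u => congrArg (fun L => L u) h1
    rw [h3, h3] at this
    exact this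
  · intro v
    refine ⟨mfderiv I J e (e.symm b) v, ?_⟩
    have h3 : ∀ b', b' = b → mfderiv J I e.symm b' (mfderiv I J e (e.symm b) v) = v →
        mfderiv J I e.symm b (mfderiv I J e (e.symm b) v) = v := by
      rintro _ rfl h
      exact h
    exact h3 _ (e.right_inv hb) (congrArg (fun L => L v) h2)

/-- In adapted charts the map is `u ↦ (u, 0)` followed by a linear isomorphism. -/
theorem mfderiv_injective_of_isImmersion {s d : ℕ}
    {S : Type*} [TopologicalSpace S] [ChartedSpace (EuclideanSpace ℝ (Fin s)) S]
    [IsManifold (𝓡 s) ∞ S]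
    {M : Type*} [TopologicalSpace M] [ChartedSpace (EuclideanSpace ℝ (Fin d)) M]
    [IsManifold (𝓡 d) ∞ M] {j : S → M}
    (hj : Manifold.IsImmersion (𝓡 s) (𝓡 d) ∞ j) (x : S) :
    Function.Injective (mfderiv (𝓡 s) (𝓡 d) j x) := by
  have h := hj.isImmersionAt x
  let φ := h.domChart
  let ψ := h.codChart
  obtain ⟨z, hz, hzx⟩ : ∃ z ∈ φ.target, φ.symm z = x :=
    ⟨φ x, φ.map_source h.mem_domChart_source, φ.left_inv h.mem_domChart_source⟩
  suffices Function.Injective (mfderiv (𝓡 s) (𝓡 d) j (φ.symm z)) by rwa [hzx] at this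
  have hφ := contMDiffOn_of_mem_maximalAtlas h.domChart_mem_maximalAtlas
  have hφ' := contMDiffOn_symm_of_mem_maximalAtlas h.domChart_mem_maximalAtlas
  have hψ := contMDiffOn_of_mem_maximalAtlas h.codChart_mem_maximalAtlas
  have hw : ∀ u ∈ φ.target, ψ (j (φ.symm u)) = h.equiv (u, 0) := fun u hu => by
    have hu' : u ∈ (φ.extend (𝓡 s)).target := by simpa using hu
    simpa using h.writtenInCharts hu'
  have hbij := mfderiv_symm_bijective φ hφ hφ' hz
  have hdφ : MDifferentiableAt 𝓘(ℝ, EuclideanSpace ℝ (Fin s)) (𝓡 s) φ.symm z :=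
    (hφ'.contMDiffAt (φ.open_target.mem_nhds hz)).mdifferentiableAt (by simp)
  have hdj : MDifferentiableAt (𝓡 s) (𝓡 d) j (φ.symm z) :=
    (hj.contMDiff _).mdifferentiableAt (by simp)
  have hdψ : MDifferentiableAt (𝓡 d) 𝓘(ℝ, EuclideanSpace ℝ (Fin d)) ψ (j (φ.symm z)) :=
    (hψ.contMDiffAt (ψ.open_source.mem_nhds (by rw [hzx]; exact h.mem_codChart_source))).mdifferentiableAt (by simp)
  have h1 : mfderiv 𝓘(ℝ, EuclideanSpace ℝ (Fin s)) 𝓘(ℝ, EuclideanSpace ℝ (Fin d))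
      (ψ ∘ j ∘ φ.symm) z =
      (h.equiv : _ →L[ℝ] EuclideanSpace ℝ (Fin d)).comp
        (ContinuousLinearMap.inl ℝ (EuclideanSpace ℝ (Fin s)) h.complement) := by
    rw [mfderiv_eq_fderiv]
    refine HasFDerivAt.fderiv ?_
    refine (ContinuousLinearMap.hasFDerivAt _).congr_of_eventuallyEq ?_
    filter_upwards [φ.open_target.mem_nhds hz] with u hu
    exact hw u hu
  rw [mfderiv_comp z hdψ (hdj.comp z hdφ), mfderiv_comp z hdj hdφ] at h1
  refine (injective_iff_map_eq_zero _).2 fun v hv => ?_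
  obtain ⟨w, rfl⟩ := hbij.2 v
  have h2 : mfderiv (𝓡 d) 𝓘(ℝ, EuclideanSpace ℝ (Fin d)) ψ (j (φ.symm z))
      (mfderiv (𝓡 s) (𝓡 d) j (φ.symm z)
        (mfderiv 𝓘(ℝ, EuclideanSpace ℝ (Fin s)) (𝓡 s) φ.symm z w)) = h.equiv (w, 0) :=
    congrArg (fun L => L w) h1
  rw [hv, map_zero] at h2
  have h3 := (map_eq_zero_iff _ h.equiv.injective).1 h2.symm
  have h4 : w = 0 := congrArg Prod.fst h3
  rw [h4, map_zero]

/-- A smooth image of an open subset of a second countable `s`-dimensional manifold that has interior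
points forces the dimension of the target to be at most `s`. -/
theorem finrank_le_of_interior_image_nonempty {s : ℕ}
    {S : Type*} [TopologicalSpace S] [SecondCountableTopology S]
    [ChartedSpace (EuclideanSpace ℝ (Fin s)) S] [IsManifold (𝓡 s) ∞ S]
    {F : Type*} [NormedAddCommGroup F] [NormedSpace ℝ F] [FiniteDimensional ℝ F]
    {h : S → F} {O : Set S} (hh : ∀ x ∈ O, ContMDiffAt (𝓡 s) 𝓘(ℝ, F) ∞ h x)
    (hint : (interior (h '' O)).Nonempty) : Module.finrank ℝ F ≤ s := by
  -- Smooth maps are locally Lipschitz and so do not raise Hausdorff dimension; a countable union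
  -- preserves the bound, whereas a set with interior has full dimension.
  have hloc : ∀ x ∈ O, ∃ U ∈ 𝓝 x, dimH (h '' U) ≤ s := by
    intro x hx
    have h1 : ContMDiffAt (𝓡 s) 𝓘(ℝ, F) ∞ h
        ((extChartAt (𝓡 s) x).symm (extChartAt (𝓡 s) x x)) := by
      rw [extChartAt_to_inv]; exact hh x hx
    have h2 : ContDiffAt ℝ 1 (h ∘ (extChartAt (𝓡 s) x).symm) (extChartAt (𝓡 s) x x) :=
      (h1.comp _ (contMDiffAt_extChartAt_symm x (mem_extChartAt_target x))).contDiffAt.of_le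
        (by simp)
    obtain ⟨K, t, ht, hK⟩ := h2.exists_lipschitzOnWith
    refine ⟨(extChartAt (𝓡 s) x).source ∩ (extChartAt (𝓡 s) x) ⁻¹' t,
      inter_mem (extChartAt_source_mem_nhds x) ((continuousAt_extChartAt x).preimage_mem_nhds ht), ?_⟩
    have hsub : h '' ((extChartAt (𝓡 s) x).source ∩ (extChartAt (𝓡 s) x) ⁻¹' t) ⊆
        (h ∘ (extChartAt (𝓡 s) x).symm) '' t := by
      rintro _ ⟨y, ⟨hy, hyt⟩, rfl⟩
      exact ⟨_, hyt, congrArg h ((extChartAt (𝓡 s) x).left_inv hy)⟩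
    calc dimH _ ≤ dimH ((h ∘ (extChartAt (𝓡 s) x).symm) '' t) := dimH_mono hsub
      _ ≤ dimH t := hK.dimH_image_le
      _ ≤ dimH (univ : Set (EuclideanSpace ℝ (Fin s))) := dimH_mono (subset_univ _)
      _ = s := by rw [Real.dimH_univ_eq_finrank, finrank_euclideanSpace_fin]
  choose! U hU hUd using hloc
  obtain ⟨t, htO, htc, ht⟩ := TopologicalSpace.countable_cover_nhdsWithin
    (fun x hx => mem_nhdsWithin_of_mem_nhds (hU x hx) : ∀ x ∈ O, U x ∈ 𝓝[O] x)
  have h1 : dimH (h '' O) ≤ s := by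
    calc dimH (h '' O) ≤ dimH (⋃ x ∈ t, h '' U x) := by
          refine dimH_mono ?_
          rw [← image_iUnion₂]
          exact image_mono ht
      _ = ⨆ x ∈ t, dimH (h '' U x) := dimH_bUnion htc _
      _ ≤ s := iSup₂_le fun x hx => hUd x (htO hx)
  have h2 : dimH (h '' O) = Module.finrank ℝ F := by
    obtain ⟨y, hy⟩ := hint
    exact Real.dimH_of_mem_nhds (mem_interior_iff_mem_nhds.1 hy)
  rw [h2] at h1
  exact_mod_cast h1

variable {k q : ℕ}
  {N : Type*} [TopologicalSpace N] [ChartedSpace (EuclideanSpace ℝ (Fin k)) N]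
  {Q : Type*} [TopologicalSpace Q] [ChartedSpace (EuclideanSpace ℝ (Fin q)) Q]

variable (k q) in
/-- Smooth coordinates in which `pr` is the projection `E × F → E`. -/
structure SubmersionChart (pr : N → Q) (F : Type) [NormedAddCommGroup F] [NormedSpace ℝ F] where
  dom : OpenPartialHomeomorph N (EuclideanSpace ℝ (Fin q) × F)
  cod : OpenPartialHomeomorph Q (EuclideanSpace ℝ (Fin q))
  mapsTo : MapsTo pr dom.source cod.source
  smooth_dom : ContMDiffOn (𝓡 k) 𝓘(ℝ, EuclideanSpace ℝ (Fin q) × F) ∞ dom dom.source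
  smooth_dom_symm : ContMDiffOn 𝓘(ℝ, EuclideanSpace ℝ (Fin q) × F) (𝓡 k) ∞ dom.symm dom.target
  smooth_cod : ContMDiffOn (𝓡 q) 𝓘(ℝ, EuclideanSpace ℝ (Fin q)) ∞ cod cod.source
  smooth_cod_symm : ContMDiffOn 𝓘(ℝ, EuclideanSpace ℝ (Fin q)) (𝓡 q) ∞ cod.symm cod.target
  cod_apply : ∀ u ∈ dom.target, cod (pr (dom.symm u)) = u.1
  convex : Convex ℝ dom.target

theorem exists_submersionChart [IsManifold (𝓡 k) ∞ N] [IsManifold (𝓡 q) ∞ Q] {pr : N → Q}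
    (hpr : Manifold.IsSubmersion (𝓡 k) (𝓡 q) ∞ pr) (x : N) :
    ∃ (F : Type) (_ : NormedAddCommGroup F) (_ : NormedSpace ℝ F) (c : SubmersionChart k q pr F),
      x ∈ c.dom.source ∧ FiniteDimensional ℝ F ∧ Module.finrank ℝ F + q = k := by
  have h := hpr.isSubmersionAt x
  let φ₁ := h.domChart.transHomeomorph h.equiv.toHomeomorph
  have hx₁ : x ∈ φ₁.source := h.mem_domChart_source
  obtain ⟨ε, hε, hball⟩ := Metric.isOpen_iff.1 φ₁.open_target (φ₁ x) (φ₁.map_source hx₁)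
  -- The target is shrunk to a ball so that its slices along `F` are convex, as constancy along the
  -- fibres will require.
  let φ := (φ₁.symm.restrOpen (Metric.ball (φ₁ x) ε) Metric.isOpen_ball).symm
  have htarget : φ.target = Metric.ball (φ₁ x) ε := inter_eq_right.2 hball
  have hφ := contMDiffOn_of_mem_maximalAtlas h.domChart_mem_maximalAtlas
  have hφ' := contMDiffOn_symm_of_mem_maximalAtlas h.domChart_mem_maximalAtlas
  have hsrc : φ.source ⊆ h.domChart.source := by
    intro y hy
    have h1 : φ₁.symm (φ y) ∈ φ₁.source := φ₁.map_target (hball (htarget ▸ φ.map_source hy))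
    have h2 : φ₁.symm (φ y) = y := φ.left_inv hy
    rwa [h2] at h1
  have htgt : ∀ u ∈ φ.target, h.equiv.symm u ∈ h.domChart.target := by
    intro u hu
    rw [htarget] at hu
    exact hball hu
  have hfin : FiniteDimensional ℝ (EuclideanSpace ℝ (Fin q) × h.complement) :=
    h.equiv.toLinearEquiv.finiteDimensional
  have hfinF : FiniteDimensional ℝ h.complement :=
    Module.Finite.of_surjective (LinearMap.snd ℝ (EuclideanSpace ℝ (Fin q)) h.complement)
      Prod.snd_surjective
  refine ⟨h.complement, inferInstance, inferInstance, ⟨φ, h.codChart, fun y hy =>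
    h.source_subset_preimage_source (hsrc hy), ?_, ?_,
    contMDiffOn_of_mem_maximalAtlas h.codChart_mem_maximalAtlas,
    contMDiffOn_symm_of_mem_maximalAtlas h.codChart_mem_maximalAtlas, ?_, ?_⟩, ?_, hfinF, ?_⟩
  · exact h.equiv.contDiff.contMDiff.comp_contMDiffOn (hφ.mono hsrc)
  · exact hφ'.comp h.equiv.symm.contDiff.contMDiff.contMDiffOn htgt
  · intro u hu
    change h.codChart (pr (h.domChart.symm (h.equiv.symm u))) = u.1
    have hu' : h.equiv.symm u ∈ (h.domChart.extend (𝓡 k)).target := by simpa using htgt u hu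
    simpa using h.writtenInCharts hu'
  · rw [htarget]; exact convex_ball _ _
  · have h1 : φ.symm (φ₁ x) ∈ φ.source :=
      φ.map_target (htarget ▸ Metric.mem_ball_self hε)
    have h2 : φ.symm (φ₁ x) = x := φ₁.left_inv hx₁
    rwa [h2] at h1
  · have h1 := h.equiv.toLinearEquiv.finrank_eq
    rw [Module.finrank_prod, finrank_euclideanSpace_fin, finrank_euclideanSpace_fin] at h1
    omega

end LocalForms

/-! ### Submersion charts and the fibres of the leaf space projection. -/

section Fibres

open Filter Topology Set

variable {k q : ℕ}
  {N : Type u} [TopologicalSpace N] [ChartedSpace (EuclideanSpace ℝ (Fin k)) N]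
  {Q : Type*} [TopologicalSpace Q] [ChartedSpace (EuclideanSpace ℝ (Fin q)) Q]
  {pr : N → Q}

namespace SubmersionChart

variable {F : Type} [NormedAddCommGroup F] [NormedSpace ℝ F] (c : SubmersionChart k q pr F)

theorem fst_mem {u : EuclideanSpace ℝ (Fin q) × F} (hu : u ∈ c.dom.target) :
    u.1 ∈ c.cod.target := by
  rw [← c.cod_apply u hu]
  exact c.cod.map_source (c.mapsTo (c.dom.map_target hu))

theorem pr_symm {u : EuclideanSpace ℝ (Fin q) × F} (hu : u ∈ c.dom.target) :
    pr (c.dom.symm u) = c.cod.symm u.1 := by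
  rw [← c.cod_apply u hu, c.cod.left_inv (c.mapsTo (c.dom.map_target hu))]

theorem contMDiffAt_symm {u : EuclideanSpace ℝ (Fin q) × F} (hu : u ∈ c.dom.target) :
    ContMDiffAt 𝓘(ℝ, EuclideanSpace ℝ (Fin q) × F) (𝓡 k) ∞ c.dom.symm u :=
  c.smooth_dom_symm.contMDiffAt (c.dom.open_target.mem_nhds hu)

theorem contMDiffAt_cod_symm {u : EuclideanSpace ℝ (Fin q) × F} (hu : u ∈ c.dom.target) :
    ContMDiffAt 𝓘(ℝ, EuclideanSpace ℝ (Fin q)) (𝓡 q) ∞ c.cod.symm u.1 :=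
  c.smooth_cod_symm.contMDiffAt (c.cod.open_target.mem_nhds (c.fst_mem hu))

theorem mfderiv_symm_bijective {u : EuclideanSpace ℝ (Fin q) × F} (hu : u ∈ c.dom.target) :
    Function.Bijective
      (mfderiv 𝓘(ℝ, EuclideanSpace ℝ (Fin q) × F) (𝓡 k) c.dom.symm u) :=
  CocontactReduction.mfderiv_symm_bijective c.dom c.smooth_dom c.smooth_dom_symm hu

theorem mfderiv_cod_symm_bijective {u : EuclideanSpace ℝ (Fin q) × F} (hu : u ∈ c.dom.target) :
    Function.Bijective
      (mfderiv 𝓘(ℝ, EuclideanSpace ℝ (Fin q)) (𝓡 q) c.cod.symm u.1) :=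
  CocontactReduction.mfderiv_symm_bijective c.cod c.smooth_cod c.smooth_cod_symm (c.fst_mem hu)

theorem mfderiv_pr (hpr : MDifferentiable (𝓡 k) (𝓡 q) pr)
    {u : EuclideanSpace ℝ (Fin q) × F} (hu : u ∈ c.dom.target)
    (v : EuclideanSpace ℝ (Fin q) × F) :
    mfderiv (𝓡 k) (𝓡 q) pr (c.dom.symm u)
      (mfderiv 𝓘(ℝ, EuclideanSpace ℝ (Fin q) × F) (𝓡 k) c.dom.symm u v) =
    mfderiv 𝓘(ℝ, EuclideanSpace ℝ (Fin q)) (𝓡 q) c.cod.symm u.1 v.1 := by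
  have h1 := mfderiv_comp u (hpr (c.dom.symm u)) ((c.contMDiffAt_symm hu).mdifferentiableAt (by simp))
  have h2 : HasMFDerivAt 𝓘(ℝ, EuclideanSpace ℝ (Fin q) × F) 𝓘(ℝ, EuclideanSpace ℝ (Fin q))
      (Prod.fst : EuclideanSpace ℝ (Fin q) × F → EuclideanSpace ℝ (Fin q)) u
      (ContinuousLinearMap.fst ℝ (EuclideanSpace ℝ (Fin q)) F) :=
    hasFDerivAt_fst.hasMFDerivAt
  have h3 := mfderiv_comp u ((c.contMDiffAt_cod_symm hu).mdifferentiableAt (by simp))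
    h2.mdifferentiableAt
  rw [h2.mfderiv] at h3
  have h4 : pr ∘ c.dom.symm =ᶠ[𝓝 u] c.cod.symm ∘ Prod.fst := by
    filter_upwards [c.dom.open_target.mem_nhds hu] with y hy
    exact c.pr_symm hy
  have h5 := congrArg (fun L => L v) (h1.symm.trans (h4.mfderiv_eq.trans h3))
  exact h5

theorem mfderiv_pr_eq_zero_iff (hpr : MDifferentiable (𝓡 k) (𝓡 q) pr)
    {u : EuclideanSpace ℝ (Fin q) × F} (hu : u ∈ c.dom.target)
    (v : EuclideanSpace ℝ (Fin q) × F) :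
    mfderiv (𝓡 k) (𝓡 q) pr (c.dom.symm u)
      (mfderiv 𝓘(ℝ, EuclideanSpace ℝ (Fin q) × F) (𝓡 k) c.dom.symm u v) = 0 ↔ v.1 = 0 := by
  rw [c.mfderiv_pr hpr hu]
  exact map_eq_zero_iff _ (c.mfderiv_cod_symm_bijective hu).1

theorem exists_symm_eq {x : N} (hx : x ∈ c.dom.source) :
    ∃ u ∈ c.dom.target, c.dom.symm u = x :=
  ⟨c.dom x, c.dom.map_source hx, c.dom.left_inv hx⟩

end SubmersionChart

variable {D : (x : N) → Submodule ℝ (TangentSpace (𝓡 k) x)}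

/-- The fibres of the leaf space projection are the leaves. -/
theorem IsLeafSpaceProjection.exists_leaf (h : IsLeafSpaceProjection k q D pr) (x : N) :
    ∃ A, IsLeaf k D A ∧ x ∈ A ∧ ∀ y, pr y = pr x ↔ y ∈ A := by
  obtain ⟨A, hA, hxA, -⟩ := (h.eq_iff x x).1 rfl
  refine ⟨A, hA, hxA, fun y => ⟨fun hy => ?_, fun hy => (h.eq_iff y x).2 ⟨A, hA, hy, hxA⟩⟩⟩
  obtain ⟨A', ⟨⟨s, S, _, _, j, hj, hjA⟩, -⟩, hyA', hxA'⟩ := (h.eq_iff y x).1 hy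
  have := hA.2 s S _ _ j hj ⟨x, by rw [hjA]; exact ⟨hxA', hxA⟩⟩
  exact this (by rw [hjA]; exact hyA')

variable [IsManifold (𝓡 k) ∞ N] [IsManifold (𝓡 q) ∞ Q]

instance (x : N) : FiniteDimensional ℝ (TangentSpace (𝓡 k) x) :=
  inferInstanceAs (FiniteDimensional ℝ (EuclideanSpace ℝ (Fin k)))

theorem mfderiv_surjective_of_isSubmersion (hpr : Manifold.IsSubmersion (𝓡 k) (𝓡 q) ∞ pr) (x : N) :
    Function.Surjective (mfderiv (𝓡 k) (𝓡 q) pr x) := by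
  obtain ⟨F, _, _, c, hx, -, -⟩ := exists_submersionChart hpr x
  obtain ⟨u, hu, rfl⟩ := c.exists_symm_eq hx
  intro w
  obtain ⟨a, rfl⟩ := (c.mfderiv_cod_symm_bijective hu).2 w
  exact ⟨_, c.mfderiv_pr (hpr.contMDiff.mdifferentiable (by simp)) hu (a, 0)⟩

/-- In a submersion chart, keep the fibre coordinate constant. -/
theorem exists_local_section (hpr : Manifold.IsSubmersion (𝓡 k) (𝓡 q) ∞ pr) (x : N) :
    ∃ σ : Q → N, ContMDiffAt (𝓡 q) (𝓡 k) ∞ σ (pr x) ∧ σ (pr x) = x ∧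
      ∀ᶠ y in 𝓝 (pr x), pr (σ y) = y := by
  obtain ⟨F, _, _, c, hx, -, -⟩ := exists_submersionChart hpr x
  obtain ⟨u, hu, rfl⟩ := c.exists_symm_eq hx
  have hsrc : pr (c.dom.symm u) ∈ c.cod.source := c.mapsTo (c.dom.map_target hu)
  have hcod := (c.smooth_cod.contMDiffAt (c.cod.open_source.mem_nhds hsrc))
  have hval : (c.cod (pr (c.dom.symm u)), u.2) = u := by rw [c.cod_apply u hu]
  let τ : Q → EuclideanSpace ℝ (Fin q) × F := fun y => (c.cod y, u.2)
  have hτ : ContMDiffAt (𝓡 q) 𝓘(ℝ, EuclideanSpace ℝ (Fin q) × F) ∞ τ (pr (c.dom.symm u)) :=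
    hcod.prodMk_space contMDiffAt_const
  have hτu : τ (pr (c.dom.symm u)) = u := hval
  refine ⟨c.dom.symm ∘ τ, (hτu.symm ▸ c.contMDiffAt_symm hu :
    ContMDiffAt _ _ ∞ c.dom.symm (τ (pr (c.dom.symm u)))).comp _ hτ, by simp [hτu], ?_⟩
  have h1 : ∀ᶠ y in 𝓝 (pr (c.dom.symm u)), τ y ∈ c.dom.target :=
    hτ.continuousAt.eventually (hτu.symm ▸ c.dom.open_target.mem_nhds hu)
  filter_upwards [h1, c.cod.open_source.mem_nhds hsrc] with y hy hys
  rw [Function.comp_apply, c.pr_symm hy, c.cod.left_inv hys]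

/-- The projection is constant on a leaf, which gives `D ≤ ker`. Equality is a matter of dimension:
the leaf fills the whole fibre and is second countable, so its dimension cannot be smaller than that
of the fibre. -/
theorem IsLeafSpaceProjection.ker_mfderiv (h : IsLeafSpaceProjection k q D pr) (x : N) :
    LinearMap.ker (mfderiv (𝓡 k) (𝓡 q) pr x).toLinearMap = D x := by
  obtain ⟨A, ⟨⟨s, S, _, _, j, hj, hjA⟩, -⟩, hxA, hA⟩ := h.exists_leaf x
  have := hj.manifold
  have := hj.secondCountable
  have hprd : MDifferentiable (𝓡 k) (𝓡 q) pr := h.submersion.contMDiff.mdifferentiable (by simp)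
  have hjs := hj.submanifold.immersion.contMDiff
  have hle : ∀ t, D (j t) ≤ LinearMap.ker (mfderiv (𝓡 k) (𝓡 q) pr (j t)).toLinearMap := by
    intro t
    rw [← hj.tangent t]
    rintro _ ⟨v, rfl⟩
    have h1 := mfderiv_comp t (hprd (j t)) (hjs.mdifferentiable (by simp) t)
    have h2 : pr ∘ j = fun _ => pr x := by
      funext t'
      exact (hA _).2 (hjA ▸ mem_range_self t')
    rw [h2, mfderiv_const] at h1
    exact (congrArg (fun L => L v) h1).symm
  rw [← hjA] at hxA
  obtain ⟨t, rfl⟩ := hxA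
  refine (Submodule.eq_of_le_of_finrank_le (hle t) ?_).symm
  have hD : Module.finrank ℝ (D (j t)) = s := by
    rw [← hj.tangent t, tangentRange, LinearMap.finrank_range_of_inj
      (mfderiv_injective_of_isImmersion hj.submanifold.immersion t)]
    exact finrank_euclideanSpace_fin
  obtain ⟨F, _, _, c, hx, hF, hFk⟩ := exists_submersionChart h.submersion (j t)
  have hker : Module.finrank ℝ
      (LinearMap.ker (mfderiv (𝓡 k) (𝓡 q) pr (j t)).toLinearMap) + q = k := by
    have h1 := LinearMap.finrank_range_add_finrank_ker
      (mfderiv (𝓡 k) (𝓡 q) pr (j t)).toLinearMap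
    rw [LinearMap.range_eq_top.2 (mfderiv_surjective_of_isSubmersion h.submersion (j t)),
      finrank_top] at h1
    change Module.finrank ℝ (EuclideanSpace ℝ (Fin q)) + _ =
      Module.finrank ℝ (EuclideanSpace ℝ (Fin k)) at h1
    rw [finrank_euclideanSpace_fin, finrank_euclideanSpace_fin] at h1
    omega
  -- The fibre coordinate of the chart, restricted to the leaf, takes all values near that of `j t`,
  -- because every nearby point of the fibre lies on the leaf.
  have hkey : Module.finrank ℝ F ≤ s := by
    let g : S → F := fun t' => (c.dom (j t')).2
    let O : Set S := j ⁻¹' c.dom.source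
    refine finrank_le_of_interior_image_nonempty (h := g) (O := O) (fun t' ht' => ?_) ?_
    · have h1 := (c.smooth_dom.contMDiffAt (c.dom.open_source.mem_nhds ht')).comp t' (hjs t')
      exact contDiff_snd.contMDiff.contMDiffAt.comp t' h1
    · have hu0 : c.dom (j t) ∈ c.dom.target := c.dom.map_source hx
      refine ⟨(c.dom (j t)).2, mem_interior_iff_mem_nhds.2 ?_⟩
      have hcont : ContinuousAt (fun w : F => ((c.dom (j t)).1, w)) (c.dom (j t)).2 := by fun_prop
      filter_upwards [hcont.preimage_mem_nhds (c.dom.open_target.mem_nhds hu0)] with w hw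
      have hpw : pr (c.dom.symm ((c.dom (j t)).1, w)) = pr (j t) := by
        rw [c.pr_symm hw, ← c.pr_symm hu0, c.dom.left_inv hx]
      have hmem := (hA _).1 (hpw.trans ((hA _).2 (hjA ▸ mem_range_self t)))
      rw [← hjA] at hmem
      obtain ⟨t', ht'⟩ := hmem
      refine ⟨t', ?_, ?_⟩
      · change j t' ∈ c.dom.source
        rw [ht']
        exact c.dom.map_target hw
      · change (c.dom (j t')).2 = w
        rw [ht', c.dom.right_inv hw]
  omega

end Fibres

/-! ### Functions constant along the second factor. -/

section Slices

/-- A function on a convex open set whose derivative vanishes in the direction of the second factor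
does not depend on the second variable. -/
theorem eq_of_fderiv_snd_eq_zero {E F G : Type*} [NormedAddCommGroup E] [NormedSpace ℝ E]
    [NormedAddCommGroup F] [NormedSpace ℝ F] [NormedAddCommGroup G] [NormedSpace ℝ G]
    {f : E × F → G} {s : Set (E × F)} (hs : IsOpen s) (hconv : Convex ℝ s)
    (hf : ∀ p ∈ s, DifferentiableAt ℝ f p) (hf' : ∀ p ∈ s, ∀ w : F, fderiv ℝ f p (0, w) = 0)
    {y : E} {w w' : F} (hw : (y, w) ∈ s) (hw' : (y, w') ∈ s) : f (y, w) = f (y, w') := by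
  let ι : F → E × F := fun w => (y, w)
  have hι : ∀ w, HasFDerivAt ι (ContinuousLinearMap.inr ℝ E F) w :=
    fun w => hasFDerivAt_prodMk_right y w
  have hιc : Continuous ι := by fun_prop
  have hconv : Convex ℝ (ι ⁻¹' s) := by
    intro a ha b hb t t' ht ht' htt
    have := hconv ha hb ht ht' htt
    change (y, t • a + t' • b) ∈ s
    have h2 : t • ι a + t' • ι b = (y, t • a + t' • b) := by
      ext1
      · change t • y + t' • y = y
        rw [← add_smul, htt, one_smul]
      · rfl
    rwa [h2] at this
  exact (hs.preimage hιc).is_const_of_fderiv_eq_zero (𝕜 := ℝ) (f := fun w => f (ι w))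
    hconv.isPreconnected
    (fun w hw => ((hf _ hw).comp w (hι w).differentiableAt).differentiableWithinAt)
    (fun w hw => by
      have h1 : HasFDerivAt (fun w => f (ι w)) _ w := (hf _ hw).hasFDerivAt.comp w (hι w)
      rw [h1.fderiv]
      ext1 z
      exact hf' _ hw z) hw hw'

end Slices

/-! ### Descent of a basic one-form to the leaf space. -/

section Descent

open Filter Topology Set

variable {m k q : ℕ}
  {M : Type*} [TopologicalSpace M] [ChartedSpace (EuclideanSpace ℝ (Fin m)) M]
  [IsManifold (𝓡 m) ∞ M]
  {N : Type u} [TopologicalSpace N] [ChartedSpace (EuclideanSpace ℝ (Fin k)) N]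
  {Q : Type*} [TopologicalSpace Q] [ChartedSpace (EuclideanSpace ℝ (Fin q)) Q]
  {θ η : OneForm m M} {i : N → M} {pr : N → Q}

theorem isReebData_reebZ (hM : IsCocontact θ η) (hz : IsZVertical k θ η i)
    (ht : IsTHorizontal k θ i) (x : N) :
    IsReebData (θ.val (i x)) (η.val (i x)) (η.extD (i x)) (reebZ θ η (i x)) := by
  obtain ⟨n, hm, -, hw⟩ := hM
  refine isReebData_of_wedge_ne_zero (n := n) ?_ (hw (i x)) (ht x (hz x))
  rw [← hm]
  exact finrank_euclideanSpace_fin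

theorem mem_cocontactOrth_iff (hM : IsCocontact θ η) (hz : IsZVertical k θ η i)
    (ht : IsTHorizontal k θ i) (x : N) (w : TangentSpace (𝓡 m) (i x)) :
    w ∈ cocontactOrth θ η (i x) (tangentRange k m i x) ↔
      θ.val (i x) w = 0 ∧ η.val (i x) w = 0 ∧
        ∀ v, contract (η.extD (i x)) w (mfderiv (𝓡 k) (𝓡 m) i x v) = 0 := by
  rw [cocontactOrth, (isReebData_reebZ hM hz ht x).mem_lambdaOrth_of_reeb_mem (hz x) (ht x)]
  refine and_congr_right fun _ => and_congr_right fun _ => ⟨fun h v => h _ ⟨v, rfl⟩, ?_⟩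
  rintro h _ ⟨v, rfl⟩
  exact h v

theorem mem_orthDistribution_iff (hM : IsCocontact θ η) (hz : IsZVertical k θ η i)
    (ht : IsTHorizontal k θ i) (x : N) (v : TangentSpace (𝓡 k) x) :
    v ∈ orthDistribution k θ η i x ↔ η.val (i x) (mfderiv (𝓡 k) (𝓡 m) i x v) = 0 ∧
      ∀ w, contract (η.extD (i x)) (mfderiv (𝓡 k) (𝓡 m) i x v)
        (mfderiv (𝓡 k) (𝓡 m) i x w) = 0 := by
  refine (mem_cocontactOrth_iff hM hz ht x (mfderiv (𝓡 k) (𝓡 m) i x v)).trans ?_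
  exact and_iff_right (ht x ⟨v, rfl⟩)

variable (k) in
/-- The covector `β` at `pr x` pulls back to the restriction of `η` at `x`. -/
def IsDescent (η : OneForm m M) (i : N → M) (pr : N → Q) (x : N)
    (β : EuclideanSpace ℝ (Fin q) →L[ℝ] ℝ) : Prop :=
  ∀ v : TangentSpace (𝓡 k) x, η.val (i x) (mfderiv (𝓡 k) (𝓡 m) i x v) =
    β (mfderiv (𝓡 k) (𝓡 q) pr x v)

/-- This is Cartan's formula in coordinates: for vertical `ν`, the derivative of the coefficients
along `ν` is `i_ν dη + d(i_ν η)`, and both terms vanish. Convexity of the chart then gives constancy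
along the slices. -/
theorem SubmersionChart.pull_eq {F : Type} [NormedAddCommGroup F] [NormedSpace ℝ F]
    (c : SubmersionChart k q pr F) (hi : ContMDiff (𝓡 k) (𝓡 m) ∞ i)
    (hpr : MDifferentiable (𝓡 k) (𝓡 q) pr)
    (hker : ∀ (x : N) (v : TangentSpace (𝓡 k) x), mfderiv (𝓡 k) (𝓡 q) pr x v = 0 →
      η.val (i x) (mfderiv (𝓡 k) (𝓡 m) i x v) = 0 ∧
      ∀ w, contract (η.extD (i x)) (mfderiv (𝓡 k) (𝓡 m) i x v)
        (mfderiv (𝓡 k) (𝓡 m) i x w) = 0)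
    {u u' : EuclideanSpace ℝ (Fin q) × F} (hu : u ∈ c.dom.target) (hu' : u' ∈ c.dom.target)
    (huu : u.1 = u'.1) : η.pull (i ∘ c.dom.symm) u = η.pull (i ∘ c.dom.symm) u' := by
  set g := i ∘ c.dom.symm with hg
  have hgs : ∀ u ∈ c.dom.target, ContMDiffAt 𝓘(ℝ, EuclideanSpace ℝ (Fin q) × F) (𝓡 m) ∞ g u :=
    fun u hu => (hi _).comp u (c.contMDiffAt_symm hu)
  have hdg : ∀ u ∈ c.dom.target, ∀ v, mfderiv 𝓘(ℝ, EuclideanSpace ℝ (Fin q) × F) (𝓡 m) g u v =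
      mfderiv (𝓡 k) (𝓡 m) i (c.dom.symm u)
        (mfderiv 𝓘(ℝ, EuclideanSpace ℝ (Fin q) × F) (𝓡 k) c.dom.symm u v) := fun u hu v =>
    congrArg (fun L => L v) (mfderiv_comp u (hi.mdifferentiable (by simp) _)
      ((c.contMDiffAt_symm hu).mdifferentiableAt (by simp)))
  have hvert : ∀ u ∈ c.dom.target, ∀ w : F, mfderiv (𝓡 k) (𝓡 q) pr (c.dom.symm u)
      (mfderiv 𝓘(ℝ, EuclideanSpace ℝ (Fin q) × F) (𝓡 k) c.dom.symm u (0, w)) = 0 :=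
    fun u hu w => (c.mfderiv_pr_eq_zero_iff hpr hu (0, w)).2 rfl
  have hzero : ∀ u ∈ c.dom.target, ∀ w : F, η.pull g u (0, w) = 0 := fun u hu w => by
    exact (congrArg (η.val (g u)) (hdg u hu (0, w))).trans (hker _ _ (hvert u hu w)).1
  have hdiff : ∀ u ∈ c.dom.target, DifferentiableAt ℝ (η.pull g) u := fun u hu =>
    (η.contDiffAt_pull (hgs u hu)).differentiableAt (by simp)
  have hfd : ∀ u ∈ c.dom.target, ∀ w : F, fderiv ℝ (η.pull g) u (0, w) = 0 := by
    intro u hu w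
    refine ContinuousLinearMap.ext fun v => ?_
    have h1 := η.extD_mfderiv (hgs u hu) (0, w) v
    have h2 := (hker _ _ (hvert u hu w)).2
      (mfderiv 𝓘(ℝ, EuclideanSpace ℝ (Fin q) × F) (𝓡 k) c.dom.symm u v)
    -- The function `u ↦ η.pull g u (0, w)` vanishes near `u`, so its derivative in every direction
    -- is zero.
    have h3 : fderiv ℝ (η.pull g) u v (0, w) = 0 := by
      have h4 : HasFDerivAt (fun u => η.pull g u (0, w))
          ((ContinuousLinearMap.apply ℝ ℝ ((0, w) : EuclideanSpace ℝ (Fin q) × F)).comp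
            (fderiv ℝ (η.pull g) u)) u :=
        HasFDerivAt.comp (g := fun L : EuclideanSpace ℝ (Fin q) × F →L[ℝ] ℝ => L (0, w)) u
          (ContinuousLinearMap.apply ℝ ℝ ((0, w) : EuclideanSpace ℝ (Fin q) × F)).hasFDerivAt
          (hdiff u hu).hasFDerivAt
      have h5 : (fun u => η.pull g u (0, w)) =ᶠ[𝓝 u] fun _ => 0 := by
        filter_upwards [c.dom.open_target.mem_nhds hu] with y hy
        exact hzero y hy w
      have h6 := h4.unique ((hasFDerivAt_const (0 : ℝ) u).congr_of_eventuallyEq h5)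
      exact congrArg (fun L => L v) h6
    have h7 := (congrArg₂ (fun a b => contract (η.extD (g u)) a b) (hdg u hu (0, w))
      (hdg u hu v)).trans h2
    rw [h3, sub_zero] at h1
    exact h1.symm.trans h7
  obtain ⟨y, w⟩ := u
  obtain ⟨y', w'⟩ := u'
  obtain rfl : y = y' := huu
  exact eq_of_fderiv_snd_eq_zero c.dom.open_target c.convex hdiff hfd hu hu'

/-- Both the coefficients of the pulled back form and the differential of `pr` depend only on the
base coordinate, so the same covector works at both points. -/
theorem SubmersionChart.isDescent_of_isDescent {F : Type} [NormedAddCommGroup F] [NormedSpace ℝ F]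
    (c : SubmersionChart k q pr F) (hi : ContMDiff (𝓡 k) (𝓡 m) ∞ i)
    (hpr : MDifferentiable (𝓡 k) (𝓡 q) pr)
    (hker : ∀ (x : N) (v : TangentSpace (𝓡 k) x), mfderiv (𝓡 k) (𝓡 q) pr x v = 0 →
      η.val (i x) (mfderiv (𝓡 k) (𝓡 m) i x v) = 0 ∧
      ∀ w, contract (η.extD (i x)) (mfderiv (𝓡 k) (𝓡 m) i x v)
        (mfderiv (𝓡 k) (𝓡 m) i x w) = 0)
    {x x' : N} (hx : x ∈ c.dom.source) (hx' : x' ∈ c.dom.source) (hxx : pr x = pr x')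
    {β : EuclideanSpace ℝ (Fin q) →L[ℝ] ℝ} (h : IsDescent k η i pr x β) :
    IsDescent k η i pr x' β := by
  obtain ⟨u, hu, rfl⟩ := c.exists_symm_eq hx
  obtain ⟨u', hu', rfl⟩ := c.exists_symm_eq hx'
  have huu : u.1 = u'.1 := by rw [← c.cod_apply u hu, hxx, c.cod_apply u' hu']
  have hdg : ∀ u ∈ c.dom.target, ∀ v, η.pull (i ∘ c.dom.symm) u v =
      η.val (i (c.dom.symm u)) (mfderiv (𝓡 k) (𝓡 m) i (c.dom.symm u)
        (mfderiv 𝓘(ℝ, EuclideanSpace ℝ (Fin q) × F) (𝓡 k) c.dom.symm u v)) := fun u hu v =>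
    congrArg (fun L => η.val (i (c.dom.symm u)) (L v))
      (mfderiv_comp u (hi.mdifferentiable (by simp) _)
      ((c.contMDiffAt_symm hu).mdifferentiableAt (by simp)))
  intro v'
  obtain ⟨⟨a, b⟩, rfl⟩ := (c.mfderiv_symm_bijective hu').2 v'
  rw [← hdg u' hu', ← c.pull_eq hi hpr hker hu hu' huu, hdg u hu]
  refine (h _).trans ?_
  refine congrArg β ?_
  refine (c.mfderiv_pr hpr hu (a, b)).trans ?_
  refine Eq.trans ?_ (c.mfderiv_pr hpr hu' (a, b)).symm
  rw [huu]

variable [IsManifold (𝓡 k) ∞ N] [IsManifold (𝓡 q) ∞ Q]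

/-- A submersion chart compares only nearby points of a fibre. The comparison is propagated along
the leaf, which is connected in its own manifold topology. -/
theorem IsLeafSpaceProjection.isDescent_of_isDescent {D : (x : N) → Submodule ℝ (TangentSpace (𝓡 k) x)}
    (hpr : IsLeafSpaceProjection k q D pr) (hi : ContMDiff (𝓡 k) (𝓡 m) ∞ i)
    (hD : ∀ (x : N) (v : TangentSpace (𝓡 k) x), v ∈ D x →
      η.val (i x) (mfderiv (𝓡 k) (𝓡 m) i x v) = 0 ∧
      ∀ w, contract (η.extD (i x)) (mfderiv (𝓡 k) (𝓡 m) i x v)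
        (mfderiv (𝓡 k) (𝓡 m) i x w) = 0)
    {x y : N} (hxy : pr y = pr x) {β : EuclideanSpace ℝ (Fin q) →L[ℝ] ℝ}
    (h : IsDescent k η i pr x β) : IsDescent k η i pr y β := by
  have hker : ∀ (x : N) (v : TangentSpace (𝓡 k) x), mfderiv (𝓡 k) (𝓡 q) pr x v = 0 → v ∈ D x :=
    fun x v hv => by rw [← hpr.ker_mfderiv x]; exact hv
  have hprd : MDifferentiable (𝓡 k) (𝓡 q) pr := hpr.submersion.contMDiff.mdifferentiable (by simp)
  obtain ⟨A, ⟨⟨s, S, _, _, j, hj, hjA⟩, -⟩, hxA, hA⟩ := hpr.exists_leaf x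
  have := hj.manifold
  have := hj.connected
  have hjs := hj.submanifold.immersion.contMDiff
  have hfib : ∀ t, pr (j t) = pr x := fun t => (hA _).2 (hjA ▸ mem_range_self t)
  have hloc : ∀ t, ∀ᶠ t' in 𝓝 t, (IsDescent k η i pr (j t') β ↔ IsDescent k η i pr (j t) β) := by
    intro t
    obtain ⟨F, _, _, c, hx, -, -⟩ := exists_submersionChart hpr.submersion (j t)
    filter_upwards [hjs.continuous.continuousAt.preimage_mem_nhds
      (c.dom.open_source.mem_nhds hx)] with t' ht'
    have hp : pr (j t') = pr (j t) := (hfib t').trans (hfib t).symm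
    exact ⟨c.isDescent_of_isDescent hi hprd (fun x v hv => hD x v (hker x v hv)) ht' hx hp,
      c.isDescent_of_isDescent hi hprd (fun x v hv => hD x v (hker x v hv)) hx ht' hp.symm⟩
  have hclopen : IsClopen {t | IsDescent k η i pr (j t) β} := by
    constructor
    · rw [← isOpen_compl_iff, isOpen_iff_mem_nhds]
      intro t ht
      filter_upwards [hloc t] with t' ht' h'
      exact ht (ht'.1 h')
    · rw [isOpen_iff_mem_nhds]
      intro t ht
      filter_upwards [hloc t] with t' ht'
      exact ht'.2 ht
  rw [← hjA] at hxA
  obtain ⟨t, rfl⟩ := hxA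
  have huniv := hclopen.eq_univ ⟨t, h⟩
  have hy := (hA y).1 hxy
  rw [← hjA] at hy
  obtain ⟨t', rfl⟩ := hy
  exact (huniv ▸ mem_univ t' : t' ∈ {t | IsDescent k η i pr (j t) β})

/-- The covector `η ∘ di` kills the kernel of the surjection `d pr`, hence factors through it. -/
theorem exists_isDescent (hpr : Manifold.IsSubmersion (𝓡 k) (𝓡 q) ∞ pr)
    (hker : ∀ (x : N) (v : TangentSpace (𝓡 k) x), mfderiv (𝓡 k) (𝓡 q) pr x v = 0 →
      η.val (i x) (mfderiv (𝓡 k) (𝓡 m) i x v) = 0) (x : N) :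
    ∃ β : EuclideanSpace ℝ (Fin q) →L[ℝ] ℝ, IsDescent k η i pr x β := by
  let p : EuclideanSpace ℝ (Fin k) →ₗ[ℝ] EuclideanSpace ℝ (Fin q) :=
    (mfderiv (𝓡 k) (𝓡 q) pr x).toLinearMap
  obtain ⟨s, hs⟩ := p.exists_rightInverse_of_surjective
    (LinearMap.range_eq_top.2 (mfderiv_surjective_of_isSubmersion hpr x))
  let a : EuclideanSpace ℝ (Fin k) →ₗ[ℝ] ℝ :=
    (η.val (i x)).comp (mfderiv (𝓡 k) (𝓡 m) i x).toLinearMap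
  refine ⟨LinearMap.toContinuousLinearMap (a.comp s), fun (v : EuclideanSpace ℝ (Fin k)) => ?_⟩
  have h1 : p (v - s (p v)) = 0 := by
    have : p (s (p v)) = p v := congrArg (fun L => L (p v)) hs
    rw [map_sub, this, sub_self]
  have h2 : a (v - s (p v)) = 0 := hker x _ h1
  rw [map_sub, sub_eq_zero] at h2
  exact h2

/-- A `1`-form whose restriction to `N` annihilates the leaves together with its differential
descends to the leaf space. -/
theorem IsLeafSpaceProjection.exists_pullbacksAgree {D : (x : N) → Submodule ℝ (TangentSpace (𝓡 k) x)}
    (hpr : IsLeafSpaceProjection k q D pr) (hi : ContMDiff (𝓡 k) (𝓡 m) ∞ i)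
    (hD : ∀ (x : N) (v : TangentSpace (𝓡 k) x), v ∈ D x →
      η.val (i x) (mfderiv (𝓡 k) (𝓡 m) i x v) = 0 ∧
      ∀ w, contract (η.extD (i x)) (mfderiv (𝓡 k) (𝓡 m) i x v)
        (mfderiv (𝓡 k) (𝓡 m) i x w) = 0) :
    ∃ ηN : OneForm q Q, PullbacksAgree k i η pr ηN := by
  have hker : ∀ (x : N) (v : TangentSpace (𝓡 k) x), mfderiv (𝓡 k) (𝓡 q) pr x v = 0 → v ∈ D x :=
    fun x v hv => by rw [← hpr.ker_mfderiv x]; exact hv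
  have hex : ∀ z : Q, ∃ β : EuclideanSpace ℝ (Fin q) →L[ℝ] ℝ,
      ∀ x, pr x = z → IsDescent k η i pr x β := by
    intro z
    obtain ⟨x, rfl⟩ := hpr.surjective z
    obtain ⟨β, hβ⟩ := exists_isDescent (η := η) (i := i) hpr.submersion
      (fun x v hv => (hD x v (hker x v hv)).1) x
    exact ⟨β, fun y hy => hpr.isDescent_of_isDescent hi hD hy hβ⟩
  choose β hβ using hex
  refine ⟨⟨fun z => β z, contMDiff_of_eventually_pullback η (fun z => β z) fun z => ?_⟩,
    fun x v => hβ (pr x) x rfl v⟩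
  obtain ⟨x, rfl⟩ := hpr.surjective z
  obtain ⟨σ, hσ, hσx, hprσ⟩ := exists_local_section hpr.submersion x
  refine ⟨i ∘ σ, (hi _).comp _ hσ, ?_⟩
  have hd : ∀ᶠ y in 𝓝 (pr x), MDifferentiableAt (𝓡 q) (𝓡 k) σ y :=
    (contMDiffAt_iff_contMDiffAt_nhds (n := 1) (by simp)).1 (hσ.of_le (by simp)) |>.mono
      fun y hy => hy.mdifferentiableAt (by simp)
  filter_upwards [hprσ.eventually_nhds, hd] with y hy hdy v
  have h1 := mfderiv_comp y (hi.mdifferentiable (by simp) (σ y)) hdy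
  have h2 := mfderiv_comp y (hpr.submersion.contMDiff.mdifferentiable (by simp) (σ y)) hdy
  have h3 : pr ∘ σ =ᶠ[𝓝 y] id := hy
  rw [h3.mfderiv_eq, mfderiv_id] at h2
  have h4 := hβ y (σ y) hy.self_of_nhds (mfderiv (𝓡 q) (𝓡 k) σ y v)
  refine Eq.trans ?_ (h4.symm.trans (congrArg (fun L => η.val (i (σ y)) (L v)) h1).symm)
  exact congrArg (fun L => β y (L v)) h2

theorem PullbacksAgree.unique (hpr : Manifold.IsSubmersion (𝓡 k) (𝓡 q) ∞ pr)
    (hsurj : Function.Surjective pr) {η₁ η₂ : OneForm q Q}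
    (h₁ : PullbacksAgree k i η pr η₁) (h₂ : PullbacksAgree k i η pr η₂) : η₁ = η₂ := by
  ext z w
  obtain ⟨x, rfl⟩ := hsurj z
  obtain ⟨v, rfl⟩ := mfderiv_surjective_of_isSubmersion hpr x w
  exact (h₁ x v).symm.trans (h₂ x v)

/-- If the pullbacks of two `1`-forms agree, so do the pullbacks of their differentials, provided
that the kernel of the projection lies in the kernel of the differential upstairs. -/
theorem PullbacksAgree.extD (hpr : Manifold.IsSubmersion (𝓡 k) (𝓡 q) ∞ pr)
    (hi : ContMDiff (𝓡 k) (𝓡 m) ∞ i) {ηN : OneForm q Q} (h : PullbacksAgree k i η pr ηN) {x : N}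
    (hker : ∀ v : TangentSpace (𝓡 k) x, mfderiv (𝓡 k) (𝓡 q) pr x v = 0 →
      ∀ w, contract (η.extD (i x)) (mfderiv (𝓡 k) (𝓡 m) i x v)
        (mfderiv (𝓡 k) (𝓡 m) i x w) = 0)
    (v w : TangentSpace (𝓡 k) x) :
    contract (ηN.extD (pr x)) (mfderiv (𝓡 k) (𝓡 q) pr x v) (mfderiv (𝓡 k) (𝓡 q) pr x w) =
      contract (η.extD (i x)) (mfderiv (𝓡 k) (𝓡 m) i x v) (mfderiv (𝓡 k) (𝓡 m) i x w) := by
  obtain ⟨σ, hσ, hσx, hprσ⟩ := exists_local_section hpr x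
  have hd : ∀ᶠ y in 𝓝 (pr x), MDifferentiableAt (𝓡 q) (𝓡 k) σ y :=
    (contMDiffAt_iff_contMDiffAt_nhds (n := 1) (by simp)).1 (hσ.of_le (by simp)) |>.mono
      fun y hy => hy.mdifferentiableAt (by simp)
  have hσpr : ∀ᶠ y in 𝓝 (pr x), ∀ u, mfderiv (𝓡 k) (𝓡 q) pr (σ y) (mfderiv (𝓡 q) (𝓡 k) σ y u) = u := by
    filter_upwards [hprσ.eventually_nhds, hd] with y hy hdy u
    have h2 := mfderiv_comp y (hpr.contMDiff.mdifferentiable (by simp) (σ y)) hdy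
    have h3 : pr ∘ σ =ᶠ[𝓝 y] id := hy
    rw [h3.mfderiv_eq, mfderiv_id] at h2
    exact (congrArg (fun L => L u) h2).symm
  have hcomp : ∀ᶠ y in 𝓝 (pr x), ∀ u, mfderiv (𝓡 q) (𝓡 m) (i ∘ σ) y u =
      mfderiv (𝓡 k) (𝓡 m) i (σ y) (mfderiv (𝓡 q) (𝓡 k) σ y u) := by
    filter_upwards [hd] with y hdy u
    exact congrArg (fun L => L u) (mfderiv_comp y (hi.mdifferentiable (by simp) (σ y)) hdy)
  have h1 := OneForm.extD_eq_of_pullback ηN η (σ := i ∘ σ) ((hi _).comp _ hσ) (x := pr x) (by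
    filter_upwards [hprσ, hσpr, hcomp] with y hy hyσ hyc u
    rw [hyc]
    refine Eq.trans ?_ (h (σ y) (mfderiv (𝓡 q) (𝓡 k) σ y u)).symm
    rw [hyσ]
    have : ∀ z, z = y → ηN.val y u = ηN.val z u := by rintro _ rfl; rfl
    exact this _ hy)
  have hcomp' := hcomp.self_of_nhds
  have hσpr' := hσpr.self_of_nhds
  rw [h1, hcomp', hcomp']
  clear h1 hcomp hσpr hcomp' hd hprσ
  -- The vectors lifted by the section and the given ones have the same projection. They differ by
  -- vertical vectors, which `dη` annihilates along `N`.
  have key : ∀ y, y = x → ∀ a b : TangentSpace (𝓡 k) y,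
      mfderiv (𝓡 k) (𝓡 q) pr y a = mfderiv (𝓡 k) (𝓡 q) pr x v →
      mfderiv (𝓡 k) (𝓡 q) pr y b = mfderiv (𝓡 k) (𝓡 q) pr x w →
      contract (η.extD (i y)) (mfderiv (𝓡 k) (𝓡 m) i y a) (mfderiv (𝓡 k) (𝓡 m) i y b) =
      contract (η.extD (i x)) (mfderiv (𝓡 k) (𝓡 m) i x v) (mfderiv (𝓡 k) (𝓡 m) i x w) := by
    rintro _ rfl a b ha hb
    have h1 := hker (a - v) (by rw [map_sub, ha, sub_self]) b
    have h2 := hker (b - w) (by rw [map_sub, hb, sub_self]) v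
    rw [map_sub, map_sub, LinearMap.sub_apply, sub_eq_zero] at h1
    rw [h1, contract_swap, eq_comm, contract_swap, neg_inj]
    rw [map_sub, map_sub, LinearMap.sub_apply, sub_eq_zero] at h2
    exact h2.symm
  exact key _ hσx _ _ (hσpr' _) (hσpr' _)

end Descent

/-! ### The constant rank theorem, as a local parametrization of the image. -/

section ConstantRank

open Filter Topology Set

/-- Constant rank theorem: the local image of a map of constant rank is parametrized by an open subset
of the range of its derivative. -/
theorem exists_local_image_param_of_finrank_eq {E E' : Type*} [NormedAddCommGroup E]
    [NormedSpace ℝ E] [FiniteDimensional ℝ E] [NormedAddCommGroup E'] [NormedSpace ℝ E']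
    [FiniteDimensional ℝ E'] {f : E → E'} {x₀ : E} {ρ : ℕ} (hf : ContDiffAt ℝ ∞ f x₀)
    (hrank : ∀ᶠ x in 𝓝 x₀, Module.finrank ℝ (LinearMap.range (fderiv ℝ f x).toLinearMap) = ρ)
    {W : Set E} (hW : W ∈ 𝓝 x₀) :
    ∃ (A : E' →L[ℝ] LinearMap.range (fderiv ℝ f x₀).toLinearMap)
      (s : LinearMap.range (fderiv ℝ f x₀).toLinearMap → E) (U : Set E)
      (B : Set (LinearMap.range (fderiv ℝ f x₀).toLinearMap)),
      U ∈ 𝓝 x₀ ∧ U ⊆ W ∧ B ∈ 𝓝 (A (f x₀)) ∧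
      (∀ u ∈ B, DifferentiableAt ℝ s u ∧ s u ∈ U ∧ A (f (s u)) = u) ∧
      ∀ x ∈ U, A (f x) ∈ B ∧ f (s (A (f x))) = f x := by
  set L := fderiv ℝ f x₀ with hL
  let G := LinearMap.range L.toLinearMap
  let K := LinearMap.ker L.toLinearMap
  obtain ⟨A₀, hA₀⟩ := G.subtype.exists_leftInverse_of_injective G.ker_subtype
  obtain ⟨κ₀, hκ₀⟩ := K.subtype.exists_leftInverse_of_injective K.ker_subtype
  let A : E' →L[ℝ] G := LinearMap.toContinuousLinearMap A₀
  let κ : E →L[ℝ] K := LinearMap.toContinuousLinearMap κ₀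
  have hA : ∀ g : G, A g = g := fun g => congrArg (fun T => T g) hA₀
  have hκ : ∀ g : K, κ g = g := fun g => congrArg (fun T => T g) hκ₀
  -- Coordinates adapted to `f`: the component of `f` along the range of its derivative, completed
  -- by a projection to the kernel. The derivative of `Φ` at `x₀` is an isomorphism.
  let Φ : E → G × K := fun x => (A (f x), κ x)
  have hΦ : ContDiffAt ℝ ∞ Φ x₀ :=
    (A.contDiff.contDiffAt.comp x₀ hf).prodMk κ.contDiff.contDiffAt
  have hfd : DifferentiableAt ℝ f x₀ := hf.differentiableAt (by simp)
  let T : E →L[ℝ] G × K := (A.comp L).prod κ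
  have hT : HasFDerivAt Φ T x₀ :=
    (A.hasFDerivAt.comp x₀ hfd.hasFDerivAt).prodMk κ.hasFDerivAt
  have hTinj : Function.Injective T := by
    refine (injective_iff_map_eq_zero T).2 fun v hv => ?_
    have h1 : A (L v) = 0 := congrArg Prod.fst hv
    have h2 : κ v = 0 := congrArg Prod.snd hv
    have h3 : L v = 0 := by
      have := hA ⟨L v, v, rfl⟩
      change A (L v) = _ at this
      rw [h1] at this
      exact (congrArg Subtype.val this).symm
    have := hκ ⟨v, h3⟩
    change κ v = _ at this
    rw [h2] at this
    exact (congrArg Subtype.val this).symm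
  have hdim : Module.finrank ℝ E = Module.finrank ℝ (G × K) := by
    rw [Module.finrank_prod]
    exact (LinearMap.finrank_range_add_finrank_ker L.toLinearMap).symm
  let Te : E ≃L[ℝ] G × K :=
    (LinearEquiv.ofInjectiveOfFinrankEq T.toLinearMap hTinj hdim).toContinuousLinearEquiv
  have hTe : HasFDerivAt Φ (Te : E →L[ℝ] G × K) x₀ := hT
  let e := hΦ.toOpenPartialHomeomorph Φ hTe (by simp)
  have he : ∀ x, e x = Φ x := fun x => rfl
  have hx₀ : x₀ ∈ e.source := hΦ.mem_toOpenPartialHomeomorph_source hTe (by simp)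
  have hΘ : ContDiffAt ℝ ∞ e.symm (Φ x₀) := hΦ.to_localInverse hTe (by simp)
  have hΘx₀ : e.symm (Φ x₀) = x₀ := e.left_inv hx₀
  have hev : ∀ᶠ p in 𝓝 (Φ x₀), p ∈ e.target ∧ DifferentiableAt ℝ e.symm p ∧
      DifferentiableAt ℝ f (e.symm p) ∧
      Module.finrank ℝ (LinearMap.range (fderiv ℝ f (e.symm p)).toLinearMap) = ρ ∧
      e.symm p ∈ W := by
    have hcont : Tendsto e.symm (𝓝 (Φ x₀)) (𝓝 x₀) := by
      have := hΘ.continuousAt.tendsto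
      rwa [hΘx₀] at this
    have htgt : ∀ᶠ p in 𝓝 (Φ x₀), p ∈ e.target := e.open_target.mem_nhds (e.map_source hx₀)
    refine htgt.and (Eventually.and ?_ (Eventually.and ?_
      ((hcont.eventually hrank).and (hcont.eventually hW))))
    · exact ((hΘ.of_le (m := 1) (by simp)).eventually (by simp)).mono
        fun p hp => hp.differentiableAt (by simp)
    · exact hcont.eventually (((hf.of_le (m := 1) (by simp)).eventually (by simp)).mono
        fun p hp => hp.differentiableAt (by simp))
  obtain ⟨ε, hε, hball⟩ := Metric.eventually_nhds_iff_ball.1 hev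
  have hAΘ : ∀ p ∈ e.target, A (f (e.symm p)) = p.1 := fun p hp =>
    congrArg Prod.fst (e.right_inv hp)
  let Ψ : G × K → E' := fun p => f (e.symm p)
  have hΨd : ∀ p ∈ Metric.ball (Φ x₀) ε, HasFDerivAt Ψ
      ((fderiv ℝ f (e.symm p)).comp (fderiv ℝ e.symm p)) p := fun p hp =>
    (hball p hp).2.2.1.hasFDerivAt.comp p (hball p hp).2.1.hasFDerivAt
  -- In these coordinates `A ∘ f` is the first projection, so `A` maps the range of the derivative
  -- onto `G`. Constant rank makes this map injective as well, and a vector `(0, w)` is sent to zero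
  -- by it.
  have hΨ0 : ∀ p ∈ Metric.ball (Φ x₀) ε, ∀ w : K, fderiv ℝ Ψ p (0, w) = 0 := by
    intro p hp w
    let R := LinearMap.range (fderiv ℝ f (e.symm p)).toLinearMap
    have hmem : ∀ v, fderiv ℝ Ψ p v ∈ R := fun v => by
      rw [(hΨd p hp).fderiv]
      exact ⟨_, rfl⟩
    have hfst : ∀ v, A (fderiv ℝ Ψ p v) = v.1 := by
      have h1 : HasFDerivAt (fun p => A (Ψ p)) (A.comp (fderiv ℝ Ψ p)) p :=
        A.hasFDerivAt.comp p (hΨd p hp).differentiableAt.hasFDerivAt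
      have h2 : (fun p => A (Ψ p)) =ᶠ[𝓝 p] Prod.fst := by
        filter_upwards [e.open_target.mem_nhds (hball p hp).1] with p' hp'
        exact hAΘ p' hp'
      have h3 := h1.unique (hasFDerivAt_fst.congr_of_eventuallyEq h2)
      exact fun v => congrArg (fun T => T v) h3
    let AR : R →ₗ[ℝ] G := A.toLinearMap.comp R.subtype
    have hsurj : Function.Surjective AR := fun g => ⟨⟨_, hmem (g, 0)⟩, hfst (g, 0)⟩
    have hρ : Module.finrank ℝ R = Module.finrank ℝ G := by
      rw [(hball p hp).2.2.2.1, hrank.self_of_nhds]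
    have hinj : Function.Injective AR :=
      (LinearMap.injective_iff_surjective_of_finrank_eq_finrank hρ).2 hsurj
    have h4 : AR ⟨_, hmem (0, w)⟩ = 0 := hfst (0, w)
    exact congrArg Subtype.val ((injective_iff_map_eq_zero AR).1 hinj _ h4)
  have hmemball : ∀ u ∈ Metric.ball (A (f x₀)) ε, (u, κ x₀) ∈ Metric.ball (Φ x₀) ε := by
    intro u hu
    rw [← ball_prod_same]
    exact ⟨hu, Metric.mem_ball_self hε⟩
  refine ⟨A, fun u => e.symm (u, κ x₀), e.source ∩ e ⁻¹' Metric.ball (Φ x₀) ε,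
    Metric.ball (A (f x₀)) ε, ?_, fun x hx => ?_, Metric.ball_mem_nhds _ hε, fun u hu => ?_, fun x hx => ?_⟩
  · exact (e.isOpen_inter_preimage Metric.isOpen_ball).mem_nhds ⟨hx₀, Metric.mem_ball_self hε⟩
  · have hxW := (hball (e x) hx.2).2.2.2.2
    rwa [e.left_inv hx.1] at hxW
  · have hb := hmemball u hu
    have ht := (hball _ hb).1
    refine ⟨?_, ⟨e.map_target ht, ?_⟩, hAΘ _ ht⟩
    · exact (hball _ hb).2.1.comp u (differentiableAt_id.prodMk (differentiableAt_const _))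
    · rw [mem_preimage, e.right_inv ht]
      exact hb
  · obtain ⟨hxs, hxb⟩ := hx
    have h1 : A (f x) ∈ Metric.ball (A (f x₀)) ε := by
      have h2 : (A (f x), κ x) ∈ Metric.ball (Φ x₀) ε := hxb
      rw [← ball_prod_same] at h2
      exact h2.1
    refine ⟨h1, ?_⟩
    have h3 := eq_of_fderiv_snd_eq_zero Metric.isOpen_ball (convex_ball (Φ x₀) ε)
      (fun p hp => (hΨd p hp).differentiableAt) hΨ0 (hmemball _ h1)
      (hxb : (A (f x), κ x) ∈ Metric.ball (Φ x₀) ε)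
    refine h3.trans ?_
    exact congrArg f (e.left_inv hxs)

theorem finrank_range_comp_comp {V₁ V₂ V₃ V₄ : Type*} [AddCommGroup V₁] [Module ℝ V₁]
    [AddCommGroup V₂] [Module ℝ V₂] [AddCommGroup V₃] [Module ℝ V₃] [AddCommGroup V₄] [Module ℝ V₄]
    (T : V₃ →ₗ[ℝ] V₄) (f : V₂ →ₗ[ℝ] V₃) (S : V₁ →ₗ[ℝ] V₂) (hT : Function.Injective T)
    (hS : Function.Surjective S) : Module.finrank ℝ (LinearMap.range (T ∘ₗ f ∘ₗ S)) =
      Module.finrank ℝ (LinearMap.range f) := by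
  rw [LinearMap.range_comp, LinearMap.range_comp_of_range_eq_top f (LinearMap.range_eq_top.2 hS)]
  exact (Submodule.equivMapOfInjective T hT _).finrank_eq.symm

/-- Constant rank theorem on manifolds. -/
theorem exists_local_image_param_of_finrank_mfderiv_eq {c q : ℕ}
    {K : Type*} [TopologicalSpace K] [ChartedSpace (EuclideanSpace ℝ (Fin c)) K]
    [IsManifold (𝓡 c) ∞ K]
    {Q : Type*} [TopologicalSpace Q] [ChartedSpace (EuclideanSpace ℝ (Fin q)) Q]
    [IsManifold (𝓡 q) ∞ Q] {f : K → Q} (hf : ContMDiff (𝓡 c) (𝓡 q) ∞ f) {ρ : ℕ}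
    (hrank : ∀ x, Module.finrank ℝ (LinearMap.range (mfderiv (𝓡 c) (𝓡 q) f x).toLinearMap) = ρ)
    (x₀ : K) :
    ∃ (G : Type) (_ : NormedAddCommGroup G) (_ : NormedSpace ℝ G) (A : Q → G) (s : G → K)
      (U : Set K) (B : Set G) (O : Set Q),
      FiniteDimensional ℝ G ∧ Module.finrank ℝ G = ρ ∧ U ∈ 𝓝 x₀ ∧ B ∈ 𝓝 (A (f x₀)) ∧
      IsOpen O ∧ MapsTo f U O ∧ (∀ y ∈ O, ContMDiffAt (𝓡 q) 𝓘(ℝ, G) ∞ A y) ∧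
      (∀ u ∈ B, MDifferentiableAt 𝓘(ℝ, G) (𝓡 c) s u ∧ s u ∈ U ∧ A (f (s u)) = u) ∧
      ∀ x ∈ U, A (f x) ∈ B ∧ f (s (A (f x))) = f x := by
  let φ := extChartAt (𝓡 c) x₀
  let ψ := extChartAt (𝓡 q) (f x₀)
  let g : EuclideanSpace ℝ (Fin c) → EuclideanSpace ℝ (Fin q) := fun z => ψ (f (φ.symm z))
  let W : Set (EuclideanSpace ℝ (Fin c)) := φ.target ∩ φ.symm ⁻¹' (f ⁻¹' ψ.source)
  have hψ : ∀ y ∈ ψ.source, ContMDiffAt (𝓡 q) 𝓘(ℝ, EuclideanSpace ℝ (Fin q)) ∞ ψ y :=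
    fun y hy => contMDiffAt_extChartAt' (by simpa [ψ] using hy)
  have hφ : ∀ z ∈ φ.target, ContMDiffAt 𝓘(ℝ, EuclideanSpace ℝ (Fin c)) (𝓡 c) ∞ φ.symm z :=
    fun z hz => contMDiffAt_extChartAt_symm _ hz
  have hg : ∀ z ∈ W, ContDiffAt ℝ ∞ g z := fun z hz =>
    contMDiffAt_iff_contDiffAt.1 ((hψ _ hz.2).comp z ((hf _).comp z (hφ z hz.1)))
  have hW : W ∈ 𝓝 (φ x₀) := by
    refine inter_mem (extChartAt_target_mem_nhds (I := 𝓡 c) x₀) ?_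
    have h1 := (hφ (φ x₀) (mem_extChartAt_target x₀)).continuousAt
    refine h1.preimage_mem_nhds (hf.continuous.continuousAt.preimage_mem_nhds ?_)
    rw [extChartAt_to_inv (I := 𝓡 c) x₀]
    exact extChartAt_source_mem_nhds (I := 𝓡 q) (f x₀)
  have hgrank : ∀ z ∈ W, Module.finrank ℝ (LinearMap.range (fderiv ℝ g z).toLinearMap) = ρ := by
    intro z hz
    have h1 : fderiv ℝ g z = (mfderiv (𝓡 q) 𝓘(ℝ, EuclideanSpace ℝ (Fin q)) ψ (f (φ.symm z))).comp
        ((mfderiv (𝓡 c) (𝓡 q) f (φ.symm z)).comp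
          (mfderiv 𝓘(ℝ, EuclideanSpace ℝ (Fin c)) (𝓡 c) φ.symm z)) := by
      have hz' := (hφ z hz.1).mdifferentiableAt (by simp)
      have hf' := (hf (φ.symm z)).mdifferentiableAt (by simp)
      rw [← mfderiv_eq_fderiv, ← mfderiv_comp z hf' hz']
      exact mfderiv_comp z ((hψ _ hz.2).mdifferentiableAt (by simp)) (hf'.comp z hz')
    rw [h1]
    refine (finrank_range_comp_comp
      (mfderiv (𝓡 q) 𝓘(ℝ, EuclideanSpace ℝ (Fin q)) ψ (f (φ.symm z))).toLinearMap
      (mfderiv (𝓡 c) (𝓡 q) f (φ.symm z)).toLinearMap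
      (mfderiv 𝓘(ℝ, EuclideanSpace ℝ (Fin c)) (𝓡 c) φ.symm z).toLinearMap ?_ ?_).trans (hrank _)
    · exact (isInvertible_mfderiv_extChartAt hz.2).bijective.1
    · have h2 := isInvertible_mfderivWithin_extChartAt_symm (I := 𝓡 c) hz.1
      rw [(𝓡 c).range_eq_univ, mfderivWithin_univ] at h2
      exact h2.bijective.2
  obtain ⟨A, s, U, B, hU, hUW, hB, hs, hUB⟩ := exists_local_image_param_of_finrank_eq
    (hg _ (mem_of_mem_nhds hW)) (Filter.mem_of_superset hW hgrank) hW
  have hx₀ : φ.symm (φ x₀) = x₀ := extChartAt_to_inv (I := 𝓡 c) x₀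
  have hB' : B ∈ 𝓝 (A (ψ (f x₀))) := by
    have h1 : g (φ x₀) = ψ (f x₀) := by simp only [g, hx₀]
    rwa [← h1]
  have hgφ : ∀ x ∈ φ.source, g (φ x) = ψ (f x) := fun x hx => by simp only [g, φ.left_inv hx]
  refine ⟨_, inferInstance, inferInstance, fun y => A (ψ y), fun u => φ.symm (s u),
    φ.source ∩ φ ⁻¹' U, B, ψ.source, inferInstance, (hgrank _ (mem_of_mem_nhds hW)), ?_, hB',
    isOpen_extChartAt_source _, fun x hx => ?_, fun y hy => ?_, fun u hu => ?_, fun x hx => ?_⟩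
  · exact inter_mem (extChartAt_source_mem_nhds x₀)
      ((continuousAt_extChartAt x₀).preimage_mem_nhds hU)
  · have h1 := (hUW hx.2).2
    rwa [mem_preimage, mem_preimage, φ.left_inv hx.1] at h1
  · exact A.contMDiff.contMDiffAt.comp y (hψ y hy)
  · obtain ⟨h1, h2, h3⟩ := hs u hu
    have h4 := (hUW h2).1
    refine ⟨?_, ⟨φ.map_target h4, ?_⟩, h3⟩
    · exact ((hφ _ h4).mdifferentiableAt (by simp)).comp u h1.mdifferentiableAt
    · rwa [mem_preimage, φ.right_inv h4]
  · obtain ⟨h1, h2⟩ := hUB (φ x) hx.2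
    have hxψ := (hUW hx.2).2
    rw [mem_preimage, mem_preimage, φ.left_inv hx.1] at hxψ
    rw [hgφ x hx.1] at h1 h2
    exact ⟨h1, ψ.injOn (hUW (hs _ h1).2.1).2 hxψ h2⟩

end ConstantRank

/-! ### Transferring the Legendrian condition between two parametrizations of the same set. -/

section Legendrian

open Filter Topology Set

variable {c r q : ℕ}
  {K : Type*} [TopologicalSpace K] [ChartedSpace (EuclideanSpace ℝ (Fin c)) K]
  [IsManifold (𝓡 c) ∞ K]
  {P : Type*} [TopologicalSpace P] [ChartedSpace (EuclideanSpace ℝ (Fin r)) P]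
  {Q : Type*} [TopologicalSpace Q] [ChartedSpace (EuclideanSpace ℝ (Fin q)) Q]
  [IsManifold (𝓡 q) ∞ Q] {f : K → Q} {p : P → Q} {ρ : ℕ}

/-- Countably many compact pieces of `K`, each inside a constant rank neighbourhood, have closed
images whose preimages cover `P`. By Baire their interiors have dense union, and at an interior
point `p` factors smoothly through `f`. -/
theorem dense_setOf_range_mfderiv_le [SecondCountableTopology K] [T2Space P] [T2Space Q]
    (hf : ContMDiff (𝓡 c) (𝓡 q) ∞ f) (hp : ContMDiff (𝓡 r) (𝓡 q) ∞ p)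
    (hrank : ∀ x, Module.finrank ℝ (LinearMap.range (mfderiv (𝓡 c) (𝓡 q) f x).toLinearMap) = ρ)
    (hfp : range p ⊆ range f) :
    Dense {y : P | ∃ x : K, f x = p y ∧ ∀ v, ∃ w,
      (mfderiv (𝓡 r) (𝓡 q) p y v : EuclideanSpace ℝ (Fin q)) = mfderiv (𝓡 c) (𝓡 q) f x w} := by
  have := ChartedSpace.locallyCompactSpace (EuclideanSpace ℝ (Fin c)) K
  have := ChartedSpace.locallyCompactSpace (EuclideanSpace ℝ (Fin r)) P
  choose G hG1 hG2 A s U B O hdata using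
    fun x => exists_local_image_param_of_finrank_mfderiv_eq hf hrank x
  have hC : ∀ x, ∃ C ∈ 𝓝 x, C ⊆ U x ∧ IsCompact C := fun x =>
    local_compact_nhds (hdata x).2.2.1
  choose C hCx hCU hC using hC
  obtain ⟨S, hS, hSC⟩ := TopologicalSpace.countable_cover_nhds hCx
  have hdense := dense_biUnion_interior_of_closed (S := S) (f := fun x => p ⁻¹' (f '' C x))
    (fun x _ => ((hC x).image hf.continuous).isClosed.preimage hp.continuous) hS (by
      refine eq_univ_of_forall fun y => ?_
      obtain ⟨x, hx⟩ := hfp ⟨y, rfl⟩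
      obtain ⟨x', hx', hxC⟩ := mem_iUnion₂.1 (hSC.ge (mem_univ x))
      exact mem_iUnion₂.2 ⟨x', hx', x, hxC, hx⟩)
  refine hdense.mono fun y hy => ?_
  obtain ⟨x, -, hy⟩ := mem_iUnion₂.1 hy
  obtain ⟨-, -, -, -, -, hfO, hA, hs, hU⟩ := hdata x
  have hev : ∀ᶠ y' in 𝓝 y, p y' ∈ O x ∧ A x (p y') ∈ B x ∧ f (s x (A x (p y'))) = p y' := by
    filter_upwards [mem_interior_iff_mem_nhds.1 hy] with y' hy'
    obtain ⟨x', hx', hxy⟩ := hy'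
    rw [← hxy]
    exact ⟨hfO (hCU x hx'), hU x' (hCU x hx')⟩
  obtain ⟨hyO, hyB, hyf⟩ := hev.self_of_nhds
  refine ⟨s x (A x (p y)), hyf, fun v => ?_⟩
  have hpd := (hp y).mdifferentiableAt (by simp)
  have hAd := (hA _ hyO).mdifferentiableAt (by simp)
  have hsd := (hs _ hyB).1
  have hfd := (hf (s x (A x (p y)))).mdifferentiableAt (by simp)
  -- The local parametrization `s` of the image inverts `A` there, so `p` is recovered from `A ∘ p`.
  have h1 : p =ᶠ[𝓝 y] f ∘ (s x ∘ (A x ∘ p)) := hev.mono fun y' hy' => hy'.2.2.symm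
  have h2 := mfderiv_comp y hfd (hsd.comp y (hAd.comp y hpd))
  exact ⟨mfderiv (𝓡 r) (𝓡 c) (s x ∘ (A x ∘ p)) y v,
    congrArg (fun T : EuclideanSpace ℝ (Fin r) →L[ℝ] EuclideanSpace ℝ (Fin q) => T v)
      (h1.mfderiv_eq.trans h2)⟩

variable [IsManifold (𝓡 r) ∞ P]

/-- The image of `f` contains a `ρ`-dimensional piece on which `A` has open image. It is covered by
`p`, so a smooth map from (an open part of) the `r`-dimensional `P` has an image with interior in
dimension `ρ`. -/
theorem rank_le_of_range_subset [SecondCountableTopology P] (hf : ContMDiff (𝓡 c) (𝓡 q) ∞ f) (hp : ContMDiff (𝓡 r) (𝓡 q) ∞ p)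
    (hrank : ∀ x, Module.finrank ℝ (LinearMap.range (mfderiv (𝓡 c) (𝓡 q) f x).toLinearMap) = ρ)
    (hfp : range f ⊆ range p) (x : K) : ρ ≤ r := by
  obtain ⟨G, _, _, A, s, U, B, O, _, rfl, hU, hB, hO, hfO, hA, hs, -⟩ :=
    exists_local_image_param_of_finrank_mfderiv_eq hf hrank x
  refine finrank_le_of_interior_image_nonempty (h := fun y => A (p y)) (O := p ⁻¹' O)
    (fun y hy => (hA _ hy).comp y (hp y)) ⟨A (f x), mem_interior_iff_mem_nhds.2 ?_⟩
  refine mem_of_superset hB fun u hu => ?_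
  obtain ⟨y, hy⟩ := hfp ⟨s u, rfl⟩
  refine ⟨y, ?_, ?_⟩
  · rw [mem_preimage, hy]
    exact hfO (hs u hu).2.1
  · simp only [hy]
    exact (hs u hu).2.2

theorem OneForm.pull_comp_extChartAt_symm (α : OneForm q Q) (hp : ContMDiff (𝓡 r) (𝓡 q) ∞ p)
    (y₀ : P) {z : EuclideanSpace ℝ (Fin r)} (hz : z ∈ (extChartAt (𝓡 r) y₀).target)
    (v : EuclideanSpace ℝ (Fin r)) :
    α.pull (p ∘ (extChartAt (𝓡 r) y₀).symm) z v =
      α.val (p ((extChartAt (𝓡 r) y₀).symm z)) (mfderiv (𝓡 r) (𝓡 q) p ((extChartAt (𝓡 r) y₀).symm z)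
        (mfderiv 𝓘(ℝ, EuclideanSpace ℝ (Fin r)) (𝓡 r) (extChartAt (𝓡 r) y₀).symm z v)) := by
  rw [OneForm.pull_apply, mfderiv_comp z ((hp _).mdifferentiableAt (by simp))
    ((contMDiffAt_extChartAt_symm y₀ hz).mdifferentiableAt (by simp))]
  rfl

theorem OneForm.pull_comp_extChartAt_symm_self (α : OneForm q Q) (hp : ContMDiff (𝓡 r) (𝓡 q) ∞ p)
    (y₀ : P) (v : EuclideanSpace ℝ (Fin r)) :
    α.pull (p ∘ (extChartAt (𝓡 r) y₀).symm) (extChartAt (𝓡 r) y₀ y₀) v =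
      α.val (p y₀) (mfderiv (𝓡 r) (𝓡 q) p y₀ v) := by
  rw [α.pull_comp_extChartAt_symm hp y₀ (mem_extChartAt_target y₀), mfderiv_extChartAt_symm_self]
  have h : ∀ y, y = y₀ → α.val (p y) (mfderiv (𝓡 r) (𝓡 q) p y v) =
      α.val (p y₀) (mfderiv (𝓡 r) (𝓡 q) p y₀ v) := by
    rintro y rfl
    rfl
  exact h _ (extChartAt_to_inv (I := 𝓡 r) y₀)

/-- If a `1`-form vanishes on the tangent spaces of a submanifold at a dense set of points, then it
does so everywhere. -/
theorem OneForm.val_mfderiv_eq_zero_of_dense (α : OneForm q Q) (hp : ContMDiff (𝓡 r) (𝓡 q) ∞ p)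
    (hd : Dense {y | ∀ v, α.val (p y) (mfderiv (𝓡 r) (𝓡 q) p y v) = 0}) (y₀ : P)
    (v : TangentSpace (𝓡 r) y₀) : α.val (p y₀) (mfderiv (𝓡 r) (𝓡 q) p y₀ v) = 0 := by
  let φ := extChartAt (𝓡 r) y₀
  have hg : ContMDiffAt 𝓘(ℝ, EuclideanSpace ℝ (Fin r)) (𝓡 q) ∞ (p ∘ φ.symm) (φ y₀) :=
    (hp _).comp _ (contMDiffAt_extChartAt_symm y₀ (mem_extChartAt_target y₀))
  have hcont : ContinuousAt (fun y => α.pull (p ∘ φ.symm) (φ y) v) y₀ := by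
    have h1 := (α.contDiffAt_pull hg).continuousAt.clm_apply (continuousAt_const (y := v))
    exact ContinuousAt.comp (g := fun z => α.pull (p ∘ φ.symm) z v) h1 (continuousAt_extChartAt y₀)
  rw [← α.pull_comp_extChartAt_symm_self hp y₀ v]
  by_contra hne
  obtain ⟨y, hyD, hys, hy⟩ := hd.inter_nhds_nonempty
    (inter_mem (extChartAt_source_mem_nhds (I := 𝓡 r) y₀) (hcont.eventually_ne hne))
  refine hy ?_
  refine (α.pull_comp_extChartAt_symm hp y₀ (φ.map_source hys) v).trans ?_
  have h : ∀ y', y' = y → ∀ v, α.val (p y') (mfderiv (𝓡 r) (𝓡 q) p y' v) = 0 := by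
    rintro _ rfl
    exact hyD
  exact h _ (φ.left_inv hys) _

/-- The pullback of the form to a chart of `P` vanishes near the point, and the exterior derivative
commutes with pullbacks. -/
theorem OneForm.extD_mfderiv_eq_zero (α : OneForm q Q) (hp : ContMDiff (𝓡 r) (𝓡 q) ∞ p)
    (h : ∀ y v, α.val (p y) (mfderiv (𝓡 r) (𝓡 q) p y v) = 0) (y₀ : P)
    (v w : TangentSpace (𝓡 r) y₀) :
    contract (α.extD (p y₀)) (mfderiv (𝓡 r) (𝓡 q) p y₀ v) (mfderiv (𝓡 r) (𝓡 q) p y₀ w) = 0 := by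
  let φ := extChartAt (𝓡 r) y₀
  have hφ := contMDiffAt_extChartAt_symm y₀ (mem_extChartAt_target (I := 𝓡 r) y₀)
  have hg : ContMDiffAt 𝓘(ℝ, EuclideanSpace ℝ (Fin r)) (𝓡 q) ∞ (p ∘ φ.symm) (φ y₀) :=
    (hp _).comp _ hφ
  have h1 := α.extD_mfderiv hg v w
  have h2 : α.pull (p ∘ φ.symm) =ᶠ[𝓝 (φ y₀)] fun _ => 0 := by
    filter_upwards [extChartAt_target_mem_nhds (I := 𝓡 r) y₀] with z hz
    ext u
    exact (α.pull_comp_extChartAt_symm hp y₀ hz u).trans (h _ _)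
  rw [h2.fderiv_eq, fderiv_fun_const, mfderiv_comp (φ y₀) ((hp _).mdifferentiableAt (by simp))
    (hφ.mdifferentiableAt (by simp))] at h1
  have h3 : ∀ y, y = y₀ → ∀ v' w' : EuclideanSpace ℝ (Fin r), v' = v → w' = w →
      contract (α.extD (p y)) (mfderiv (𝓡 r) (𝓡 q) p y v') (mfderiv (𝓡 r) (𝓡 q) p y w') =
        contract (α.extD (p y₀)) (mfderiv (𝓡 r) (𝓡 q) p y₀ v) (mfderiv (𝓡 r) (𝓡 q) p y₀ w) := by
    rintro _ rfl _ _ rfl rfl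
    rfl
  refine (h3 _ (extChartAt_to_inv (I := 𝓡 r) y₀) _ _ (mfderiv_extChartAt_symm_self y₀ v)
    (mfderiv_extChartAt_symm_self y₀ w)).symm.trans (h1.trans ?_)
  exact sub_self (0 : ℝ)

/-- The tangent spaces of `p` and `f` are compared only on a dense set. This suffices: vanishing of
the form extends by continuity, isotropy for its differential follows, and the dimension of `P` can
be read off anywhere. Isotropic subspaces of the right dimension are Lagrangian. -/
theorem isContactLegendrian_of_range_eq [SecondCountableTopology K] [SecondCountableTopology P] [T2Space P] [T2Space Q]
    {η : OneForm q Q} (hη : ∀ z, ∃ R, IsReebData 0 (η.val z) (η.extD z) R)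
    (hf : ContMDiff (𝓡 c) (𝓡 q) ∞ f)
    (hLag : ∀ x, IsLagrangian 0 (η.val (f x)) (η.extD (f x)) (tangentRange c q f x))
    (hp : IsSubmanifold r q p) (hfp : range p = range f) : IsContactLegendrian r η p := by
  have hps := hp.immersion.contMDiff
  have hinj := mfderiv_injective_of_isImmersion hp.immersion
  have hQ : ∀ z : Q, Module.finrank ℝ (TangentSpace (𝓡 q) z) = q := fun z =>
    finrank_euclideanSpace_fin
  -- At each point `2 * rank + 1 = q`, so the division by two is exact.
  have hrank : ∀ x, Module.finrank ℝ
      (LinearMap.range (mfderiv (𝓡 c) (𝓡 q) f x).toLinearMap) = (q - 1) / 2 := fun x => by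
    obtain ⟨R, hR⟩ := hη (f x)
    have h1 := (hR.finrank_of_isLagrangian (hLag x)).trans (hQ _)
    change 2 * Module.finrank ℝ (LinearMap.range (mfderiv (𝓡 c) (𝓡 q) f x).toLinearMap) + 1 = q at h1
    omega
  have hdense := dense_setOf_range_mfderiv_le hf hps hrank hfp.le
  have hzero : ∀ y v, η.val (p y) (mfderiv (𝓡 r) (𝓡 q) p y v) = 0 := by
    refine η.val_mfderiv_eq_zero_of_dense hps (hdense.mono ?_)
    rintro y ⟨x, hxy, hx⟩ v
    obtain ⟨w, hw⟩ := hx v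
    have h1 : ∀ z, f x = z → η.val z (mfderiv (𝓡 c) (𝓡 q) f x w : EuclideanSpace ℝ (Fin q)) = 0 := by
      rintro _ rfl
      exact ((hLag x).1 _ ⟨w, rfl⟩).2
    exact (congrArg (η.val (p y)) hw).trans (h1 _ hxy)
  intro y
  obtain ⟨R, hR⟩ := hη (p y)
  rw [contactOrth, contactFlat_eq, hR.lambdaOrth_eq_self_iff]
  refine hR.isLagrangian_of_finrank ?_ ?_ ?_
  · rintro _ ⟨v, rfl⟩
    exact hzero y v
  · rintro _ ⟨v, rfl⟩ _ ⟨w, rfl⟩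
    exact η.extD_mfderiv_eq_zero hps hzero y v w
  · obtain ⟨x, hx⟩ := hfp.le ⟨y, rfl⟩
    obtain ⟨R', hR'⟩ := hη (f x)
    have h1 := (hR'.finrank_of_isLagrangian (hLag x)).trans (hQ _)
    change 2 * Module.finrank ℝ (LinearMap.range (mfderiv (𝓡 c) (𝓡 q) f x).toLinearMap) + 1 = q at h1
    have h2 := rank_le_of_range_subset hf hps hrank hfp.ge x
    have h3 : Module.finrank ℝ (tangentRange r q p y) = r :=
      (LinearMap.finrank_range_of_inj (hinj y)).trans finrank_euclideanSpace_fin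
    -- At a point `y'` of the dense set, the tangent space of `P` sits inside a Lagrangian one.
    have h4 : r ≤ (q - 1) / 2 := by
      obtain ⟨y', x', hxy, hx'⟩ := (@Dense.nonempty _ _ _ ⟨y⟩ hdense)
      have h5 : Module.finrank ℝ (tangentRange r q p y') = r :=
        (LinearMap.finrank_range_of_inj (hinj y')).trans finrank_euclideanSpace_fin
      let Wp : Submodule ℝ (EuclideanSpace ℝ (Fin q)) := tangentRange r q p y'
      let Wf : Submodule ℝ (EuclideanSpace ℝ (Fin q)) := tangentRange c q f x'
      have hle : Wp ≤ Wf := by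
        rintro _ ⟨v, rfl⟩
        obtain ⟨w, hw⟩ := hx' v
        exact ⟨w, hw.symm⟩
      exact h5.ge.trans ((Submodule.finrank_mono hle).trans (hrank x').le)
    rw [h3, hQ]
    rw [hrank x] at h1
    omega

end Legendrian

/-! ### Assembling the contact structure and the reduced Legendrian submanifold. -/

section Reduction

open Set

variable {m k q : ℕ}
  {M : Type*} [TopologicalSpace M] [ChartedSpace (EuclideanSpace ℝ (Fin m)) M]
  {N : Type u} [TopologicalSpace N] [ChartedSpace (EuclideanSpace ℝ (Fin k)) N]
  {i : N → M}

theorem IsCleanIntersection.range_comp {e c : ℕ}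
    {L : Type*} [TopologicalSpace L] [ChartedSpace (EuclideanSpace ℝ (Fin e)) L]
    {K : Type*} [TopologicalSpace K] [ChartedSpace (EuclideanSpace ℝ (Fin c)) K]
    {l : L → M} {a : K → L} {b : K → N} (hab : IsCleanIntersection m k e c l i a b)
    (hi : Function.Injective i) {Q : Type*} (pr : N → Q) :
    pr '' (i ⁻¹' range l) = range (pr ∘ b) := by
  apply subset_antisymm
  · rintro _ ⟨n, hn, rfl⟩
    obtain ⟨x, hx⟩ := hab.range_eq.ge ⟨hn, n, rfl⟩
    exact ⟨x, congrArg pr (hi ((congrFun hab.comm x).symm.trans hx))⟩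
  · rintro _ ⟨x, rfl⟩
    exact ⟨b x, ⟨a x, congrFun hab.comm x⟩, rfl⟩

variable {Q : Type*} [TopologicalSpace Q] [ChartedSpace (EuclideanSpace ℝ (Fin q)) Q]
  {pr : N → Q} [IsManifold (𝓡 m) ∞ M] [IsManifold (𝓡 k) ∞ N]

/-- Cleanness lifts a vector of `TL ∩ TN` to `T(L ∩ N)`, and injectivity of `di` identifies the
lift. The subspace `U` stands for the tangent space of `L`, moved from the base point `l (a x)` to
the equal point `i (b x)`. -/
theorem IsCleanIntersection.tangentRange_comp {e c : ℕ}
    {L : Type*} [TopologicalSpace L] [ChartedSpace (EuclideanSpace ℝ (Fin e)) L]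
    {K : Type*} [TopologicalSpace K] [ChartedSpace (EuclideanSpace ℝ (Fin c)) K]
    {l : L → M} {a : K → L} {b : K → N} (hab : IsCleanIntersection m k e c l i a b)
    (hi : IsSubmanifold k m i) (hl : ContMDiff (𝓡 e) (𝓡 m) ∞ l)
    (hpr : ContMDiff (𝓡 k) (𝓡 q) ∞ pr) (x : K)
    {U : Submodule ℝ (TangentSpace (𝓡 m) (i (b x)))}
    (hU : ∀ v : EuclideanSpace ℝ (Fin m), v ∈ U ↔
      ∃ w, (mfderiv (𝓡 e) (𝓡 m) l (a x) w : EuclideanSpace ℝ (Fin m)) = v) :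
    (U.comap (mfderiv (𝓡 k) (𝓡 m) i (b x)).toLinearMap).map
      (mfderiv (𝓡 k) (𝓡 q) pr (b x)).toLinearMap = tangentRange c q (pr ∘ b) x := by
  have hib := hi.immersion.contMDiff
  have hcomp : ∀ u : EuclideanSpace ℝ (Fin c),
      (mfderiv (𝓡 e) (𝓡 m) l (a x) (mfderiv (𝓡 c) (𝓡 e) a x u) : EuclideanSpace ℝ (Fin m)) =
      mfderiv (𝓡 k) (𝓡 m) i (b x) (mfderiv (𝓡 c) (𝓡 k) b x u) := by
    intro u
    have h1 := mfderiv_comp x ((hl _).mdifferentiableAt (by simp))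
      ((hab.smooth_left x).mdifferentiableAt (by simp))
    have h2 := mfderiv_comp x ((hib _).mdifferentiableAt (by simp))
      ((hab.smooth_right x).mdifferentiableAt (by simp))
    have h3 : ∀ g g' : K → M, g = g' →
        (mfderiv (𝓡 c) (𝓡 m) g x u : EuclideanSpace ℝ (Fin m)) = mfderiv (𝓡 c) (𝓡 m) g' x u := by
      rintro _ _ rfl
      rfl
    have h4 := h3 _ _ hab.comm
    rw [h1, h2] at h4
    exact h4
  have hprb := mfderiv_comp x ((hpr _).mdifferentiableAt (by simp))
    ((hab.smooth_right x).mdifferentiableAt (by simp))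
  have hproj : ∀ t t' : TangentBundle (𝓡 m) M, t = t' →
      t.proj = t'.proj ∧ (t.snd : EuclideanSpace ℝ (Fin m)) = t'.snd := by
    rintro _ _ rfl
    exact ⟨rfl, rfl⟩
  have hmk : ∀ y y' : M, y = y' → ∀ v v' : EuclideanSpace ℝ (Fin m), v = v' →
      (⟨y, v⟩ : TangentBundle (𝓡 m) M) = ⟨y', v'⟩ := by
    rintro _ _ rfl _ _ rfl
    rfl
  apply le_antisymm
  · rintro _ ⟨v, hv, rfl⟩
    obtain ⟨w, hw⟩ := (hU _).1 hv
    have hmem : tangentMap (𝓡 k) (𝓡 m) i ⟨b x, v⟩ ∈ range (tangentMap (𝓡 c) (𝓡 m) (l ∘ a)) := by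
      rw [hab.tangent_eq]
      exact ⟨⟨⟨a x, w⟩, hmk _ _ (congrFun hab.comm x) _ _ hw⟩, ⟨_, rfl⟩⟩
    obtain ⟨⟨x', u⟩, hu⟩ := hmem
    obtain ⟨h1, h2⟩ := hproj _ _ hu
    obtain rfl : x' = x := hab.submanifold.injective (h1.trans (congrFun hab.comm x).symm)
    refine ⟨u, ?_⟩
    have h3 := mfderiv_comp x' ((hl _).mdifferentiableAt (by simp))
      ((hab.smooth_left x').mdifferentiableAt (by simp))
    have h4 : (mfderiv (𝓡 c) (𝓡 k) b x' u : EuclideanSpace ℝ (Fin k)) = v := by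
      refine mfderiv_injective_of_isImmersion hi.immersion (b x') ((hcomp u).symm.trans ?_)
      refine Eq.trans ?_ h2
      exact congrArg (fun T : EuclideanSpace ℝ (Fin c) →L[ℝ] EuclideanSpace ℝ (Fin m) => T u) h3.symm
    subst h4
    exact congrArg (fun T : EuclideanSpace ℝ (Fin c) →L[ℝ] EuclideanSpace ℝ (Fin q) => T u) hprb
  · rintro _ ⟨u, rfl⟩
    refine ⟨mfderiv (𝓡 c) (𝓡 k) b x u, (hU _).2 ⟨_, hcomp u⟩, ?_⟩
    exact congrArg (fun T : EuclideanSpace ℝ (Fin c) →L[ℝ] EuclideanSpace ℝ (Fin q) => T u) hprb.symm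

variable [IsManifold (𝓡 q) ∞ Q] {θ η : OneForm m M} {ηN : OneForm q Q}

theorem IsLeafSpaceProjection.mfderiv_eq_zero_iff (hM : IsCocontact θ η) (hz : IsZVertical k θ η i)
    (ht : IsTHorizontal k θ i) (hpr : IsLeafSpaceProjection k q (orthDistribution k θ η i) pr)
    (x : N) (v : TangentSpace (𝓡 k) x) :
    mfderiv (𝓡 k) (𝓡 q) pr x v = 0 ↔ η.val (i x) (mfderiv (𝓡 k) (𝓡 m) i x v) = 0 ∧
      ∀ w, contract (η.extD (i x)) (mfderiv (𝓡 k) (𝓡 m) i x v)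
        (mfderiv (𝓡 k) (𝓡 m) i x w) = 0 := by
  rw [← mem_orthDistribution_iff hM hz ht, ← hpr.ker_mfderiv]
  rfl

theorem PullbacksAgree.exists_isReebData (hM : IsCocontact θ η) (hi : ContMDiff (𝓡 k) (𝓡 m) ∞ i)
    (hz : IsZVertical k θ η i) (ht : IsTHorizontal k θ i)
    (hpr : IsLeafSpaceProjection k q (orthDistribution k θ η i) pr)
    (h : PullbacksAgree k i η pr ηN) (z : Q) :
    ∃ R, IsReebData 0 (ηN.val z) (ηN.extD z) R := by
  obtain ⟨x, rfl⟩ := hpr.surjective z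
  obtain ⟨r, hr⟩ := hz x
  have hx := isReebData_reebZ hM hz ht x
  rw [← hr] at hx
  have hker := hpr.mfderiv_eq_zero_iff hM hz ht x
  exact ⟨_, IsReebData.quotient (I := (mfderiv (𝓡 k) (𝓡 m) i x).toLinearMap)
    (p := (mfderiv (𝓡 k) (𝓡 q) pr x).toLinearMap) hx
    (mfderiv_surjective_of_isSubmersion hpr.submersion x) (fun v h1 h2 => (hker v).2 ⟨h1, h2⟩)
    (fun v => (h x v).symm)
    (h.extD hpr.submersion hi fun v hv => ((hker v).1 hv).2)⟩

theorem isContact_of_exists_isReebData [Nonempty Q]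
    (h : ∀ z, ∃ R, IsReebData 0 (ηN.val z) (ηN.extD z) R) : IsContact ηN := by
  have key : ∀ z, ∃ n, q = 2 * n + 1 ∧ wedge (toAlt (ηN.val z)) (wedgePow (ηN.extD z) n) ≠ 0 := by
    intro z
    obtain ⟨R, hR⟩ := h z
    obtain ⟨n, hn, hw⟩ := wedge_ne_zero_of_nondegenerate hR.eta_reeb
      fun v hv hvw => hR.nondeg v rfl hv fun w _ hw => hvw w hw
    exact ⟨n, finrank_euclideanSpace_fin.symm.trans hn, hw⟩
  -- The exponent found at each point is determined by `q`, so it may be read off at any one point.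
  obtain ⟨n, hn, -⟩ := key (Classical.arbitrary Q)
  refine ⟨n, hn, fun z => ?_⟩
  obtain ⟨n', hn', hw⟩ := key z
  obtain rfl : n' = n := by omega
  exact hw

theorem PullbacksAgree.isLagrangian_tangentRange (hM : IsCocontact θ η) (hi : IsSubmanifold k m i)
    (hcois : IsCoisotropic k θ η i) (hz : IsZVertical k θ η i) (ht : IsTHorizontal k θ i)
    (hpr : IsLeafSpaceProjection k q (orthDistribution k θ η i) pr)
    (h : PullbacksAgree k i η pr ηN) {e c : ℕ}
    {L : Type*} [TopologicalSpace L] [ChartedSpace (EuclideanSpace ℝ (Fin e)) L]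
    {K : Type*} [TopologicalSpace K] [ChartedSpace (EuclideanSpace ℝ (Fin c)) K]
    {l : L → M} {a : K → L} {b : K → N} (hl : ContMDiff (𝓡 e) (𝓡 m) ∞ l)
    (hL : IsCocontactLegendrian e θ η l) (hab : IsCleanIntersection m k e c l i a b) (x : K) :
    IsLagrangian 0 (ηN.val (pr (b x))) (ηN.extD (pr (b x))) (tangentRange c q (pr ∘ b) x) := by
  have hx := isReebData_reebZ hM hz ht (b x)
  obtain ⟨r, hr⟩ := hz (b x)
  -- The base point is generalized in order to carry the tangent space of `L` over to `i (b x)`.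
  have hU : ∀ y t, l t = y → (∃ R, IsReebData (θ.val y) (η.val y) (η.extD y) R) →
      ∃ U : Submodule ℝ (TangentSpace (𝓡 m) y), IsLagrangian (θ.val y) (η.val y) (η.extD y) U ∧
        ∀ v : EuclideanSpace ℝ (Fin m), v ∈ U ↔
          ∃ w, (mfderiv (𝓡 e) (𝓡 m) l t w : EuclideanSpace ℝ (Fin m)) = v := by
    rintro _ t rfl ⟨R, hR⟩
    exact ⟨tangentRange e m l t, hR.lambdaOrth_eq_self_iff.1 (hL t), fun v => Iff.rfl⟩
  obtain ⟨U, hU, hUmem⟩ := hU _ _ (congrFun hab.comm x) ⟨_, hx⟩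
  rw [← hr] at hx
  have hker := hpr.mfderiv_eq_zero_iff hM hz ht (b x)
  rw [← hab.tangentRange_comp hi hl hpr.submersion.contMDiff x hUmem]
  exact IsReebData.isLagrangian_quotient (I := (mfderiv (𝓡 k) (𝓡 m) i (b x)).toLinearMap)
    (p := (mfderiv (𝓡 k) (𝓡 q) pr (b x)).toLinearMap) hx
    (fun v => ht (b x) ⟨v, rfl⟩)
    (fun w h1 h2 h3 => hcois (b x) ((mem_cocontactOrth_iff hM hz ht (b x) w).2 ⟨h1, h2, h3⟩))
    (mfderiv_surjective_of_isSubmersion hpr.submersion (b x))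
    (fun v h1 h2 => (hker v).2 ⟨h1, h2⟩) (fun v => (h (b x) v).symm)
    (h.extD hpr.submersion hi.immersion.contMDiff fun v hv => ((hker v).1 hv).2) hU

end Reduction

end CocontactReduction

end

theorem mainTheorem7
    {m k q : ℕ}
    {M : Type*} [TopologicalSpace M] [T2Space M] [SecondCountableTopology M]
    [ChartedSpace (EuclideanSpace ℝ (Fin m)) M] [IsManifold (𝓡 m) ∞ M]
    {N : Type*} [TopologicalSpace N] [T2Space N] [SecondCountableTopology N] [Nonempty N]
    [ChartedSpace (EuclideanSpace ℝ (Fin k)) N] [IsManifold (𝓡 k) ∞ N]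
    {Q : Type*} [TopologicalSpace Q] [T2Space Q] [SecondCountableTopology Q]
    [ChartedSpace (EuclideanSpace ℝ (Fin q)) Q] [IsManifold (𝓡 q) ∞ Q]
    (θ η : OneForm m M) (hM : IsCocontact θ η)
    (i : N → M) (hi : IsSubmanifold k m i)
    (hcois : IsCoisotropic k θ η i)
    (hz : IsZVertical k θ η i) (ht : IsTHorizontal k θ i)
    (pr : N → Q) (hpr : IsLeafSpaceProjection k q (orthDistribution k θ η i) pr) :
    ∃ ηN : OneForm q Q,
      (IsContact ηN ∧ PullbacksAgree k i η pr ηN) ∧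
      (∀ η' : OneForm q Q, PullbacksAgree k i η pr η' → η' = ηN) ∧
      ∀ {e c r : ℕ}
        {L : Type*} [TopologicalSpace L] [T2Space L] [SecondCountableTopology L]
        [ChartedSpace (EuclideanSpace ℝ (Fin e)) L] [IsManifold (𝓡 e) ∞ L]
        {K : Type*} [TopologicalSpace K] [T2Space K] [SecondCountableTopology K]
        [ChartedSpace (EuclideanSpace ℝ (Fin c)) K] [IsManifold (𝓡 c) ∞ K]
        {P : Type*} [TopologicalSpace P] [T2Space P] [SecondCountableTopology P]
        [ChartedSpace (EuclideanSpace ℝ (Fin r)) P] [IsManifold (𝓡 r) ∞ P]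
        (l : L → M) (a : K → L) (b : K → N) (p : P → Q),
        IsSubmanifold e m l → IsCocontactLegendrian e θ η l →
        IsCleanIntersection m k e c l i a b →
        IsSubmanifold r q p → Set.range p = pr '' (i ⁻¹' Set.range l) →
        IsContactLegendrian r ηN p := by
  have his := hi.immersion.contMDiff
  obtain ⟨ηN, hηN⟩ := hpr.exists_pullbacksAgree his
    fun x v hv => (mem_orthDistribution_iff hM hz ht x v).1 hv
  have hReeb := hηN.exists_isReebData hM his hz ht hpr
  have : Nonempty Q := Nonempty.map pr inferInstance
  refine ⟨ηN, ⟨isContact_of_exists_isReebData hReeb, hηN⟩,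
    fun η' h' => h'.unique hpr.submersion hpr.surjective hηN, ?_⟩
  intro e c r L _ _ _ _ _ K _ _ _ _ _ P _ _ _ _ _ l a b p hl hL hab hp hrange
  exact isContactLegendrian_of_range_eq hReeb
    (hpr.submersion.contMDiff.comp hab.smooth_right)
    (hηN.isLagrangian_tangentRange hM hi hcois hz ht hpr hl.immersion.contMDiff hL hab) hp
    (hrange.trans (hab.range_comp hi.injective pr))
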